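/- Theorem 2.6. Let $n\ge 1$, write $\xi=(\xi',\xi_n)\in\mathbb R^{n-1}\times\mathbb R$, $\langle\xi\rangle=(1+|\xi|^2)^{1/2}$, $\mathbb C_\pm=\{z\in\mathbb C: \operatorname{Im}z\gtrless 0\}$. *Function spaces.* $\mathcal H^+$ is the set of functions $t\mapsto\int_0^\infty e^{-ist}\varphi(s)\,ds$ on $\mathbb R$ with $\varphi\in\mathcal S(\mathbb R)$. $\mathcal H_{-1}$ is the set of $C^\infty$-functions $f$ on $\mathbb R$ such that $\tau^{-1}f(\tau^{-1})$ coincides for $0<|\tau|<1$ with a $C^\infty$-function on $(-1,1)$. For $f=g+P$ with $g\in\mathcal H_{-1}$ and $P$ a polynomial (both are then unique), $h_{-1}f=g$. For $d\in\mathbb R$, $S^d_{1,0}(\mathbb R^n,\mathbb R^{n-1},\mathcal H^+)$ is the set of $C^\infty$-functions $f(x,\xi',\xi_n)$ that are in $\mathcal H^+$ as functions of $\xi_n$, such that for all $k'\in\mathbb N_0$ the function $h_{-1}(\xi_n^{k'}f)$ (with $h_{-1}$ acting in $\xi_n$) is $C^\infty$ in $(x,\xi',\xi_n)$, and for all $\alpha\in\mathbb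 N_0^{n-1}$, $\beta\in\mathbb N_0^n$, $k,k'\in\mathbb N_0$, $$\|\partial_x^\beta\partial_{\xi'}^\alpha\partial_{\xi_n}^k h_{-1}(\xi_n^{k'}f(x,\xi',\xi_n))\|_{L_2(\mathbb R,\,d\xi_n)}\le C_{\alpha,\beta,k,k'}\,\langle\xi'\rangle^{d+\frac12-k+k'-|\alpha|}\quad\text{for all }x,\xi',$$ where the $C_{\alpha,\beta,k,k'}$ are continuous functions of $x$ (estimates local in $x$), respectively constants (estimates global in $x$). *Hypotheses.* Let $q(x,\xi)$ be a pseudodifferential symbol on $\mathbb R^n\times\mathbb R^n$ of order $0$, i.e. $q$ is a complex-valued $C^\infty$-function with $|\partial_x^\beta\partial_\xi^\alpha q(x,\xi)|\le C_{\alpha,\beta}\langle\xi\rangle^{-|\alpha|}$ for all $\alpha,\beta\in\mathbb N_0^n$, with $C_{\alpha,\beta}$ continuous functions of $x$. Assume that $q$ is homogeneous in $\xi$ of degree $0$ for $|\xi|\ge 1$ (that is, $q(x,s\xi)=q(x,\xi)$ for $|\xi|\ge1$, $s\ge1$), that it has the $0$-transmission property at all hyperplanes $\{x_n=c\}$, $$\partial_x^\beta\partial_\xi^\alpha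 q(x,0,-\xi_n)=(-1)^{|\alpha|}\partial_x^\beta\partial_\xi^\alpha q(x,0,\xi_n)\quad\text{for all }\alpha,\beta\in\mathbb N_0^n,\ x\in\mathbb R^n,\ |\xi_n|\ge1,$$ and that for some $\theta\in\mathbb R$ the values $q(x,\xi)$, for all $x,\xi\in\mathbb R^n$, avoid the ray $\{re^{i\theta}: r\ge0\}$. Let $s_0(x)=q(x,0,1)$. *Conclusion.* There are functions $q^\pm(x,\xi',\xi_n)$ with $$q(x,\xi)=s_0(x)\,q^-(x,\xi)\,q^+(x,\xi)\quad\text{for all }x,\xi\in\mathbb R^n,$$ such that for all $x,\xi'$ the function $q^{\pm}$ of $\xi_n$ extends from $\mathbb R$ to a function that is continuous and nowhere zero on $\overline{\mathbb C}_{\mp}$ and holomorphic in $\mathbb C_\mp$. Moreover $q^+=1+f$ and $\overline{q^-}=1+g$, where $f$ and $g$ belong to $S^0_{1,0}(\mathbb R^n,\mathbb R^{n-1},\mathcal H^+)$ with estimates local in $x$, and are homogeneous of degree $0$ in $\xi$ for $|\xi'|\ge1$. If in addition the $C_{\alpha,\beta}$ in the estimates of $q$ can be taken to be constants and $\inf_{x,\xi}|q(x,\xi)|>0$,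 then the estimates of $f$ and $g$ hold globally in $x$. -/

import Mathlib

open scoped ContDiff

noncomputable section

/-- `ℝᵏ` with its Euclidean norm. -/
abbrev Eu (k : ℕ) : Type := EuclideanSpace ℝ (Fin k)

/-- The partial derivative `∂_i g`. -/
def pderivCoord {k : ℕ} (i : Fin k) (g : Eu k → ℂ) : Eu k → ℂ :=
  fun x => fderiv ℝ g x (EuclideanSpace.single i 1)

/-- The derivative `∂^α g = ∂_1^{α_1} ⋯ ∂_k^{α_k} g` for a multi-index `α`. -/
def multiDeriv {k : ℕ} (α : Fin k → ℕ) (g : Eu k → ℂ) : Eu k → ℂ :=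
  (List.finRange k).foldr (fun i h => (pderivCoord i)^[α i] h) g

/-- The mixed derivative `∂_X^β ∂_{ξ'}^α ∂_{ξ_n}^k a (X, ξ', ξ_n)`. -/
def symDeriv {M m : ℕ} (β : Fin M → ℕ) (α : Fin m → ℕ) (k : ℕ)
    (a : Eu M → Eu m → ℝ → ℂ) (X : Eu M) (η : Eu m) (t : ℝ) : ℂ :=
  multiDeriv β (fun Y => multiDeriv α (fun ζ => iteratedDeriv k (a Y ζ) t) η) X

/-- `a (X, ξ', ξ_n)` is a `C^∞`-function of all variables jointly. -/
def JointlySmooth {M m : ℕ} (a : Eu M → Eu m → ℝ → ℂ) : Prop :=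
  ContDiff ℝ ∞ (fun p : Eu M × Eu m × ℝ => a p.1 p.2.1 p.2.2)

/-- `⟨ξ'⟩ = (1 + |ξ'|²)^{1/2}`. -/
def bracket {m : ℕ} (η : Eu m) : ℝ := Real.sqrt (1 + ‖η‖ ^ 2)

/-- `⟨ξ⟩ = (1 + |ξ|²)^{1/2}` for `ξ = (ξ', ξ_n)`. -/
def bracketFull {m : ℕ} (η : Eu m) (t : ℝ) : ℝ := Real.sqrt (1 + (‖η‖ ^ 2 + t ^ 2))

/-- `|ξ| ≥ 1` for `ξ = (ξ', ξ_n)`. -/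
def OutsideUnitBall {m : ℕ} (η : Eu m) (t : ℝ) : Prop := 1 ≤ Real.sqrt (‖η‖ ^ 2 + t ^ 2)

/-- The symbol space `S^r_{1,0}(ℝ^M × ℝ^{m+1})`, with estimates that are global in `X`. -/
def IsSymbol {M m : ℕ} (r : ℝ) (p : Eu M → Eu m → ℝ → ℂ) : Prop :=
  JointlySmooth p ∧
  ∀ (β : Fin M → ℕ) (α : Fin m → ℕ) (k : ℕ), ∃ C : ℝ, ∀ X η t,
    ‖symDeriv β α k p X η t‖ ≤ C * bracketFull η t ^ (r - ((∑ i, α i : ℕ) + k : ℝ))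

/-- The symbol space `S^r_{1,0}(ℝ^M × ℝ^{m+1})`, with estimates that are local in `X`: the
constants are continuous functions of `X`. -/
def IsSymbolLoc {M m : ℕ} (r : ℝ) (p : Eu M → Eu m → ℝ → ℂ) : Prop :=
  JointlySmooth p ∧
  ∀ (β : Fin M → ℕ) (α : Fin m → ℕ) (k : ℕ), ∃ C : Eu M → ℝ, Continuous C ∧ ∀ X η t,
    ‖symDeriv β α k p X η t‖ ≤ C X * bracketFull η t ^ (r - ((∑ i, α i : ℕ) + k : ℝ))

/-- The space `𝓗_d`: the `C^∞`-functions `f` on `ℝ` such that `τ^d f(τ⁻¹)` coincides with a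
`C^∞`-function for `-1 < τ < 1`. -/
def MemH (d : ℤ) (f : ℝ → ℂ) : Prop :=
  ContDiff ℝ ∞ f ∧
  ∃ k : ℝ → ℂ, ContDiffOn ℝ ∞ k (Set.Ioo (-1) 1) ∧
    ∀ τ ∈ Set.Ioo (-1 : ℝ) 1, τ ≠ 0 → k τ = (τ : ℂ) ^ d * f τ⁻¹

/-- The space `𝓗⁺ = 𝓕(e⁺ 𝓢₊)`: the Fourier transforms (with kernel `e^{-ixt}`) of the extensions
by zero of restrictions to `ℝ₊` of Schwartz functions. -/
def MemHPlus (f : ℝ → ℂ) : Prop :=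
  ∃ φ : SchwartzMap ℝ ℂ, ∀ t : ℝ,
    f t = ∫ x in Set.Ioi (0 : ℝ), Complex.exp (-Complex.I * x * t) * φ x

/-- A polynomial whose subtraction takes `f` into `𝓗_{-1}` is unique. -/
theorem polynomialPart_unique {f : ℝ → ℂ} {p r : Polynomial ℂ}
    (hp : MemH (-1) (fun t => f t - p.eval (t : ℂ)))
    (hr : MemH (-1) (fun t => f t - r.eval (t : ℂ))) : p = r := by
  have key : ∀ g : ℝ → ℂ, MemH (-1) g → Filter.Tendsto g Filter.atTop (nhds 0) := by
    rintro g ⟨-, k, hk, hkg⟩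
    have h0 : ContinuousAt k 0 :=
      hk.continuousOn.continuousAt (Ioo_mem_nhds (by norm_num) (by norm_num))
    have h1 : Filter.Tendsto (fun t : ℝ => ((t⁻¹ : ℝ) : ℂ) * k t⁻¹) Filter.atTop
        (nhds (((0 : ℝ) : ℂ) * k 0)) :=
      ((Complex.continuous_ofReal.tendsto 0).comp tendsto_inv_atTop_zero).mul
        (h0.tendsto.comp tendsto_inv_atTop_zero)
    rw [Complex.ofReal_zero, zero_mul] at h1
    refine h1.congr' ?_
    filter_upwards [Filter.eventually_gt_atTop 1] with t ht
    have ht0 : t ≠ 0 := by positivity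
    rw [hkg t⁻¹ ⟨by have : 0 < t⁻¹ := by positivity
                    linarith, inv_lt_one_of_one_lt₀ ht⟩ (inv_ne_zero ht0)]
    have : (t : ℂ) ≠ 0 := by exact_mod_cast ht0
    simp [this]
  have h := (key _ hr).sub (key _ hp)
  by_contra hne
  have hd : p - r ≠ 0 := sub_ne_zero.2 hne
  have h' : Filter.Tendsto (fun t : ℝ => (p - r).eval (t : ℂ)) Filter.atTop (nhds 0) := by
    simpa using h
  have hnorm : Filter.Tendsto (fun t : ℝ => ‖((t : ℝ) : ℂ)‖) Filter.atTop Filter.atTop := by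
    simpa using Filter.tendsto_abs_atTop_atTop (G := ℝ)
  rcases le_or_gt (p - r).degree 0 with hdeg | hdeg
  · rw [Polynomial.eq_C_of_degree_le_zero hdeg] at h' hd
    simp only [Polynomial.eval_C] at h'
    exact hd (by rw [tendsto_nhds_unique tendsto_const_nhds h', Polynomial.C_0])
  · exact not_tendsto_atTop_of_tendsto_nhds h'.norm
      (Polynomial.tendsto_norm_atTop (p - r) hdeg hnorm)

open Classical in
/-- The projection `h_{-1}`, which removes the polynomial part: on a sum of a function in `𝓗_{-1}`
and a polynomial it returns the function in `𝓗_{-1}`. -/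
def hMinusOne (f : ℝ → ℂ) : ℝ → ℂ :=
  if h : ∃ p : Polynomial ℂ, MemH (-1) (fun t => f t - p.eval (t : ℂ)) then
    fun t => f t - h.choose.eval (t : ℂ)
  else f

/-- The function `h_{-1}(ξ_n^{k'} f(X, ξ', ξ_n))`, with `h_{-1}` acting in `ξ_n`. -/
def hMinusOneMul {M m : ℕ} (k' : ℕ) (f : Eu M → Eu m → ℝ → ℂ) : Eu M → Eu m → ℝ → ℂ :=
  fun X η => hMinusOne (fun t => (t : ℂ) ^ k' * f X η t)

/-- What the spaces `S^d_{1,0}(ℝ^M, ℝ^m, 𝓗⁺)` with global and with local estimates have in common: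
`f` is smooth and in `𝓗⁺` with respect to `ξ_n`, and the functions `h_{-1}(ξ_n^{k'} f)` whose
derivatives are to be estimated are smooth. -/
def SmoothHPlusValued {M m : ℕ} (f : Eu M → Eu m → ℝ → ℂ) : Prop :=
  JointlySmooth f ∧ (∀ X η, MemHPlus (f X η)) ∧ ∀ k' : ℕ, JointlySmooth (hMinusOneMul k' f)

/-- The `L₂(ℝ)`-norm in `ξ_n` of `∂_X^β ∂_{ξ'}^α ∂_{ξ_n}^k h_{-1}(ξ_n^{k'} f)`. -/
def seminormHPlus {M m : ℕ} (β : Fin M → ℕ) (α : Fin m → ℕ) (k k' : ℕ)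
    (f : Eu M → Eu m → ℝ → ℂ) (X : Eu M) (η : Eu m) : ENNReal :=
  MeasureTheory.eLpNorm (fun t : ℝ => symDeriv β α k (hMinusOneMul k' f) X η t) 2
    MeasureTheory.volume

/-- The space `S^d_{1,0}(ℝ^M, ℝ^m, 𝓗⁺)`, with estimates that are global in `X`. -/
def MemSHPlus {M m : ℕ} (d : ℝ) (f : Eu M → Eu m → ℝ → ℂ) : Prop :=
  SmoothHPlusValued f ∧
  ∀ (β : Fin M → ℕ) (α : Fin m → ℕ) (k k' : ℕ), ∃ C : ℝ, ∀ X η,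
    seminormHPlus β α k k' f X η ≤
      ENNReal.ofReal (C * bracket η ^ (d + 1 / 2 - k + k' - (∑ i, α i : ℕ) : ℝ))

/-- The space `S^d_{1,0}(ℝ^M, ℝ^m, 𝓗⁺)`, with estimates that are local in `X`: the constants are
continuous functions of `X`. -/
def MemSHPlusLoc {M m : ℕ} (d : ℝ) (f : Eu M → Eu m → ℝ → ℂ) : Prop :=
  SmoothHPlusValued f ∧
  ∀ (β : Fin M → ℕ) (α : Fin m → ℕ) (k k' : ℕ), ∃ C : Eu M → ℝ, Continuous C ∧ ∀ X η,
    seminormHPlus β α k k' f X η ≤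
      ENNReal.ofReal (C X * bracket η ^ (d + 1 / 2 - k + k' - (∑ i, α i : ℕ) : ℝ))

/-- `q(x, ξ)` is homogeneous of degree `0` in `ξ` for `|ξ| ≥ 1`. -/
def HomogeneousZero {M m : ℕ} (q : Eu M → Eu m → ℝ → ℂ) : Prop :=
  ∀ x η t, OutsideUnitBall η t → ∀ s : ℝ, 1 ≤ s → q x (s • η) (s * t) = q x η t

/-- `f(x, ξ', ξ_n)` is homogeneous of degree `0` in `ξ = (ξ', ξ_n)` for `|ξ'| ≥ 1`. -/
def HomogeneousZeroTangential {M m : ℕ} (f : Eu M → Eu m → ℝ → ℂ) : Prop :=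
  ∀ x (η : Eu m) (t : ℝ), 1 ≤ ‖η‖ → ∀ s : ℝ, 1 ≤ s → f x (s • η) (s * t) = f x η t

/-- The `0`-transmission property at all hyperplanes `{x_n = c}`, for a symbol that is homogeneous
of degree `0`. The multi-index of the `ξ`-derivative is `(α, k)`. -/
def ZeroTransmission {M m : ℕ} (q : Eu M → Eu m → ℝ → ℂ) : Prop :=
  ∀ (β : Fin M → ℕ) (α : Fin m → ℕ) (k : ℕ) (x : Eu M) (t : ℝ), 1 ≤ |t| →
    symDeriv β α k q x 0 (-t) = (-1) ^ ((∑ i, α i) + k) * symDeriv β α k q x 0 t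

/-- All values of `q` avoid the ray `{r e^{iθ} ∣ r ≥ 0}`. -/
def AvoidsRay {M m : ℕ} (θ : ℝ) (q : Eu M → Eu m → ℝ → ℂ) : Prop :=
  ∀ x η t, ∀ r : ℝ, 0 ≤ r → q x η t ≠ r * Complex.exp (θ * Complex.I)

/-- The function `u` on `ℝ` extends to a function that is continuous on the closure of the
half-plane `U`, holomorphic in `U`, and without zeros on the closure. -/
def InvertibleHolomorphicExtension (U : Set ℂ) (u : ℝ → ℂ) : Prop :=
  ∃ g : ℂ → ℂ, DiffContOnCl ℂ g U ∧ (∀ t : ℝ, g t = u t) ∧ ∀ z ∈ closure U, g z ≠ 0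

end

/-! Through ξ_n = cot(φ/2) the line together with its point at infinity becomes a circle, on which
e^{iφ} = (ξ_n + i)/(ξ_n − i); the lower half-plane becomes the unit disc and ξ_n = ∞ becomes φ = 0,
e^{iφ} = 1. Homogeneity rewrites q(x, ξ', 1/u) for small u as q(x, uξ', 1) if u > 0 and as q(x,
−uξ', −1) if u < 0. The transmission property says exactly that these two functions of uξ' have the
same Taylor expansion at 0, so q is smooth on the whole circle, with value s_0(x) at infinity
(`LocSmoothBdd.circleSymbol`).

Since the values avoid a ray, q has a smooth logarithm ψ on the circle. Split ψ − ψ(∞) into its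
parts with positive and with negative frequencies, each normalised to vanish at infinity. The first
extends holomorphically to the disc, the second to its exterior; their exponentials are q^+ and q^-,
without zeros because they are exponentials. The conjugate of the negative part of ψ is the positive
part of ψ̄, so a single projection `hardyProj` serves both factors. It is the convolution of ψ''
with the continuous kernel −∑ e^{iks}/k²; thus smoothness and bounds in the parameters come from
differentiation under the integral sign.

Membership in 𝓗⁺ (`memHPlus_comp_circleAngle`): Borel's lemma gives a one-sided transform with the
same expansion at infinity; the remainder is Schwartz and splits into a one-sided transform and the
conjugate of one. Uniqueness of the splitting (`eq_zero_of_add_conj_eq_zero`) removes the conjugate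
part. The same uniqueness gives homogeneity of the factors, since a dilation of ξ_n acts on the disc
by an automorphism that fixes 1.

For the estimates, `SymbolPair` records a homogeneous function together with its smooth continuation
across ξ_n = ∞, where it vanishes. This class is stable under all derivatives and under
multiplication by ξ_n with removal of the constant at infinity, which is how h_{-1} acts. On ‖ξ'‖ ≤
2 its members are O((1 + ξ_n²)^{-1/2}); homogeneity and scaling of the L₂-norm then give the powers
of ⟨ξ'⟩ (`SymbolPair.exists_eLpNorm_le`).

Bounds are carried throughout uniformly in x over an open set S. Taking S to be the whole space
gives the global estimates; taking balls gives the local ones, and also the joint smoothness. -/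

open Set Filter Topology

/-! ### Functions with all derivatives bounded on a set. -/

section SmoothBdd

variable {P R G G' : Type} [NormedAddCommGroup P] [NormedSpace ℝ P]
  [NormedAddCommGroup R] [NormedSpace ℝ R]
  [NormedAddCommGroup G] [NormedSpace ℝ G] [NormedAddCommGroup G'] [NormedSpace ℝ G']

/-- `F` is smooth on `A` and each of its iterated derivatives is bounded on `A`. -/
def SmoothBddOn (A : Set P) (F : P → G) : Prop :=
  ContDiffOn ℝ ∞ F A ∧ ∀ n : ℕ, ∃ C : ℝ, ∀ p ∈ A, ‖iteratedFDeriv ℝ n F p‖ ≤ C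

theorem SmoothBddOn.mono {A B : Set P} {F : P → G} (h : SmoothBddOn B F) (hAB : A ⊆ B) :
    SmoothBddOn A F :=
  ⟨h.1.mono hAB, fun n => (h.2 n).imp fun _ hC p hp => hC p (hAB hp)⟩

theorem SmoothBddOn.congr {A : Set P} (hA : IsOpen A) {F F' : P → G} (h : SmoothBddOn A F)
    (he : EqOn F' F A) : SmoothBddOn A F' := by
  refine ⟨h.1.congr he, fun n => (h.2 n).imp fun C hC p hp => ?_⟩
  have : F' =ᶠ[𝓝 p] F := by filter_upwards [hA.mem_nhds hp] with y hy using he hy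
  rw [(this.iteratedFDeriv ℝ n).eq_of_nhds]
  exact hC p hp

theorem SmoothBddOn.exists_bound_le {A : Set P} {F : P → G} (h : SmoothBddOn A F) (n : ℕ) :
    ∃ C : ℝ, 0 ≤ C ∧ ∀ i ≤ n, ∀ p ∈ A, ‖iteratedFDeriv ℝ i F p‖ ≤ C := by
  choose C hC using h.2
  refine ⟨∑ i ∈ Finset.range (n + 1), |C i|, Finset.sum_nonneg fun _ _ => abs_nonneg _,
    fun i hi p hp => ((hC i p hp).trans (le_abs_self _)).trans ?_⟩
  exact Finset.single_le_sum (f := fun i => |C i|) (fun _ _ => abs_nonneg _)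
    (Finset.mem_range.2 (by omega))

theorem SmoothBddOn.bounded {A : Set P} {F : P → G} (h : SmoothBddOn A F) :
    ∃ C : ℝ, ∀ p ∈ A, ‖F p‖ ≤ C := by
  obtain ⟨C, hC⟩ := h.2 0
  exact ⟨C, fun p hp => by simpa using hC p hp⟩

theorem SmoothBddOn.const {A : Set P} (c : G) : SmoothBddOn A (fun _ => c) := by
  refine ⟨contDiffOn_const, fun n => ⟨‖c‖, fun p _ => ?_⟩⟩
  rcases n with _ | n
  · simp
  · simp [iteratedFDeriv_succ_const]

theorem SmoothBddOn.bilinear {A : Set P} (hA : IsOpen A) (B : G →L[ℝ] R →L[ℝ] G')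
    {F : P → G} {H : P → R} (hF : SmoothBddOn A F) (hH : SmoothBddOn A H) :
    SmoothBddOn A (fun p => B (F p) (H p)) := by
  refine ⟨B.isBoundedBilinearMap.contDiff.comp₂_contDiffOn hF.1 hH.1, fun n => ?_⟩
  obtain ⟨C, hC0, hC⟩ := hF.exists_bound_le n
  obtain ⟨D, hD0, hD⟩ := hH.exists_bound_le n
  refine ⟨‖B‖ * ∑ i ∈ Finset.range (n + 1), (n.choose i : ℝ) * C * D, fun p hp => ?_⟩
  have := B.norm_iteratedFDerivWithin_le_of_bilinear hF.1 hH.1 hA.uniqueDiffOn hp (n := n)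
    (by exact_mod_cast le_top)
  rw [iteratedFDerivWithin_of_isOpen n hA hp] at this
  refine this.trans ?_
  gcongr with i hi
  · rw [iteratedFDerivWithin_of_isOpen i hA hp]
    exact hC i (by simp at hi; omega) p hp
  · rw [iteratedFDerivWithin_of_isOpen (n - i) hA hp]
    exact hD _ (by omega) p hp

theorem SmoothBddOn.clm_comp {A : Set P} (hA : IsOpen A) (B : G →L[ℝ] G')
    {F : P → G} (hF : SmoothBddOn A F) : SmoothBddOn A (fun p => B (F p)) := by
  refine ⟨B.contDiff.comp_contDiffOn hF.1, fun n => ?_⟩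
  obtain ⟨C, hC⟩ := hF.2 n
  refine ⟨‖B‖ * C, fun p hp => ?_⟩
  refine (B.norm_iteratedFDeriv_comp_left (hF.1.contDiffAt (hA.mem_nhds hp))
    (by exact_mod_cast le_top)).trans ?_
  gcongr
  exact hC p hp

theorem SmoothBddOn.add {A : Set P} (hA : IsOpen A) {F H : P → G}
    (hF : SmoothBddOn A F) (hH : SmoothBddOn A H) : SmoothBddOn A (fun p => F p + H p) := by
  refine ⟨hF.1.add hH.1, fun n => ?_⟩
  obtain ⟨C, hC⟩ := hF.2 n
  obtain ⟨D, hD⟩ := hH.2 n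
  refine ⟨C + D, fun p hp => ?_⟩
  have h1 : ContDiffAt ℝ n F p := (hF.1.contDiffAt (hA.mem_nhds hp)).of_le (by exact_mod_cast le_top)
  have h2 : ContDiffAt ℝ n H p := (hH.1.contDiffAt (hA.mem_nhds hp)).of_le (by exact_mod_cast le_top)
  have := iteratedFDeriv_add_apply h1 h2
  change ‖iteratedFDeriv ℝ n (F + H) p‖ ≤ _
  rw [this]
  exact (norm_add_le _ _).trans (add_le_add (hC p hp) (hD p hp))

theorem SmoothBddOn.neg {A : Set P} (hA : IsOpen A) {F : P → G}
    (hF : SmoothBddOn A F) : SmoothBddOn A (fun p => - F p) :=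
  hF.clm_comp hA (-ContinuousLinearMap.id ℝ G)

theorem SmoothBddOn.sub {A : Set P} (hA : IsOpen A) {F H : P → G}
    (hF : SmoothBddOn A F) (hH : SmoothBddOn A H) : SmoothBddOn A (fun p => F p - H p) := by
  simpa [sub_eq_add_neg] using hF.add hA (hH.neg hA)

theorem SmoothBddOn.mul {A : Set P} (hA : IsOpen A) {F H : P → ℂ}
    (hF : SmoothBddOn A F) (hH : SmoothBddOn A H) : SmoothBddOn A (fun p => F p * H p) :=
  hF.bilinear hA (ContinuousLinearMap.mul ℝ ℂ) hH

theorem SmoothBddOn.fderiv {A : Set P} (hA : IsOpen A) {F : P → G} (hF : SmoothBddOn A F) :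
    SmoothBddOn A (fderiv ℝ F) := by
  refine ⟨hF.1.fderiv_of_isOpen hA (by norm_cast), fun n => ?_⟩
  simpa only [norm_iteratedFDeriv_fderiv] using hF.2 (n + 1)

/-- Separates the bound on the values from that on the derivatives. Logarithms need this, because
the two bounds have different reasons there. -/
theorem SmoothBddOn.of_fderiv {A : Set P} (hA : IsOpen A) {F : P → G}
    (hd : DifferentiableOn ℝ F A) (hb : ∃ C : ℝ, ∀ p ∈ A, ‖F p‖ ≤ C)
    (hF : SmoothBddOn A (_root_.fderiv ℝ F)) : SmoothBddOn A F := by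
  refine ⟨(contDiffOn_infty_iff_fderiv_of_isOpen hA).2 ⟨hd, hF.1⟩, fun n => ?_⟩
  rcases n with _ | n
  · simpa using hb
  · simpa only [norm_iteratedFDeriv_fderiv] using hF.2 n

/-- Composition, with bounds on the outer function only at the values of the inner one, and on the
inner one only for its proper derivatives. -/
theorem smoothBddOn_comp {A : Set P} {B : Set R} (hA : IsOpen A) (hB : IsOpen B)
    {F : R → G} {γ : P → R} (hF : ContDiffOn ℝ ∞ F B) (hγ : ContDiffOn ℝ ∞ γ A)
    (hm : MapsTo γ A B)
    (hFb : ∀ n : ℕ, ∃ C : ℝ, ∀ p ∈ A, ‖iteratedFDeriv ℝ n F (γ p)‖ ≤ C)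
    (hγb : ∀ n : ℕ, ∃ C : ℝ, ∀ p ∈ A, ‖iteratedFDeriv ℝ (n + 1) γ p‖ ≤ C) :
    SmoothBddOn A (fun p => F (γ p)) := by
  refine ⟨hF.comp hγ hm, fun n => ?_⟩
  choose C hC using hFb
  choose D hD using hγb
  have hD1 : 1 ≤ 1 + ∑ i ∈ Finset.range n, |D i| := by
    have : 0 ≤ ∑ i ∈ Finset.range n, |D i| := Finset.sum_nonneg fun _ _ => abs_nonneg _
    linarith
  refine ⟨n.factorial * (∑ i ∈ Finset.range (n + 1), |C i|) *
    (1 + ∑ i ∈ Finset.range n, |D i|) ^ n, fun p hp => ?_⟩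
  have := norm_iteratedFDerivWithin_comp_le (n := n) (C := ∑ i ∈ Finset.range (n + 1), |C i|)
    (D := 1 + ∑ i ∈ Finset.range n, |D i|) hF hγ (by exact_mod_cast le_top) hB.uniqueDiffOn
    hA.uniqueDiffOn hm hp ?_ ?_
  · rwa [iteratedFDerivWithin_of_isOpen n hA hp] at this
  · intro i hi
    rw [iteratedFDerivWithin_of_isOpen i hB (hm hp)]
    refine ((hC i p hp).trans (le_abs_self _)).trans ?_
    exact Finset.single_le_sum (f := fun i => |C i|) (fun _ _ => abs_nonneg _)
      (Finset.mem_range.2 (by omega))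
  · intro i hi1 hi
    rw [iteratedFDerivWithin_of_isOpen i hA hp]
    obtain ⟨j, rfl⟩ : ∃ j, i = j + 1 := ⟨i - 1, by omega⟩
    refine ((hD j p hp).trans (le_abs_self _)).trans ?_
    refine le_trans ?_ (le_self_pow₀ hD1 (by omega))
    refine (Finset.single_le_sum (f := fun i => |D i|) (fun _ _ => abs_nonneg _)
      (Finset.mem_range.2 (by omega : j < n))).trans (by linarith)

theorem SmoothBddOn.comp {A : Set P} {B : Set R} (hA : IsOpen A) (hB : IsOpen B)
    {F : R → G} {γ : P → R} (hF : SmoothBddOn B F) (hγ : ContDiffOn ℝ ∞ γ A)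
    (hm : MapsTo γ A B)
    (hγb : ∀ n : ℕ, ∃ C : ℝ, ∀ p ∈ A, ‖iteratedFDeriv ℝ (n + 1) γ p‖ ≤ C) :
    SmoothBddOn A (fun p => F (γ p)) :=
  smoothBddOn_comp hA hB hF.1 hγ hm
    (fun n => (hF.2 n).imp fun _ hC _ hp => hC _ (hm hp)) hγb

/-- Composition with a function that is smooth near a compact set containing all values. -/
theorem SmoothBddOn.comp_left {A : Set P} {B K : Set R} (hA : IsOpen A) (hB : IsOpen B)
    (hK : IsCompact K) (hKB : K ⊆ B)
    {F : R → G} {γ : P → R} (hF : ContDiffOn ℝ ∞ F B) (hγ : SmoothBddOn A γ)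
    (hm : MapsTo γ A K) : SmoothBddOn A (fun p => F (γ p)) := by
  refine smoothBddOn_comp hA hB hF hγ.1 (hm.mono_right hKB) (fun n => ?_) (fun n => hγ.2 _)
  have : ContinuousOn (iteratedFDeriv ℝ n F) K := by
    have h1 : ContinuousOn (iteratedFDerivWithin ℝ n F B) B :=
      hF.continuousOn_iteratedFDerivWithin (by exact_mod_cast le_top) hB.uniqueDiffOn
    exact (h1.congr fun x hx => (iteratedFDerivWithin_of_isOpen n hB hx).symm).mono hKB
  obtain ⟨C, hC⟩ := hK.exists_bound_of_continuousOn this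
  exact ⟨C, fun p hp => hC _ (hm hp)⟩

theorem ContDiff.smoothBddOn_of_subset_isCompact {A K : Set P} {F : P → G} (hF : ContDiff ℝ ∞ F)
    (hK : IsCompact K) (hA : A ⊆ K) : SmoothBddOn A F := by
  refine ⟨hF.contDiffOn, fun n => ?_⟩
  obtain ⟨C, hC⟩ := hK.exists_bound_of_continuousOn
    (hF.continuous_iteratedFDeriv (m := n) (by exact_mod_cast le_top)).continuousOn
  exact ⟨C, fun p hp => hC p (hA hp)⟩

theorem SmoothBddOn.union {A B : Set P} (hA : IsOpen A) (hB : IsOpen B) {F : P → G}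
    (h1 : SmoothBddOn A F) (h2 : SmoothBddOn B F) : SmoothBddOn (A ∪ B) F := by
  refine ⟨fun p hp => ?_, fun n => ?_⟩
  · rcases hp with hp | hp
    · exact (h1.1.contDiffAt (hA.mem_nhds hp)).contDiffWithinAt
    · exact (h2.1.contDiffAt (hB.mem_nhds hp)).contDiffWithinAt
  · obtain ⟨C, hC⟩ := h1.2 n
    obtain ⟨D, hD⟩ := h2.2 n
    refine ⟨max C D, fun p hp => ?_⟩
    rcases hp with hp | hp
    · exact (hC p hp).trans (le_max_left _ _)
    · exact (hD p hp).trans (le_max_right _ _)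

theorem SmoothBddOn.hasFDerivAt_integral {A : Set P} {J : Set ℝ} (hA : IsOpen A) (hJ : IsOpen J)
    {a b : ℝ} (hab : uIcc a b ⊆ J) {k : ℝ → ℝ} (hk : IntervalIntegrable k MeasureTheory.volume a b)
    {H : P × ℝ → G} (hH : SmoothBddOn (A ×ˢ J) H) {p : P} (hp : p ∈ A) :
    HasFDerivAt (fun p => ∫ s in a..b, k s • H (p, s))
      (∫ s in a..b, k s • (_root_.fderiv ℝ H (p, s)).comp (ContinuousLinearMap.inl ℝ P ℝ)) p := by
  have hAJ : IsOpen (A ×ˢ J) := hA.prod hJ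
  obtain ⟨C, hC⟩ := (hH.fderiv hAJ).bounded
  have hsub : uIoc a b ⊆ J := uIoc_subset_uIcc.trans hab
  have hcont : ∀ p ∈ A, ContinuousOn (fun s => H (p, s)) (uIcc a b) := fun p hp =>
    hH.1.continuousOn.comp (by fun_prop) fun s hs => ⟨hp, hab hs⟩
  have hcont' : ∀ p ∈ A, ContinuousOn (fun s => (_root_.fderiv ℝ H (p, s)).comp
      (ContinuousLinearMap.inl ℝ P ℝ)) (uIcc a b) := fun p hp =>
    ContinuousOn.clm_comp ((hH.fderiv hAJ).1.continuousOn.comp (by fun_prop)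
      fun s hs => ⟨hp, hab hs⟩) continuousOn_const
  refine intervalIntegral.hasFDerivAt_integral_of_dominated_of_fderiv_le
    (bound := fun s => |k s| * |C|) (F := fun p s => k s • H (p, s))
    (F' := fun p s => k s • (_root_.fderiv ℝ H (p, s)).comp (ContinuousLinearMap.inl ℝ P ℝ))
    (hA.mem_nhds hp) ?_ ?_ ?_ ?_ ?_ ?_
  · filter_upwards [hA.mem_nhds hp] with p hp
    exact (hk.smul_continuousOn (hcont p hp)).def'.aestronglyMeasurable
  · exact hk.smul_continuousOn (hcont p hp)
  · exact (hk.smul_continuousOn (hcont' p hp)).def'.aestronglyMeasurable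
  · refine Eventually.of_forall fun s hs p hp => ?_
    rw [norm_smul, Real.norm_eq_abs]
    gcongr
    refine (ContinuousLinearMap.opNorm_comp_le _ _).trans ?_
    refine (mul_le_of_le_one_right (norm_nonneg _)
      (ContinuousLinearMap.norm_inl_le_one ℝ P ℝ)).trans ?_
    exact (hC (p, s) ⟨hp, hsub hs⟩).trans (le_abs_self _)
  · exact hk.abs.mul_const _
  · refine Eventually.of_forall fun s hs p hp => ?_
    have h1 : HasFDerivAt H (_root_.fderiv ℝ H (p, s)) (p, s) :=
      ((hH.1.contDiffAt (hAJ.mem_nhds ⟨hp, hsub hs⟩)).differentiableAt (by simp)).hasFDerivAt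
    have h2 : HasFDerivAt (fun p : P => (p, s)) (ContinuousLinearMap.inl ℝ P ℝ) p :=
      hasFDerivAt_prodMk_left p s
    exact (h1.comp p h2).const_smul (k s)

/-- The derivative in the parameter is an integral of the same form, with the partial derivative of
`H` as integrand. Both inductions on the order therefore let the target space vary. -/
theorem SmoothBddOn.integral {A : Set P} {J : Set ℝ} (hA : IsOpen A) (hJ : IsOpen J)
    {a b : ℝ} (hab : uIcc a b ⊆ J) {k : ℝ → ℝ} (hk : IntervalIntegrable k MeasureTheory.volume a b)
    {H : P × ℝ → G} (hH : SmoothBddOn (A ×ˢ J) H) :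
    SmoothBddOn A (fun p => ∫ s in a..b, k s • H (p, s)) := by
  have hAJ : IsOpen (A ×ˢ J) := hA.prod hJ
  have hd := fun (G : Type) [NormedAddCommGroup G] [NormedSpace ℝ G] (H : P × ℝ → G)
    (hH : SmoothBddOn (A ×ˢ J) H) p (hp : p ∈ A) => hH.hasFDerivAt_integral hA hJ hab hk hp
  have hs : ∀ (G : Type) [NormedAddCommGroup G] [NormedSpace ℝ G] (H : P × ℝ → G)
      (_ : SmoothBddOn (A ×ˢ J) H), SmoothBddOn (A ×ˢ J)
        (fun z => (_root_.fderiv ℝ H z).comp (ContinuousLinearMap.inl ℝ P ℝ)) :=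
    fun G _ _ H hH => (hH.fderiv hAJ).clm_comp hAJ
      ((ContinuousLinearMap.compL ℝ P (P × ℝ) G).flip (ContinuousLinearMap.inl ℝ P ℝ))
  constructor
  · refine contDiffOn_infty.2 fun n => ?_
    induction n generalizing G with
    | zero => exact contDiffOn_zero.2 fun p hp => (hd G H hH p hp).continuousAt.continuousWithinAt
    | succ n ih =>
      refine (contDiffOn_succ_iff_fderiv_of_isOpen hA).2
        ⟨fun p hp => (hd G H hH p hp).differentiableAt.differentiableWithinAt,
          fun h => absurd h (WithTop.natCast_ne_top n), ?_⟩
      exact (ih (hs G H hH)).congr fun p hp => (hd G H hH p hp).fderiv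
  · intro n
    induction n generalizing G with
    | zero =>
      obtain ⟨C, hC⟩ := hH.bounded
      refine ⟨abs (∫ s in a..b, |k s| * |C|), fun p hp => ?_⟩
      rw [norm_iteratedFDeriv_zero]
      refine intervalIntegral.norm_integral_le_abs_of_norm_le ?_ (hk.abs.mul_const _)
      refine (MeasureTheory.ae_restrict_iff' measurableSet_uIoc).2
        (Eventually.of_forall fun s hs => ?_)
      rw [norm_smul, Real.norm_eq_abs]
      gcongr
      exact (hC (p, s) ⟨hp, hab (uIoc_subset_uIcc hs)⟩).trans (le_abs_self _)
    | succ n ih =>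
      obtain ⟨C, hC⟩ := ih (hs G H hH)
      refine ⟨C, fun p hp => ?_⟩
      rw [← norm_iteratedFDeriv_fderiv]
      have : (_root_.fderiv ℝ fun p => ∫ s in a..b, k s • H (p, s)) =ᶠ[𝓝 p]
          fun p => ∫ s in a..b, k s • (_root_.fderiv ℝ H (p, s)).comp
            (ContinuousLinearMap.inl ℝ P ℝ) := by
        filter_upwards [hA.mem_nhds hp] with p hp using (hd G H hH p hp).fderiv
      rw [(this.iteratedFDeriv ℝ n).eq_of_nhds]
      exact hC p hp

end SmoothBdd

/-! ### Bounds uniform in x and local in the remaining variables. -/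

section LocSmoothBdd

variable {E V V' G G' : Type} [NormedAddCommGroup E] [NormedSpace ℝ E]
  [NormedAddCommGroup V] [NormedSpace ℝ V] [NormedAddCommGroup V'] [NormedSpace ℝ V']
  [NormedAddCommGroup G] [NormedSpace ℝ G] [NormedAddCommGroup G'] [NormedSpace ℝ G']

/-- Near `v`, the function `F (x, v')` is smooth with derivatives bounded uniformly in `x ∈ S`. -/
def LocSmoothBddAt (S : Set E) (F : E × V → G) (v : V) : Prop :=
  ∃ N : Set V, IsOpen N ∧ v ∈ N ∧ SmoothBddOn (S ×ˢ N) F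

/-- `F (x, v)` is smooth for `x ∈ S`, with derivatives bounded uniformly in `x ∈ S` and locally
in `v`. -/
def LocSmoothBdd (S : Set E) (F : E × V → G) : Prop := ∀ v, LocSmoothBddAt S F v

variable {S : Set E} {v : V}

theorem LocSmoothBddAt.congr (hS : IsOpen S) {F F' : E × V → G} (h : LocSmoothBddAt S F v)
    (he : ∀ᶠ v' in 𝓝 v, ∀ x ∈ S, F' (x, v') = F (x, v')) : LocSmoothBddAt S F' v := by
  obtain ⟨N, hN, hv, h⟩ := h
  obtain ⟨N', hN's, hN', hv'⟩ := eventually_nhds_iff.1 he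
  refine ⟨N ∩ N', hN.inter hN', ⟨hv, hv'⟩, ?_⟩
  refine SmoothBddOn.congr (hS.prod (hN.inter hN')) (h.mono (prod_mono_right inter_subset_left)) ?_
  rintro ⟨x, w⟩ ⟨hx, hw⟩
  exact hN's w hw.2 x hx

theorem LocSmoothBddAt.binary {G₁ G₂ : Type} [NormedAddCommGroup G₁] [NormedSpace ℝ G₁]
    [NormedAddCommGroup G₂] [NormedSpace ℝ G₂] (hS : IsOpen S)
    {F : E × V → G} {H : E × V → G₁} {R : E × V → G₂}
    (hR : ∀ A : Set (E × V), IsOpen A → SmoothBddOn A F → SmoothBddOn A H → SmoothBddOn A R)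
    (hF : LocSmoothBddAt S F v) (hH : LocSmoothBddAt S H v) : LocSmoothBddAt S R v := by
  obtain ⟨N, hN, hv, h⟩ := hF
  obtain ⟨N', hN', hv', h'⟩ := hH
  exact ⟨N ∩ N', hN.inter hN', ⟨hv, hv'⟩, hR _ (hS.prod (hN.inter hN'))
    (h.mono (prod_mono_right inter_subset_left)) (h'.mono (prod_mono_right inter_subset_right))⟩

theorem LocSmoothBddAt.add (hS : IsOpen S) {F H : E × V → G} (hF : LocSmoothBddAt S F v)
    (hH : LocSmoothBddAt S H v) : LocSmoothBddAt S (fun p => F p + H p) v :=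
  .binary hS (fun _ hA h1 h2 => h1.add hA h2) hF hH

theorem LocSmoothBddAt.sub (hS : IsOpen S) {F H : E × V → G} (hF : LocSmoothBddAt S F v)
    (hH : LocSmoothBddAt S H v) : LocSmoothBddAt S (fun p => F p - H p) v :=
  .binary hS (fun _ hA h1 h2 => h1.sub hA h2) hF hH

theorem LocSmoothBddAt.mul (hS : IsOpen S) {F H : E × V → ℂ} (hF : LocSmoothBddAt S F v)
    (hH : LocSmoothBddAt S H v) : LocSmoothBddAt S (fun p => F p * H p) v :=
  .binary hS (fun _ hA h1 h2 => h1.mul hA h2) hF hH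

theorem LocSmoothBddAt.const (c : G) : LocSmoothBddAt S (fun _ : E × V => c) v :=
  ⟨univ, isOpen_univ, mem_univ _, .const c⟩

theorem LocSmoothBddAt.clm_comp (hS : IsOpen S) (B : G →L[ℝ] G') {F : E × V → G}
    (h : LocSmoothBddAt S F v) : LocSmoothBddAt S (fun p => B (F p)) v := by
  obtain ⟨N, hN, hv, h⟩ := h
  exact ⟨N, hN, hv, h.clm_comp (hS.prod hN) B⟩

theorem LocSmoothBddAt.fderiv (hS : IsOpen S) {F : E × V → G}
    (h : LocSmoothBddAt S F v) : LocSmoothBddAt S (fderiv ℝ F) v := by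
  obtain ⟨N, hN, hv, h⟩ := h
  exact ⟨N, hN, hv, h.fderiv (hS.prod hN)⟩

theorem LocSmoothBddAt.fderiv_apply (hS : IsOpen S) {F : E × V → G}
    (h : LocSmoothBddAt S F v) (w : E × V) :
    LocSmoothBddAt S (fun p => _root_.fderiv ℝ F p w) v :=
  (h.fderiv hS).clm_comp hS (ContinuousLinearMap.apply ℝ G w)

theorem LocSmoothBddAt.contDiffAt (hS : IsOpen S) {F : E × V → G}
    (h : LocSmoothBddAt S F v) {x : E} (hx : x ∈ S) : ContDiffAt ℝ ∞ F (x, v) := by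
  obtain ⟨N, hN, hv, h⟩ := h
  exact h.1.contDiffAt ((hS.prod hN).mem_nhds ⟨hx, hv⟩)

theorem LocSmoothBdd.exists_isOpen_of_isCompact (hS : IsOpen S) {F : E × V → G} {K : Set V}
    (hK : IsCompact K) (h : ∀ v ∈ K, LocSmoothBddAt S F v) :
    ∃ N : Set V, IsOpen N ∧ K ⊆ N ∧ SmoothBddOn (S ×ˢ N) F := by
  refine hK.induction_on (p := fun K => ∃ N : Set V, IsOpen N ∧ K ⊆ N ∧ SmoothBddOn (S ×ˢ N) F)
    ⟨∅, isOpen_empty, subset_rfl, by simp [SmoothBddOn]⟩ ?_ ?_ ?_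
  · rintro s t hst ⟨N, hN, htN, h⟩
    exact ⟨N, hN, hst.trans htN, h⟩
  · rintro s t ⟨N, hN, hsN, h⟩ ⟨N', hN', htN', h'⟩
    refine ⟨N ∪ N', hN.union hN', union_subset_union hsN htN', ?_⟩
    rw [prod_union]
    exact h.union (hS.prod hN) (hS.prod hN') h'
  · intro v hv
    obtain ⟨N, hN, hvN, h⟩ := h v hv
    exact ⟨N, mem_nhdsWithin_of_mem_nhds (hN.mem_nhds hvN), N, hN, subset_rfl, h⟩

theorem SmoothBddOn.comp_snd {N : Set V} (hS : IsOpen S) (hN : IsOpen N) {γ : V → G}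
    (hγ : SmoothBddOn N γ) : SmoothBddOn (S ×ˢ N) (fun p => γ p.2) := by
  refine hγ.comp (hS.prod hN) hN contDiff_snd.contDiffOn (fun p hp => hp.2) fun n => ?_
  simp_rw [← norm_iteratedFDeriv_fderiv]
  have : _root_.fderiv ℝ (Prod.snd : E × V → V) = fun _ => ContinuousLinearMap.snd ℝ E V := by
    ext1 p; exact fderiv_snd
  rw [this]
  exact (SmoothBddOn.const (A := S ×ˢ N) (ContinuousLinearMap.snd ℝ E V)).2 n

theorem exists_isOpen_smoothBddOn [ProperSpace V] {U : Set V} (hU : IsOpen U) (hv : v ∈ U)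
    {γ : V → G} (hγ : ContDiffOn ℝ ∞ γ U) :
    ∃ N ⊆ U, IsOpen N ∧ v ∈ N ∧ SmoothBddOn N γ := by
  obtain ⟨r, hr, hrU⟩ := Metric.nhds_basis_closedBall.mem_iff.1 (hU.mem_nhds hv)
  have hb : Metric.ball v r ⊆ U := Metric.ball_subset_closedBall.trans hrU
  refine ⟨Metric.ball v r, hb, Metric.isOpen_ball, Metric.mem_ball_self hr, hγ.mono hb,
    fun n => ?_⟩
  have : ContinuousOn (iteratedFDeriv ℝ n γ) (Metric.closedBall v r) := by
    have h1 : ContinuousOn (iteratedFDerivWithin ℝ n γ U) U :=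
      hγ.continuousOn_iteratedFDerivWithin (by exact_mod_cast le_top) hU.uniqueDiffOn
    exact (h1.congr fun x hx => (iteratedFDerivWithin_of_isOpen n hU hx).symm).mono hrU
  obtain ⟨C, hC⟩ := (isCompact_closedBall v r).exists_bound_of_continuousOn this
  exact ⟨C, fun p hp => hC _ (Metric.ball_subset_closedBall hp)⟩

theorem LocSmoothBddAt.of_snd [ProperSpace V] (hS : IsOpen S) {U : Set V} (hU : IsOpen U)
    (hv : v ∈ U) {γ : V → G} (hγ : ContDiffOn ℝ ∞ γ U) :
    LocSmoothBddAt S (fun p => γ p.2) v := by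
  obtain ⟨N, -, hN, hvN, h⟩ := exists_isOpen_smoothBddOn hU hv hγ
  exact ⟨N, hN, hvN, h.comp_snd hS hN⟩

theorem LocSmoothBdd.of_snd [ProperSpace V] (hS : IsOpen S) {γ : V → G} (hγ : ContDiff ℝ ∞ γ) :
    LocSmoothBdd S (fun p => γ p.2) :=
  fun _ => .of_snd hS isOpen_univ (mem_univ _) hγ.contDiffOn

/-- Substitution in the second variable. -/
theorem LocSmoothBddAt.comp_right [ProperSpace V'] (hS : IsOpen S) {F : E × V → G} {U : Set V'}
    (hU : IsOpen U) {w : V'} (hw : w ∈ U) {γ : V' → V} (hγ : ContDiffOn ℝ ∞ γ U)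
    (hF : LocSmoothBddAt S F (γ w)) : LocSmoothBddAt S (fun p => F (p.1, γ p.2)) w := by
  obtain ⟨N, hN, hvN, h⟩ := hF
  have hγ' : ContDiffOn ℝ ∞ (_root_.fderiv ℝ γ) U := hγ.fderiv_of_isOpen hU (by norm_cast)
  -- Only γ' has to be bounded: the map (x, v) ↦ (x, γ v) is itself unbounded when `S` is, but
  -- composition asks only for bounds on its proper derivatives.
  obtain ⟨N', hN'U, hN', hwN', h'⟩ := exists_isOpen_smoothBddOn hU hw hγ'
  have ho : IsOpen (N' ∩ γ ⁻¹' N) := (hγ.continuousOn.mono hN'U).isOpen_inter_preimage hN' hN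
  have hos : IsOpen (S ×ˢ (N' ∩ γ ⁻¹' N)) := hS.prod ho
  have hd : ∀ p ∈ S ×ˢ (N' ∩ γ ⁻¹' N), HasFDerivAt (fun p : E × V' => (p.1, γ p.2))
      ((ContinuousLinearMap.fst ℝ E V').prod
        ((_root_.fderiv ℝ γ p.2).comp (ContinuousLinearMap.snd ℝ E V'))) p := fun p hp => by
    have h1 : HasFDerivAt γ (_root_.fderiv ℝ γ p.2) p.2 :=
      ((hγ.contDiffAt (hU.mem_nhds (hN'U hp.2.1))).differentiableAt (by simp)).hasFDerivAt
    exact hasFDerivAt_fst.prodMk (h1.comp p hasFDerivAt_snd)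
  have hγs : ContDiffOn ℝ ∞ (fun p : E × V' => (p.1, γ p.2)) (S ×ˢ (N' ∩ γ ⁻¹' N)) :=
    contDiff_fst.contDiffOn.prodMk
      (hγ.comp contDiff_snd.contDiffOn fun p hp => hN'U hp.2.1)
  refine ⟨N' ∩ γ ⁻¹' N, ho, ⟨hwN', hvN⟩, h.comp hos (hS.prod hN) hγs
    (fun p hp => ⟨hp.1, hp.2.2⟩) fun n => ?_⟩
  have hsb : SmoothBddOn (S ×ˢ (N' ∩ γ ⁻¹' N)) (fun p : E × V' =>
      (ContinuousLinearMap.fst ℝ E V').prod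
        ((_root_.fderiv ℝ γ p.2).comp (ContinuousLinearMap.snd ℝ E V'))) := by
    have h1 := ((h'.mono (inter_subset_left (t := γ ⁻¹' N))).comp_snd hS ho).clm_comp hos
      ((ContinuousLinearMap.compL ℝ (E × V') V (E × V)  (ContinuousLinearMap.inr ℝ E V)).comp
        ((ContinuousLinearMap.compL ℝ (E × V') V' V).flip (ContinuousLinearMap.snd ℝ E V')))
    have h2 := (SmoothBddOn.const (A := S ×ˢ (N' ∩ γ ⁻¹' N))
      ((ContinuousLinearMap.inl ℝ E V).comp (ContinuousLinearMap.fst ℝ E V'))).add hos h1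
    refine h2.congr hos fun p _ => ?_
    ext z <;> simp
  obtain ⟨C, hC⟩ := (hsb.congr hos fun p hp => (hd p hp).fderiv).2 n
  exact ⟨C, fun p hp => by simpa only [norm_iteratedFDeriv_fderiv] using hC p hp⟩

theorem LocSmoothBdd.comp_right [ProperSpace V'] (hS : IsOpen S) {F : E × V → G}
    {γ : V' → V} (hγ : ContDiff ℝ ∞ γ)
    (hF : LocSmoothBdd S F) : LocSmoothBdd S (fun p => F (p.1, γ p.2)) :=
  fun w => .comp_right hS isOpen_univ (mem_univ w) hγ.contDiffOn (hF _)

theorem LocSmoothBddAt.integral (hS : IsOpen S) {a b : ℝ} {k : ℝ → ℝ}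
    (hk : IntervalIntegrable k MeasureTheory.volume a b) {H : E × (V × ℝ) → G}
    (hH : ∀ s ∈ uIcc a b, LocSmoothBddAt S H (v, s)) :
    LocSmoothBddAt S (fun p => ∫ s in a..b, k s • H (p.1, (p.2, s))) v := by
  obtain ⟨N, hN, hKN, h⟩ := LocSmoothBdd.exists_isOpen_of_isCompact (K := {v} ×ˢ uIcc a b) hS
    (isCompact_singleton.prod isCompact_uIcc) (F := H) (by
      rintro ⟨v', s⟩ ⟨hv', hs⟩
      obtain rfl : v' = v := hv'
      exact hH s hs)
  obtain ⟨N', J, hN', hJ, hvN', hJs, hsub⟩ :=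
    generalized_tube_lemma isCompact_singleton isCompact_uIcc hN hKN
  have ho := hS.prod hN'
  refine ⟨N', hN', hvN' rfl, ?_⟩
  refine SmoothBddOn.integral (H := fun z : (E × V) × ℝ => H (z.1.1, (z.1.2, z.2)))
    ho hJ hJs hk ?_
  let L : ((E × V) × ℝ) →L[ℝ] (E × (V × ℝ)) :=
    ((ContinuousLinearMap.fst ℝ E V).comp (ContinuousLinearMap.fst ℝ (E × V) ℝ)).prod
      (((ContinuousLinearMap.snd ℝ E V).comp (ContinuousLinearMap.fst ℝ (E × V) ℝ)).prod
        (ContinuousLinearMap.snd ℝ (E × V) ℝ))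
  refine h.comp (γ := L) (ho.prod hJ) (hS.prod hN) L.contDiff.contDiffOn ?_ fun n => ?_
  · rintro ⟨⟨x, w⟩, s⟩ ⟨⟨hx, hw⟩, hs⟩
    exact ⟨hx, hsub ⟨hw, hs⟩⟩
  · simp_rw [← norm_iteratedFDeriv_fderiv]
    have : _root_.fderiv ℝ L = fun _ => L := by
      ext1 p; exact L.fderiv
    rw [this]
    exact (SmoothBddOn.const L).2 n

theorem LocSmoothBddAt.comp_left (hS : IsOpen S) {B K : Set G} (hB : IsOpen B)
    (hK : IsCompact K) (hKB : K ⊆ B) {γ : G → G'} (hγ : ContDiffOn ℝ ∞ γ B) {F : E × V → G}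
    (hF : LocSmoothBddAt S F v) (hm : ∀ᶠ v' in 𝓝 v, ∀ x ∈ S, F (x, v') ∈ K) :
    LocSmoothBddAt S (fun p => γ (F p)) v := by
  obtain ⟨N, hN, hv, h⟩ := hF
  obtain ⟨N', hN's, hN', hv'⟩ := eventually_nhds_iff.1 hm
  refine ⟨N ∩ N', hN.inter hN', ⟨hv, hv'⟩, ?_⟩
  exact (h.mono (prod_mono_right inter_subset_left)).comp_left (hS.prod (hN.inter hN')) hB hK hKB
    hγ fun p hp => hN's _ hp.2.2 _ hp.1

theorem LocSmoothBddAt.comp_contDiff [ProperSpace G] (hS : IsOpen S)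
    {γ : G → G'} (hγ : ContDiff ℝ ∞ γ) {F : E × V → G}
    (hF : LocSmoothBddAt S F v) : LocSmoothBddAt S (fun p => γ (F p)) v := by
  have hF' := hF
  obtain ⟨N, hN, hv, h⟩ := hF'
  obtain ⟨C, hC⟩ := h.bounded
  refine hF.comp_left hS isOpen_univ (isCompact_closedBall (0 : G) C) (subset_univ _)
    hγ.contDiffOn ?_
  filter_upwards [hN.mem_nhds hv] with v' hv' x hx
  simpa using hC (x, v') ⟨hx, hv'⟩

/-- A logarithm of a function which is bounded away from zero. -/
theorem LocSmoothBddAt.log (hS : IsOpen S) {F : E × V → ℂ} (hF : LocSmoothBddAt S F v)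
    (hsl : ∀ x ∈ S, ∀ v, F (x, v) ∈ Complex.slitPlane) {c : ℝ} (hc : 0 < c)
    (hlow : ∀ᶠ v' in 𝓝 v, ∀ x ∈ S, c ≤ ‖F (x, v')‖) :
    LocSmoothBddAt S (fun p => Complex.log (F p)) v := by
  have hF' := hF
  obtain ⟨N, hN, hv, h⟩ := hF'
  obtain ⟨N', hN's, hN', hv'⟩ := eventually_nhds_iff.1 hlow
  obtain ⟨C, hC⟩ := h.bounded
  have hK : IsCompact {z : ℂ | c ≤ ‖z‖ ∧ ‖z‖ ≤ C} := by
    refine (isCompact_closedBall (0 : ℂ) C).of_isClosed_subset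
      ((isClosed_le continuous_const continuous_norm).inter
        (isClosed_le continuous_norm continuous_const)) fun z hz => by simpa using hz.2
  have ho := hS.prod (hN.inter hN')
  have h0 := h.mono (prod_mono_right (s := S) (inter_subset_left (s := N) (t := N')))
  have hinv : SmoothBddOn (S ×ˢ (N ∩ N')) (fun p => (F p)⁻¹) := by
    refine h0.comp_left (γ := F) (F := fun z : ℂ => z⁻¹) ho (isOpen_compl_singleton (x := (0 : ℂ)))
      hK ?_ (fun z hz => ?_) fun p hp => ⟨hN's _ hp.2.2 _ hp.1, hC _ ⟨hp.1, hp.2.1⟩⟩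
    · rintro z ⟨hz, -⟩ rfl
      simp at hz; linarith
    · exact (contDiffAt_inv ℝ hz).contDiffWithinAt
  have hd : ∀ p ∈ S ×ˢ (N ∩ N'), HasFDerivAt (fun p => Complex.log (F p))
      ((F p)⁻¹ • _root_.fderiv ℝ F p) p := fun p hp => by
    have h1 : HasFDerivAt F (_root_.fderiv ℝ F p) p :=
      ((h0.1.contDiffAt (ho.mem_nhds hp)).differentiableAt (by simp)).hasFDerivAt
    refine ((Complex.hasStrictFDerivAt_log_real (hsl _ hp.1 _)).hasFDerivAt.comp p h1).congr_fderiv ?_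
    ext z <;> simp
  -- The values of `F` may approach the cut, so they need not stay in a compact part of the slit
  -- plane. But |log F| is controlled by |F| and by |arg| ≤ π, and the derivative F⁻¹ dF does not
  -- see the cut.
  refine ⟨N ∩ N', hN.inter hN', ⟨hv, hv'⟩, .of_fderiv ho
    (fun p hp => (hd p hp).differentiableAt.differentiableWithinAt) ?_ ?_⟩
  · refine ⟨|Real.log c| + |Real.log C| + Real.pi, fun p hp => ?_⟩
    refine (Complex.norm_le_abs_re_add_abs_im _).trans ?_
    refine add_le_add ?_ ?_
    · rw [Complex.log_re]
      have h1 := hN's _ hp.2.2 _ hp.1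
      have h2 := hC p ⟨hp.1, hp.2.1⟩
      have h3 := Real.log_le_log hc h1
      have h4 := Real.log_le_log (hc.trans_le h1) h2
      have h5 := neg_abs_le (Real.log c)
      have h6 := le_abs_self (Real.log C)
      rw [abs_le]
      constructor
      · linarith [abs_nonneg (Real.log C)]
      · exact h4.trans (by linarith [abs_nonneg (Real.log c)])
    · rw [Complex.log_im]
      exact Complex.abs_arg_le_pi _
  · refine SmoothBddOn.congr ho (hinv.bilinear ho
      ((ContinuousLinearMap.lsmul ℝ ℂ : ℂ →L[ℝ] ((E × V) →L[ℝ] ℂ) →L[ℝ] ((E × V) →L[ℝ] ℂ)))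
      (h0.fderiv ho)) fun p hp => (hd p hp).fderiv

/-- Closed balls are compact here. Together with the converse below, this transfers smoothness
through every operation already known to preserve `LocSmoothBdd`. -/
theorem ContDiff.locSmoothBdd_ball [ProperSpace E] [ProperSpace V] {F : E × V → G}
    (hF : ContDiff ℝ ∞ F) (R : ℝ) : LocSmoothBdd (Metric.ball 0 R) F := fun v =>
  ⟨Metric.ball v 1, Metric.isOpen_ball, Metric.mem_ball_self one_pos,
    hF.smoothBddOn_of_subset_isCompact
      ((isCompact_closedBall (0 : E) R).prod (isCompact_closedBall v 1))
      (prod_mono Metric.ball_subset_closedBall Metric.ball_subset_closedBall)⟩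

theorem contDiff_of_locSmoothBdd_ball {F : E × V → G}
    (hF : ∀ R : ℝ, LocSmoothBdd (Metric.ball 0 R) F) : ContDiff ℝ ∞ F :=
  contDiff_iff_contDiffAt.2 fun ⟨x, v⟩ =>
    (hF (‖x‖ + 1) v).contDiffAt Metric.isOpen_ball (by simp)

end LocSmoothBdd

/-! ### Iterated directional derivatives. -/

noncomputable section DirDeriv

variable {P P' : Type} [NormedAddCommGroup P] [NormedSpace ℝ P]
  [NormedAddCommGroup P'] [NormedSpace ℝ P']

/-- The derivative of `F` in the direction `v`. -/
def dirDeriv (v : P) (F : P → ℂ) : P → ℂ := fun p => fderiv ℝ F p v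

/-- Iterated derivatives in the directions `e i`, for the indices `i` in a list. -/
def dirMultiDeriv {ι : Type} (e : ι → P) (α : ι → ℕ) (l : List ι) (F : P → ℂ) : P → ℂ :=
  l.foldr (fun i h => (dirDeriv (e i))^[α i] h) F

theorem ContDiff.dirDeriv {F : P → ℂ} (hF : ContDiff ℝ ∞ F) (v : P) :
    ContDiff ℝ ∞ (dirDeriv v F) :=
  (hF.fderiv_right (m := ∞) (by norm_cast)).clm_apply contDiff_const

theorem ContDiff.iterate_dirDeriv {F : P → ℂ} (hF : ContDiff ℝ ∞ F) (v : P) (k : ℕ) :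
    ContDiff ℝ ∞ ((_root_.dirDeriv v)^[k] F) := by
  induction k with
  | zero => exact hF
  | succ k ih => rw [Function.iterate_succ_apply']; exact ih.dirDeriv v

theorem ContDiff.dirMultiDeriv {ι : Type} (e : ι → P) (α : ι → ℕ) (l : List ι) {F : P → ℂ}
    (hF : ContDiff ℝ ∞ F) : ContDiff ℝ ∞ (dirMultiDeriv e α l F) := by
  induction l with
  | nil => exact hF
  | cons i l ih => exact ih.iterate_dirDeriv _ _

theorem dirDeriv_comm {F : P → ℂ} (hF : ContDiff ℝ ∞ F) (v w : P) :
    dirDeriv v (dirDeriv w F) = dirDeriv w (dirDeriv v F) := by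
  have hd : ∀ p, DifferentiableAt ℝ (fderiv ℝ F) p := fun p =>
    ((hF.fderiv_right (m := ∞) (by norm_cast)).differentiable (by simp)) p
  have key : ∀ (v w p : P), dirDeriv v (dirDeriv w F) p = fderiv ℝ (fderiv ℝ F) p v w := by
    intro v w p
    unfold dirDeriv
    rw [fderiv_clm_apply (hd p) (differentiableAt_const w)]
    simp
  ext p
  rw [key, key]
  exact (hF.contDiffAt.isSymmSndFDerivAt (by
    rw [minSmoothness_of_isRCLikeNormedField]; exact WithTop.coe_le_coe.2 le_top)).eq v w

theorem dirDeriv_iterate_comm {F : P → ℂ} (hF : ContDiff ℝ ∞ F) (v w : P) (k : ℕ) :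
    dirDeriv v ((dirDeriv w)^[k] F) = (dirDeriv w)^[k] (dirDeriv v F) := by
  induction k with
  | zero => rfl
  | succ k ih =>
    rw [Function.iterate_succ_apply', dirDeriv_comm (hF.iterate_dirDeriv w k), ih,
      ← Function.iterate_succ_apply' (dirDeriv w)]

theorem dirDeriv_dirMultiDeriv_comm {ι : Type} (e : ι → P) (α : ι → ℕ) (l : List ι) {F : P → ℂ}
    (hF : ContDiff ℝ ∞ F) (v : P) :
    dirDeriv v (dirMultiDeriv e α l F) = dirMultiDeriv e α l (dirDeriv v F) := by
  induction l with
  | nil => rfl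
  | cons i l ih =>
    change dirDeriv v ((dirDeriv (e i))^[α i] (dirMultiDeriv e α l F)) =
      (dirDeriv (e i))^[α i] (dirMultiDeriv e α l (dirDeriv v F))
    rw [dirDeriv_iterate_comm (hF.dirMultiDeriv e α l), ih]

theorem dirMultiDeriv_congr {ι : Type} {e : ι → P} {α β : ι → ℕ} {l : List ι} (F : P → ℂ)
    (h : ∀ i ∈ l, α i = β i) : dirMultiDeriv e α l F = dirMultiDeriv e β l F := by
  induction l with
  | nil => rfl
  | cons i l ih =>
    change (dirDeriv (e i))^[α i] (dirMultiDeriv e α l F) =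
      (dirDeriv (e i))^[β i] (dirMultiDeriv e β l F)
    rw [ih fun j hj => h j (List.mem_cons_of_mem _ hj), h i List.mem_cons_self]

/-- Commutation moves the extra derivative to the innermost place; `Nodup` ensures that the
direction `e i` occurs only once in the list. -/
theorem dirMultiDeriv_add_single {ι : Type} [DecidableEq ι] (e : ι → P) (α : ι → ℕ) {l : List ι}
    (hl : l.Nodup) {i : ι} (hi : i ∈ l) {F : P → ℂ} (hF : ContDiff ℝ ∞ F) :
    dirMultiDeriv e (α + Pi.single i 1) l F = dirMultiDeriv e α l (dirDeriv (e i) F) := by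
  induction l with
  | nil => simp at hi
  | cons j l ih =>
    rw [List.nodup_cons] at hl
    change (dirDeriv (e j))^[(α + Pi.single i 1 : ι → ℕ) j]
        (dirMultiDeriv e (α + Pi.single i 1) l F) =
      (dirDeriv (e j))^[α j] (dirMultiDeriv e α l (dirDeriv (e i) F))
    by_cases hij : j = i
    · subst hij
      rw [dirMultiDeriv_congr (β := α) F (fun k hk => by
        have : k ≠ j := fun h => hl.1 (h ▸ hk)
        simp [this]), ← dirDeriv_dirMultiDeriv_comm e α l hF]
      simp
    · rw [ih hl.2 ((List.mem_cons.1 hi).resolve_left (Ne.symm hij))]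
      simp [hij]

theorem dirDeriv_comp_affine {F : P → ℂ} (hF : ContDiff ℝ ∞ F) (L : P' →L[ℝ] P) (c : P) (v : P') :
    (fun z => dirDeriv (L v) F (L z + c)) = dirDeriv v (fun z => F (L z + c)) := by
  ext z
  have h1 : HasFDerivAt F (fderiv ℝ F (L z + c)) (L z + c) :=
    (hF.differentiable (by simp) _).hasFDerivAt
  have h2 : HasFDerivAt (fun z => L z + c) L z := L.hasFDerivAt.add_const c
  have h3 : HasFDerivAt (fun z => F (L z + c)) ((fderiv ℝ F (L z + c)).comp L) z := h1.comp z h2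
  change fderiv ℝ F (L z + c) (L v) = fderiv ℝ (fun z => F (L z + c)) z v
  rw [h3.fderiv]
  rfl

theorem iterate_dirDeriv_comp_affine {F : P → ℂ} (hF : ContDiff ℝ ∞ F) (L : P' →L[ℝ] P) (c : P)
    (v : P') (k : ℕ) :
    (fun z => (dirDeriv (L v))^[k] F (L z + c)) = (dirDeriv v)^[k] (fun z => F (L z + c)) := by
  induction k with
  | zero => rfl
  | succ k ih =>
    simp only [Function.iterate_succ_apply']
    rw [← ih, ← dirDeriv_comp_affine (hF.iterate_dirDeriv _ _)]

theorem dirMultiDeriv_comp_affine {ι : Type} (e : ι → P') (α : ι → ℕ) (l : List ι) {F : P → ℂ}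
    (hF : ContDiff ℝ ∞ F) (L : P' →L[ℝ] P) (c : P) :
    (fun z => dirMultiDeriv (fun i => L (e i)) α l F (L z + c)) =
      dirMultiDeriv e α l (fun z => F (L z + c)) := by
  induction l with
  | nil => rfl
  | cons i l ih =>
    change (fun z => (dirDeriv (L (e i)))^[α i]
      (dirMultiDeriv (fun i => L (e i)) α l F) (L z + c)) =
      (dirDeriv (e i))^[α i] (dirMultiDeriv e α l (fun z => F (L z + c)))
    rw [iterate_dirDeriv_comp_affine (hF.dirMultiDeriv _ _ _), ih]

theorem dirDeriv_fun_sub {F H : P → ℂ} (hF : ContDiff ℝ ∞ F) (hH : ContDiff ℝ ∞ H) (v : P) :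
    dirDeriv v (fun p => F p - H p) = fun p => dirDeriv v F p - dirDeriv v H p := by
  ext p
  unfold dirDeriv
  rw [fderiv_fun_sub (hF.differentiable (by simp) p) (hH.differentiable (by simp) p)]
  rfl

theorem dirMultiDeriv_sub {ι : Type} (e : ι → P) (α : ι → ℕ) (l : List ι) {F H : P → ℂ}
    (hF : ContDiff ℝ ∞ F) (hH : ContDiff ℝ ∞ H) :
    dirMultiDeriv e α l (fun p => F p - H p) =
      fun p => dirMultiDeriv e α l F p - dirMultiDeriv e α l H p := by
  have aux : ∀ (k : ℕ) (v : P) {F H : P → ℂ} (_ : ContDiff ℝ ∞ F) (_ : ContDiff ℝ ∞ H),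
      (dirDeriv v)^[k] (fun p => F p - H p) =
        fun p => (dirDeriv v)^[k] F p - (dirDeriv v)^[k] H p := by
    intro k v F H hF hH
    induction k with
    | zero => rfl
    | succ k ih =>
      simp only [Function.iterate_succ_apply']
      rw [ih, dirDeriv_fun_sub (hF.iterate_dirDeriv v k) (hH.iterate_dirDeriv v k)]
  induction l with
  | nil => rfl
  | cons i l ih =>
    change (dirDeriv (e i))^[α i] (dirMultiDeriv e α l (fun p => F p - H p)) = _
    rw [ih, aux _ _ (hF.dirMultiDeriv _ _ _) (hH.dirMultiDeriv _ _ _)]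
    rfl

/-- Reflection of the directions produces the sign (−1)^{|α|} that appears in the transmission
property. -/
theorem dirMultiDeriv_neg_dir {ι : Type} (e : ι → P) (α : ι → ℕ) (l : List ι) {F : P → ℂ}
    (hF : ContDiff ℝ ∞ F) : dirMultiDeriv (fun i => -e i) α l F =
      fun p => (-1) ^ (l.map α).sum * dirMultiDeriv e α l F p := by
  have aux : ∀ (k : ℕ) (v : P) (c : ℂ) {F : P → ℂ} (_ : ContDiff ℝ ∞ F),
      (dirDeriv (-v))^[k] (fun p => c * F p) =
        fun p => (-1) ^ k * c * (dirDeriv v)^[k] F p := by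
    intro k v c F hF
    induction k with
    | zero => simp
    | succ k ih =>
      simp only [Function.iterate_succ_apply']
      rw [ih]
      ext p
      change fderiv ℝ _ p (-v) = _ * fderiv ℝ _ p v
      rw [fderiv_const_mul ((hF.iterate_dirDeriv v k).differentiable (by simp) p)]
      simp [pow_succ]
  induction l with
  | nil => simp [dirMultiDeriv]
  | cons i l ih =>
    change (dirDeriv (-e i))^[α i] (dirMultiDeriv (fun i => -e i) α l F) = _
    rw [ih, aux _ _ _ (hF.dirMultiDeriv _ _ _)]
    ext p
    simp only [List.map_cons, List.sum_cons, pow_add]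
    rfl

/-- The derivatives of order `n + 1` are controlled by those of order `n` of the partial
derivatives. -/
theorem exists_norm_iteratedFDeriv_succ_le {ι : Type} [Fintype ι] [FiniteDimensional ℝ P]
    (b : Module.Basis ι ℝ P) : ∃ C : ι → ℝ, ∀ (n : ℕ) (F : P → ℂ) (_ : ContDiff ℝ ∞ F) (p : P),
      ‖iteratedFDeriv ℝ (n + 1) F p‖ ≤ ∑ i, C i * ‖iteratedFDeriv ℝ n (dirDeriv (b i) F) p‖ := by
  let Λ : ι → (ℂ →L[ℝ] (P →L[ℝ] ℂ)) := fun i =>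
    ContinuousLinearMap.smulRightL ℝ P ℂ (LinearMap.toContinuousLinearMap (b.coord i))
  refine ⟨fun i => ‖Λ i‖, fun n F hF p => ?_⟩
  have h1 : fderiv ℝ F = fun p => ∑ i, Λ i (dirDeriv (b i) F p) := by
    ext p v
    conv_lhs => rw [← b.sum_repr v, map_sum]
    simp [Λ, dirDeriv]
  rw [← norm_iteratedFDeriv_fderiv, h1]
  have hs : ∀ i, ContDiff ℝ ∞ (fun p => Λ i (dirDeriv (b i) F p)) := fun i =>
    (Λ i).contDiff.comp (hF.dirDeriv (b i))
  rw [iteratedFDeriv_fun_sum_apply fun i _ => (hs i).contDiffAt.of_le (by exact_mod_cast le_top)]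
  refine (norm_sum_le _ _).trans (Finset.sum_le_sum fun i _ => ?_)
  exact (Λ i).norm_iteratedFDeriv_comp_left (hF.dirDeriv (b i)).contDiffAt
    (by exact_mod_cast le_top)

/-- Working with a family closed under the basis derivatives makes the induction on the order
immediate. It is applied to the family of all mixed partial derivatives of a symbol. -/
theorem exists_iteratedFDeriv_bound {ι : Type} [Fintype ι] [FiniteDimensional ℝ P]
    (b : Module.Basis ι ℝ P) {W : Set (P → ℂ)} (hW : ∀ F ∈ W, ContDiff ℝ ∞ F)
    (hWb : ∀ F ∈ W, ∀ i, dirDeriv (b i) F ∈ W) {A : Set P}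
    (hA : ∀ F ∈ W, ∃ C : ℝ, ∀ p ∈ A, ‖F p‖ ≤ C) (n : ℕ) :
    ∀ F ∈ W, ∃ C : ℝ, ∀ p ∈ A, ‖iteratedFDeriv ℝ n F p‖ ≤ C := by
  obtain ⟨c, hc⟩ := exists_norm_iteratedFDeriv_succ_le b
  induction n with
  | zero => simpa using hA
  | succ n ih =>
    intro F hF
    choose C hC using fun i => ih _ (hWb F hF i)
    refine ⟨∑ i, |c i| * C i, fun p hp => (hc n F (hW F hF) p).trans ?_⟩
    refine Finset.sum_le_sum fun i _ => ?_
    refine mul_le_mul (le_abs_self _) (hC i p hp) (norm_nonneg _) (abs_nonneg _)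

/-- The same induction with zero in place of a bound; it turns vanishing partial derivatives into
flatness. -/
theorem iteratedFDeriv_eq_zero_of_dirDeriv {ι : Type} [Fintype ι] [FiniteDimensional ℝ P]
    (b : Module.Basis ι ℝ P) {W : Set (P → ℂ)} (hW : ∀ F ∈ W, ContDiff ℝ ∞ F)
    (hWb : ∀ F ∈ W, ∀ i, dirDeriv (b i) F ∈ W) {p : P}
    (hp : ∀ F ∈ W, F p = 0) (n : ℕ) :
    ∀ F ∈ W, iteratedFDeriv ℝ n F p = 0 := by
  obtain ⟨c, hc⟩ := exists_norm_iteratedFDeriv_succ_le b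
  induction n with
  | zero => 
    intro F hF
    rw [← norm_eq_zero, norm_iteratedFDeriv_zero, hp F hF, norm_zero]
  | succ n ih =>
    intro F hF
    rw [← norm_le_zero_iff]
    refine (hc n F (hW F hF) p).trans (le_of_eq (Finset.sum_eq_zero fun i _ => ?_))
    rw [ih _ (hWb F hF i), norm_zero, mul_zero]

end DirDeriv

/-! ### Cutting off a function along a set where it is flat. -/

section Flat

variable {P G : Type} [NormedAddCommGroup P] [NormedSpace ℝ P]
  [NormedAddCommGroup G] [NormedSpace ℝ G]

-- Where ℓ = 0, both F and dF vanish, so F = o(|z − p|), and setting F to zero on part of the space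
-- keeps this. The derivative is again a cut-off of a flat function, which is what the two
-- inductions below use.
open Classical in
theorem hasFDerivAt_ite_flat {F : P → G} (hF : ContDiff ℝ ∞ F) {ℓ : P → ℝ} (hℓ : Continuous ℓ)
    (hflat : ∀ p, ℓ p = 0 → ∀ n : ℕ, iteratedFDeriv ℝ n F p = 0) (p : P) :
    HasFDerivAt (fun p => if ℓ p < 0 then F p else 0) (if ℓ p < 0 then fderiv ℝ F p else 0) p := by
  have hFd : HasFDerivAt F (fderiv ℝ F p) p := (hF.differentiable (by simp) p).hasFDerivAt
  rcases lt_trichotomy (ℓ p) 0 with h | h | h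
  · rw [if_pos h]
    refine hFd.congr_of_eventuallyEq ?_
    filter_upwards [(isOpen_lt hℓ continuous_const).mem_nhds h] with z hz
    rw [if_pos hz]
  · rw [if_neg (by simp [h])]
    have h0 : F p = 0 := by
      rw [← norm_eq_zero, ← norm_iteratedFDeriv_zero (𝕜 := ℝ), hflat p h 0, norm_zero]
    have h1 : fderiv ℝ F p = 0 := by
      rw [← norm_eq_zero, ← norm_iteratedFDeriv_zero (𝕜 := ℝ) (f := fderiv ℝ F),
        norm_iteratedFDeriv_fderiv, hflat p h 1, norm_zero]
    rw [h1, hasFDerivAt_iff_isLittleO] at hFd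
    rw [hasFDerivAt_iff_isLittleO]
    refine (Asymptotics.isBigO_of_le _ fun z => ?_).trans_isLittleO hFd
    simp only [h, lt_irrefl, if_false, h0]
    split_ifs <;> simp
  · rw [if_neg h.le.not_gt]
    refine (hasFDerivAt_const (0 : G) p).congr_of_eventuallyEq ?_
    filter_upwards [(isOpen_lt continuous_const hℓ).mem_nhds h] with z hz
    rw [if_neg (le_of_lt hz).not_gt]

theorem fderiv_flat {F : P → G} {ℓ : P → ℝ}
    (hflat : ∀ p, ℓ p = 0 → ∀ n : ℕ, iteratedFDeriv ℝ n F p = 0) :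
    ∀ p, ℓ p = 0 → ∀ n : ℕ, iteratedFDeriv ℝ n (fderiv ℝ F) p = 0 := fun p hp n => by
  rw [← norm_eq_zero, norm_iteratedFDeriv_fderiv, hflat p hp, norm_zero]

open Classical in
theorem contDiff_ite_flat {F : P → G} (hF : ContDiff ℝ ∞ F) {ℓ : P → ℝ} (hℓ : Continuous ℓ)
    (hflat : ∀ p, ℓ p = 0 → ∀ n : ℕ, iteratedFDeriv ℝ n F p = 0) :
    ContDiff ℝ ∞ (fun p => if ℓ p < 0 then F p else 0) := by
  refine contDiff_infty.2 fun n => ?_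
  induction n generalizing G with
  | zero => exact contDiff_zero.2 (continuous_iff_continuousAt.2 fun p =>
      (hasFDerivAt_ite_flat hF hℓ hflat p).continuousAt)
  | succ n ih =>
    refine contDiff_succ_iff_fderiv.2
      ⟨fun p => (hasFDerivAt_ite_flat hF hℓ hflat p).differentiableAt,
        fun h => absurd h (WithTop.natCast_ne_top n), ?_⟩
    rw [show fderiv ℝ (fun p => if ℓ p < 0 then F p else 0) =
      fun p => if ℓ p < 0 then fderiv ℝ F p else 0 from
        funext fun p => (hasFDerivAt_ite_flat hF hℓ hflat p).fderiv]
    exact ih (hF.fderiv_right (m := ∞) (by norm_cast)) (fderiv_flat hflat)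

open Classical in
theorem norm_iteratedFDeriv_ite_flat_le {F : P → G} (hF : ContDiff ℝ ∞ F) {ℓ : P → ℝ}
    (hℓ : Continuous ℓ) (hflat : ∀ p, ℓ p = 0 → ∀ n : ℕ, iteratedFDeriv ℝ n F p = 0) (n : ℕ)
    (p : P) : ‖iteratedFDeriv ℝ n (fun p => if ℓ p < 0 then F p else 0) p‖ ≤
      ‖iteratedFDeriv ℝ n F p‖ := by
  induction n generalizing G with
  | zero =>
    simp only [norm_iteratedFDeriv_zero]
    split_ifs <;> simp
  | succ n ih =>
    rw [← norm_iteratedFDeriv_fderiv, ← norm_iteratedFDeriv_fderiv (f := F),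
      show fderiv ℝ (fun p => if ℓ p < 0 then F p else 0) =
      fun p => if ℓ p < 0 then fderiv ℝ F p else 0 from
        funext fun p => (hasFDerivAt_ite_flat hF hℓ hflat p).fderiv]
    exact ih (hF.fderiv_right (m := ∞) (by norm_cast)) (fderiv_flat hflat)

end Flat

/-! ### Symbols as functions of all variables, and flatness of the transmission defect. -/

noncomputable section Symbols

variable {M m : ℕ}

/-- The function of the pair `(X, (ξ', ξ_n))` given by `a (X, ξ', ξ_n)`. -/
def joint (a : Eu M → Eu m → ℝ → ℂ) : Eu M × (Eu m × ℝ) → ℂ := fun p => a p.1 p.2.1 p.2.2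

/-- The coordinate directions in `X`. -/
def dirX (M m : ℕ) (i : Fin M) : Eu M × (Eu m × ℝ) := (EuclideanSpace.single i 1, 0, 0)

/-- The coordinate directions in `ξ'`. -/
def dirXi (M m : ℕ) (i : Fin m) : Eu M × (Eu m × ℝ) := (0, EuclideanSpace.single i 1, 0)

/-- The direction of `ξ_n`. -/
def dirXin (M m : ℕ) : Eu M × (Eu m × ℝ) := (0, 0, 1)

theorem multiDeriv_eq_dirMultiDeriv {k : ℕ} (α : Fin k → ℕ) (g : Eu k → ℂ) :
    multiDeriv α g =
      dirMultiDeriv (fun i => EuclideanSpace.single i (1 : ℝ)) α (List.finRange k) g := rfl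

theorem dirMultiDeriv_zero {P ι : Type} [NormedAddCommGroup P] [NormedSpace ℝ P] (e : ι → P)
    (l : List ι) (F : P → ℂ) : dirMultiDeriv e 0 l F = F := by
  unfold dirMultiDeriv
  induction l with
  | nil => rfl
  | cons i l ih => simp

/-- The derivative `∂_X^β ∂_{ξ'}^α ∂_{ξ_n}^k` of a function of all variables. -/
def jointDeriv (β : Fin M → ℕ) (α : Fin m → ℕ) (k : ℕ) (F : Eu M × (Eu m × ℝ) → ℂ) :
    Eu M × (Eu m × ℝ) → ℂ :=
  dirMultiDeriv (dirX M m) β (List.finRange M)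
    (dirMultiDeriv (dirXi M m) α (List.finRange m) ((dirDeriv (dirXin M m))^[k] F))

theorem iteratedDeriv_eq_iterate_dirDeriv (k : ℕ) (g : ℝ → ℂ) :
    iteratedDeriv k g = (dirDeriv (1 : ℝ))^[k] g := by
  rw [iteratedDeriv_eq_iterate]
  congr 1

/-- Each slice is the composition of the joint function with an affine embedding, so the nested
partial derivatives are directional derivatives of one smooth function, and commute. -/
theorem symDeriv_eq_jointDeriv {a : Eu M → Eu m → ℝ → ℂ} (ha : JointlySmooth a)
    (β : Fin M → ℕ) (α : Fin m → ℕ) (k : ℕ) (X : Eu M) (η : Eu m) (t : ℝ) :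
    symDeriv β α k a X η t = jointDeriv β α k (joint a) (X, η, t) := by
  have ha' : ContDiff ℝ ∞ (joint a) := ha
  have h1 : ∀ (Y : Eu M) (ζ : Eu m) (t : ℝ), iteratedDeriv k (a Y ζ) t =
      (dirDeriv (dirXin M m))^[k] (joint a) (Y, ζ, t) := by
    intro Y ζ t
    have := congrFun (iterate_dirDeriv_comp_affine ha'
      ((ContinuousLinearMap.inr ℝ (Eu M) (Eu m × ℝ)).comp (ContinuousLinearMap.inr ℝ (Eu m) ℝ))
      (Y, ζ, 0) 1 k) t
    rw [iteratedDeriv_eq_iterate_dirDeriv]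
    simpa [joint, dirXin] using this.symm
  have h2 : ∀ (Y : Eu M) (η : Eu m) (t : ℝ),
      multiDeriv α (fun ζ => iteratedDeriv k (a Y ζ) t) η =
      dirMultiDeriv (dirXi M m) α (List.finRange m) ((dirDeriv (dirXin M m))^[k] (joint a))
        (Y, η, t) := by
    intro Y η t
    have := congrFun (dirMultiDeriv_comp_affine (fun i => EuclideanSpace.single i (1 : ℝ)) α
      (List.finRange m) (ha'.iterate_dirDeriv (dirXin M m) k)
      ((ContinuousLinearMap.inr ℝ (Eu M) (Eu m × ℝ)).comp (ContinuousLinearMap.inl ℝ (Eu m) ℝ))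
      (Y, 0, t)) η
    simp_rw [h1]
    simpa [show dirXi M m = fun i => (0, EuclideanSpace.single i 1, 0) from rfl,
      multiDeriv_eq_dirMultiDeriv] using this.symm
  have := congrFun (dirMultiDeriv_comp_affine (fun i => EuclideanSpace.single i (1 : ℝ)) β
      (List.finRange M)
      ((ha'.iterate_dirDeriv (dirXin M m) k).dirMultiDeriv (dirXi M m) α (List.finRange m))
      (ContinuousLinearMap.inl ℝ (Eu M) (Eu m × ℝ)) (0, η, t)) X
  unfold symDeriv
  simp_rw [h2]
  simpa [show dirX M m = fun i => (EuclideanSpace.single i 1, 0) from rfl, jointDeriv,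
    multiDeriv_eq_dirMultiDeriv] using this.symm

/-- The standard basis of the space of all variables. -/
def jointBasis (M m : ℕ) : Module.Basis (Fin M ⊕ (Fin m ⊕ Fin 1)) ℝ (Eu M × (Eu m × ℝ)) :=
  (EuclideanSpace.basisFun (Fin M) ℝ).toBasis.prod
    ((EuclideanSpace.basisFun (Fin m) ℝ).toBasis.prod (Module.Basis.singleton (Fin 1) ℝ))

theorem jointBasis_inl (i : Fin M) : jointBasis M m (Sum.inl i) = dirX M m i := by
  simp only [jointBasis, dirX, Module.Basis.prod_apply]
  simp
  rfl

theorem jointBasis_inr_inl (i : Fin m) : jointBasis M m (Sum.inr (Sum.inl i)) = dirXi M m i := by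
  simp [jointBasis, dirXi]

theorem jointBasis_inr_inr (i : Fin 1) : jointBasis M m (Sum.inr (Sum.inr i)) = dirXin M m := by
  simp [jointBasis, dirXin]

theorem ContDiff.jointDeriv {F : Eu M × (Eu m × ℝ) → ℂ} (hF : ContDiff ℝ ∞ F)
    (β : Fin M → ℕ) (α : Fin m → ℕ) (k : ℕ) : ContDiff ℝ ∞ (jointDeriv β α k F) :=
  ((hF.iterate_dirDeriv _ _).dirMultiDeriv _ _ _).dirMultiDeriv _ _ _

/-- The closure property that lets `exists_iteratedFDeriv_bound` apply to the mixed derivatives of a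
symbol. -/
theorem dirDeriv_jointBasis_jointDeriv {F : Eu M × (Eu m × ℝ) → ℂ} (hF : ContDiff ℝ ∞ F)
    (β : Fin M → ℕ) (α : Fin m → ℕ) (k : ℕ) (i : Fin M ⊕ (Fin m ⊕ Fin 1)) :
    ∃ (β' : Fin M → ℕ) (α' : Fin m → ℕ) (k' : ℕ),
      dirDeriv (jointBasis M m i) (jointDeriv β α k F) = jointDeriv β' α' k' F := by
  have h1 := hF.iterate_dirDeriv (dirXin M m) k
  have h2 := h1.dirMultiDeriv (dirXi M m) α (List.finRange m)
  rcases i with i | i | i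
  · refine ⟨β + Pi.single i 1, α, k, ?_⟩
    rw [jointBasis_inl, jointDeriv, dirDeriv_dirMultiDeriv_comm _ _ _ h2,
      ← dirMultiDeriv_add_single _ _ (List.nodup_finRange _) (List.mem_finRange i) h2]
    rfl
  · refine ⟨β, α + Pi.single i 1, k, ?_⟩
    rw [jointBasis_inr_inl, jointDeriv, dirDeriv_dirMultiDeriv_comm _ _ _ h2,
      dirDeriv_dirMultiDeriv_comm _ _ _ h1,
      ← dirMultiDeriv_add_single _ _ (List.nodup_finRange _) (List.mem_finRange i) h1]
    rfl
  · refine ⟨β, α, k + 1, ?_⟩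
    rw [jointBasis_inr_inr, jointDeriv, dirDeriv_dirMultiDeriv_comm _ _ _ h2,
      dirDeriv_dirMultiDeriv_comm _ _ _ h1, ← Function.iterate_succ_apply' (dirDeriv (dirXin M m))]
    rfl

/-- At order 0 all exponents of ⟨ξ⟩ are nonpositive and ⟨ξ⟩ ≥ 1, so the symbol estimates contain
plain bounds for every derivative. Powers of ⟨ξ'⟩ are recovered later from homogeneity. -/
theorem IsSymbol.locSmoothBdd {q : Eu M → Eu m → ℝ → ℂ} (hq : IsSymbol 0 q) :
    LocSmoothBdd univ (joint q) := by
  intro v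
  refine ⟨univ, isOpen_univ, mem_univ _, hq.1.contDiffOn, fun n => ?_⟩
  have hq1 : ContDiff ℝ ∞ (joint q) := hq.1
  refine exists_iteratedFDeriv_bound (jointBasis M m)
    (W := {F | ∃ β α k, F = jointDeriv β α k (joint q)}) ?_ ?_ ?_ n (joint q) ⟨0, 0, 0, ?_⟩
  · rintro F ⟨β, α, k, rfl⟩
    exact hq1.jointDeriv _ _ _
  · rintro F ⟨β, α, k, rfl⟩ i
    exact dirDeriv_jointBasis_jointDeriv hq1 β α k i
  · rintro F ⟨β, α, k, rfl⟩
    obtain ⟨C, hC⟩ := hq.2 β α k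
    refine ⟨|C|, fun ⟨X, η, t⟩ _ => ?_⟩
    rw [← symDeriv_eq_jointDeriv hq.1]
    refine (hC X η t).trans ?_
    have hb : 1 ≤ bracketFull η t := by
      unfold bracketFull
      rw [Real.one_le_sqrt]
      nlinarith [sq_nonneg ‖η‖, sq_nonneg t]
    have h1 : bracketFull η t ^ (0 - ((∑ i, α i : ℕ) + k : ℝ)) ≤ 1 :=
      Real.rpow_le_one_of_one_le_of_nonpos hb (by
        have : (0 : ℝ) ≤ ((∑ i, α i : ℕ) + k : ℝ) := by positivity
        linarith)
    have h0 : 0 ≤ bracketFull η t ^ (0 - ((∑ i, α i : ℕ) + k : ℝ)) :=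
      Real.rpow_nonneg (by linarith) _
    calc C * bracketFull η t ^ (0 - ((∑ i, α i : ℕ) + k : ℝ))
        ≤ |C| * bracketFull η t ^ (0 - ((∑ i, α i : ℕ) + k : ℝ)) := by
          gcongr; exact le_abs_self C
      _ ≤ |C| * 1 := by gcongr
      _ = |C| := mul_one _
  · simp [jointDeriv, dirMultiDeriv_zero]

/-- The difference between the two restrictions of `q` which the transmission property compares. -/
def transmissionDefect (q : Eu M → Eu m → ℝ → ℂ) : Eu M × Eu m → ℂ :=
  fun z => q z.1 (-z.2) (-1) - q z.1 z.2 1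

theorem contDiff_transmissionDefect {q : Eu M → Eu m → ℝ → ℂ} (hq : JointlySmooth q) :
    ContDiff ℝ ∞ (transmissionDefect q) := by
  have hq' : ContDiff ℝ ∞ (joint q) := hq
  exact (hq'.comp (contDiff_fst.prodMk (contDiff_snd.neg.prodMk contDiff_const))).sub
    (hq'.comp (contDiff_fst.prodMk (contDiff_snd.prodMk contDiff_const)))

/-- The chain rule for ζ ↦ −ζ gives (−1)^{|α|}, which cancels the sign in the transmission property
at ξ_n = 1 with no x- or ξ_n-derivative. -/
theorem dirMultiDeriv_transmissionDefect {q : Eu M → Eu m → ℝ → ℂ} (hq : JointlySmooth q)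
    (ht : ZeroTransmission q) (α : Fin m → ℕ) (x : Eu M) :
    dirMultiDeriv (fun i => ((0, EuclideanSpace.single i 1) : Eu M × Eu m)) α (List.finRange m)
      (transmissionDefect q) (x, 0) = 0 := by
  have hq' : ContDiff ℝ ∞ (joint q) := hq
  have hs : ∀ t : ℝ, ContDiff ℝ ∞ (fun ζ => q x ζ t) := fun t =>
    hq'.comp (contDiff_const.prodMk (contDiff_id.prodMk contDiff_const))
  have h1 := congrFun (dirMultiDeriv_comp_affine (fun i => EuclideanSpace.single i (1 : ℝ)) α
    (List.finRange m) (contDiff_transmissionDefect hq)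
    (ContinuousLinearMap.inr ℝ (Eu M) (Eu m)) (x, 0)) 0
  simp only [ContinuousLinearMap.inr_apply, Prod.mk_add_mk, zero_add, add_zero] at h1
  rw [h1]
  have h2 : ContDiff ℝ ∞ (fun ζ => q x (-ζ) (-1)) := (hs (-1)).comp contDiff_neg
  change dirMultiDeriv _ α _ (fun ζ => q x (-ζ) (-1) - q x ζ 1) 0 = 0
  rw [dirMultiDeriv_sub _ _ _ h2 (hs 1)]
  have h3 := congrFun (dirMultiDeriv_comp_affine (fun i => EuclideanSpace.single i (1 : ℝ)) α
    (List.finRange m) (hs (-1)) (-ContinuousLinearMap.id ℝ (Eu m)) 0) 0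
  simp only [_root_.neg_apply, ContinuousLinearMap.id_apply, neg_zero,
    add_zero] at h3
  rw [dirMultiDeriv_neg_dir _ _ _ (hs (-1))] at h3
  have h4 := ht 0 α 0 x 1 (by simp)
  simp only [symDeriv, iteratedDeriv_zero, add_zero,
    multiDeriv_eq_dirMultiDeriv, dirMultiDeriv_zero] at h4
  have hsum : ((List.finRange m).map α).sum = ∑ i, α i := by
    rw [← List.sum_ofFn, List.ofFn_eq_map]
  simp only [← h3, h4, hsum, ← mul_assoc, ← mul_pow]
  simp

/-- The ξ'-derivatives vanish along all of {ξ' = 0}, hence so do their x-derivatives. Functions with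
this property form a family closed under all basis derivatives. -/
theorem transmissionDefect_flat {q : Eu M → Eu m → ℝ → ℂ} (hq : JointlySmooth q)
    (ht : ZeroTransmission q) (n : ℕ) (x : Eu M) :
    iteratedFDeriv ℝ n (transmissionDefect q) (x, 0) = 0 := by
  let b := (EuclideanSpace.basisFun (Fin M) ℝ).toBasis.prod
    (EuclideanSpace.basisFun (Fin m) ℝ).toBasis
  let e : Fin m → Eu M × Eu m := fun i => (0, EuclideanSpace.single i 1)
  refine iteratedFDeriv_eq_zero_of_dirDeriv b (W := {F | ContDiff ℝ ∞ F ∧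
    ∀ α x, dirMultiDeriv e α (List.finRange m) F (x, 0) = 0}) (fun F hF => hF.1) ?_ ?_ n _
    ⟨contDiff_transmissionDefect hq, dirMultiDeriv_transmissionDefect hq ht⟩
  · rintro F ⟨hF, hF0⟩ i
    refine ⟨hF.dirDeriv _, fun α x => ?_⟩
    rcases i with i | i
    · rw [← dirDeriv_dirMultiDeriv_comm _ _ _ hF]
      have h1 := congrFun (dirDeriv_comp_affine (hF.dirMultiDeriv e α (List.finRange m))
        (ContinuousLinearMap.inl ℝ (Eu M) (Eu m)) 0 (EuclideanSpace.single i (1 : ℝ))) x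
      simp only [ContinuousLinearMap.inl_apply, add_zero, hF0] at h1
      simpa [b, dirDeriv] using h1
    · have : b (Sum.inr i) = e i := by simp [b, e]
      rw [this, ← dirMultiDeriv_add_single _ _ (List.nodup_finRange _) (List.mem_finRange i) hF]
      exact hF0 _ _
  · rintro F ⟨hF, hF0⟩
    have := hF0 0 x
    rwa [dirMultiDeriv_zero] at this

end Symbols

/-! ### The symbol as a smooth function on the circle. -/

noncomputable section Circle

variable {M m : ℕ}

/-- The symbol `q (x, ξ', u⁻¹)` near `u = 0`, for a symbol homogeneous of degree `0` with the
transmission property. -/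
def chartAtInfinity (q : Eu M → Eu m → ℝ → ℂ) : Eu M × (Eu m × ℝ) → ℂ := fun p =>
  q p.1 (p.2.2 • p.2.1) 1 +
    if p.2.2 < 0 then transmissionDefect q (p.1, p.2.2 • p.2.1) else 0

theorem chartAtInfinity_zero (q : Eu M → Eu m → ℝ → ℂ) (x : Eu M) (η : Eu m) :
    chartAtInfinity q (x, η, 0) = q x 0 1 := by simp [chartAtInfinity]

/-- Homogeneity with factor |u|⁻¹ ≥ 1, applied at (uη, 1) for u > 0 and at (−uη, −1) for u < 0. Both
points lie outside the unit ball whatever η is. -/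
theorem chartAtInfinity_eq {q : Eu M → Eu m → ℝ → ℂ} (hq : HomogeneousZero q) (x : Eu M)
    (η : Eu m) {u : ℝ} (hu : u ≠ 0) (hu1 : |u| ≤ 1) :
    chartAtInfinity q (x, η, u) = q x η u⁻¹ := by
  have hout : ∀ (ζ : Eu m) (t : ℝ), |t| = 1 → OutsideUnitBall ζ t := fun ζ t ht => by
    unfold OutsideUnitBall
    rw [Real.one_le_sqrt, ← sq_abs t, ht]
    nlinarith [sq_nonneg ‖ζ‖]
  rcases lt_or_gt_of_ne hu with h | h
  · have h1 := hq x (-(u • η)) (-1) (hout _ _ (by simp)) (-u)⁻¹ (by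
      rw [abs_of_neg h] at hu1
      exact (one_le_inv₀ (by linarith)).2 hu1)
    simp only [chartAtInfinity, h, if_true, transmissionDefect]
    rw [add_sub_cancel, ← h1, smul_neg, smul_smul]
    congr 1
    · rw [inv_neg, neg_mul, inv_mul_cancel₀ hu]; simp
    · rw [inv_neg]; simp
  · have h1 := hq x (u • η) 1 (hout _ _ (by simp)) u⁻¹ (by
      rw [abs_of_pos h] at hu1
      exact (one_le_inv₀ h).2 hu1)
    simp only [chartAtInfinity, h.not_gt, if_false, add_zero]
    rw [← h1, smul_smul, inv_mul_cancel₀ hu, one_smul, mul_one]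

/-- The first summand is smooth across u = 0. The second is cut off at u = 0, where uη = 0 and the
transmission defect is flat, so the cut costs neither smoothness nor bounds. -/
theorem LocSmoothBdd.chartAtInfinity {q : Eu M → Eu m → ℝ → ℂ} (hq : JointlySmooth q)
    (ht : ZeroTransmission q) {S : Set (Eu M)} (hS : IsOpen S) (hb : LocSmoothBdd S (joint q)) :
    LocSmoothBdd S (chartAtInfinity q) := by
  have hsm : ContDiff ℝ ∞ (fun v : Eu m × ℝ => v.2 • v.1) := contDiff_snd.smul contDiff_fst
  have h1 : LocSmoothBdd S (fun p : Eu M × (Eu m × ℝ) => q p.1 (p.2.2 • p.2.1) 1) :=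
    hb.comp_right (γ := fun v : Eu m × ℝ => (v.2 • v.1, (1 : ℝ))) hS
      (hsm.prodMk contDiff_const)
  have h2 : LocSmoothBdd S (fun p : Eu M × (Eu m × ℝ) => q p.1 (-(p.2.2 • p.2.1)) (-1)) :=
    hb.comp_right (γ := fun v : Eu m × ℝ => (-(v.2 • v.1), (-1 : ℝ))) hS
      (hsm.neg.prodMk contDiff_const)
  set Z : Eu M × (Eu m × ℝ) → ℂ := fun p => transmissionDefect q (p.1, p.2.2 • p.2.1) with hZ
  have hΓ : ContDiff ℝ ∞ (fun p : Eu M × (Eu m × ℝ) => (p.1, p.2.2 • p.2.1)) :=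
    contDiff_fst.prodMk (hsm.comp contDiff_snd)
  have hZs : ContDiff ℝ ∞ Z := (contDiff_transmissionDefect hq).comp hΓ
  have hflat : ∀ p : Eu M × (Eu m × ℝ), p.2.2 = 0 → ∀ n : ℕ, iteratedFDeriv ℝ n Z p = 0 := by
    intro p hp n
    -- The chain-rule bound with C = 0, since the outer derivatives vanish at (x, 0); D is just some
    -- bound ≥ 1 for the inner derivatives at p.
    have := norm_iteratedFDeriv_comp_le (n := n) (C := 0)
      (D := 1 + ∑ i ∈ Finset.range (n + 1), ‖iteratedFDeriv ℝ i
        (fun p : Eu M × (Eu m × ℝ) => (p.1, p.2.2 • p.2.1)) p‖)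
      (contDiff_transmissionDefect hq) hΓ (by exact_mod_cast le_top) p ?_ ?_
    · rw [mul_zero, zero_mul] at this
      exact norm_le_zero_iff.1 this
    · intro i _
      rw [hp, zero_smul, transmissionDefect_flat hq ht, norm_zero]
    · intro i hi1 hin
      have h0 : ∀ j ∈ Finset.range (n + 1), 0 ≤ ‖iteratedFDeriv ℝ j
        (fun p : Eu M × (Eu m × ℝ) => (p.1, p.2.2 • p.2.1)) p‖ := fun _ _ => norm_nonneg _
      have h2 := Finset.single_le_sum h0 (Finset.mem_range.2 (by omega : i < n + 1))
      refine le_trans ?_ (le_self_pow₀ (by linarith [Finset.sum_nonneg h0]) (by omega))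
      linarith
  have hℓ : Continuous (fun p : Eu M × (Eu m × ℝ) => p.2.2) := by fun_prop
  intro v
  refine (h1 v).add hS ?_
  obtain ⟨N, hN, hv, hs⟩ := (h2 v).sub hS (h1 v)
  refine ⟨N, hN, hv, ?_⟩
  have hs' : SmoothBddOn (S ×ˢ N) Z := hs
  constructor
  · convert (contDiff_ite_flat hZs hℓ hflat).contDiffOn
  · intro n
    obtain ⟨C, hC⟩ := hs'.2 n
    refine ⟨C, fun p hp => ?_⟩
    have := (norm_iteratedFDeriv_ite_flat_le hZs hℓ hflat n p).trans (hC p hp)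
    convert this

/-- The symbol in the coordinate `φ` on the circle with `ξ_n = cot (φ / 2)`. -/
def circleSymbol (q : Eu M → Eu m → ℝ → ℂ) : Eu M × (Eu m × ℝ) → ℂ := fun p =>
  if Real.sin (p.2.2 / 2) = 0 then q p.1 0 1
  else q p.1 p.2.1 (Real.cos (p.2.2 / 2) / Real.sin (p.2.2 / 2))

theorem circleSymbol_add_two_pi (q : Eu M → Eu m → ℝ → ℂ) (x : Eu M) (η : Eu m) (φ : ℝ) :
    circleSymbol q (x, η, φ + 2 * Real.pi) = circleSymbol q (x, η, φ) := by
  have h : (φ + 2 * Real.pi) / 2 = φ / 2 + Real.pi := by ring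
  simp [circleSymbol, h, Real.sin_add_pi, Real.cos_add_pi]

/-- Two charts: u = tan(φ/2) near the point at infinity, where `chartAtInfinity` is smooth, and ξ_n
= cot(φ/2) elsewhere. -/
theorem LocSmoothBdd.circleSymbol {q : Eu M → Eu m → ℝ → ℂ} (hq : JointlySmooth q)
    (hhom : HomogeneousZero q) (ht : ZeroTransmission q) {S : Set (Eu M)} (hS : IsOpen S)
    (hb : LocSmoothBdd S (joint q)) : LocSmoothBdd S (circleSymbol q) := by
  rintro ⟨η, φ⟩
  have hcs : Continuous (fun v : Eu m × ℝ => Real.sin (v.2 / 2)) := by fun_prop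
  have hcc : Continuous (fun v : Eu m × ℝ => Real.cos (v.2 / 2)) := by fun_prop
  have hss : ContDiff ℝ ∞ (fun v : Eu m × ℝ => Real.sin (v.2 / 2)) :=
    Real.contDiff_sin.comp (contDiff_snd.div_const 2)
  have hsc : ContDiff ℝ ∞ (fun v : Eu m × ℝ => Real.cos (v.2 / 2)) :=
    Real.contDiff_cos.comp (contDiff_snd.div_const 2)
  by_cases h : Real.sin (φ / 2) = 0
  · have hc : Real.cos (φ / 2) ≠ 0 := fun hc => by
      have := Real.sin_sq_add_cos_sq (φ / 2)
      rw [h, hc] at this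
      norm_num at this
    set U : Set (Eu m × ℝ) := {v | Real.cos (v.2 / 2) ≠ 0}
    have hU : IsOpen U := isOpen_ne_fun hcc continuous_const
    have hγ : ContDiffOn ℝ ∞
        (fun v : Eu m × ℝ => (v.1, Real.sin (v.2 / 2) / Real.cos (v.2 / 2))) U :=
      contDiff_fst.contDiffOn.prodMk (hss.contDiffOn.div hsc.contDiffOn fun v hv => hv)
    have hct : ContinuousAt
        (fun v : Eu m × ℝ => Real.sin (v.2 / 2) / Real.cos (v.2 / 2)) (η, φ) :=
      hcs.continuousAt.div hcc.continuousAt hc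
    refine LocSmoothBddAt.congr hS (LocSmoothBddAt.comp_right hS hU (w := (η, φ)) hc hγ
      (hb.chartAtInfinity hq ht hS _)) ?_
    have h1 : ∀ᶠ v in 𝓝 (η, φ), |Real.sin (v.2 / 2) / Real.cos (v.2 / 2)| < 1 :=
      hct.abs.eventually_lt_const (by simp [h])
    filter_upwards [h1, hU.mem_nhds hc] with v hv hvc x _
    simp only [_root_.circleSymbol]
    split_ifs with hs
    · rw [hs, zero_div, chartAtInfinity_zero]
    · rw [chartAtInfinity_eq hhom _ _ (div_ne_zero hs hvc) hv.le, inv_div]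
  · set U : Set (Eu m × ℝ) := {v | Real.sin (v.2 / 2) ≠ 0}
    have hU : IsOpen U := isOpen_ne_fun hcs continuous_const
    have hγ : ContDiffOn ℝ ∞
        (fun v : Eu m × ℝ => (v.1, Real.cos (v.2 / 2) / Real.sin (v.2 / 2))) U :=
      contDiff_fst.contDiffOn.prodMk (hsc.contDiffOn.div hss.contDiffOn fun v hv => hv)
    refine LocSmoothBddAt.congr hS (LocSmoothBddAt.comp_right hS hU (w := (η, φ)) h hγ (hb _)) ?_
    filter_upwards [hU.mem_nhds h] with v hv x _
    simp only [_root_.circleSymbol]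
    rw [if_neg hv]
    rfl

end Circle

/-! ### The projection onto positive frequencies. -/

noncomputable section Projection

open Complex (I)

theorem summable_inv_succ_sq : Summable (fun n : ℕ => 1 / ((n : ℝ) + 1) ^ 2) := by
  have := (summable_nat_add_iff 1).2 (Real.summable_one_div_nat_pow.2 (by norm_num : 1 < 2))
  simpa using this

/-- The kernel `- ∑ e^{iks} / k²`, summed over `k ≥ 1`. -/
def hardyKernel (s : ℝ) : ℂ :=
  ∑' n : ℕ, -(1 / ((n : ℂ) + 1) ^ 2) * Complex.exp (((n : ℂ) + 1) * I * s)

theorem norm_hardyKernel_term (n : ℕ) (s : ℝ) :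
    ‖-(1 / ((n : ℂ) + 1) ^ 2) * Complex.exp (((n : ℂ) + 1) * I * s)‖ = 1 / ((n : ℝ) + 1) ^ 2 := by
  have h1 : ((n : ℂ) + 1) * I * s = (((n : ℝ) + 1) * s : ℝ) * I := by push_cast; ring
  have h2 : ‖(n : ℂ) + 1‖ = (n : ℝ) + 1 := by
    rw [show (n : ℂ) + 1 = ((n + 1 : ℕ) : ℂ) by push_cast; rfl, Complex.norm_natCast]
    push_cast; rfl
  rw [norm_mul, h1, Complex.norm_exp_ofReal_mul_I, mul_one, norm_neg, norm_div, norm_pow, h2]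
  simp

theorem continuous_hardyKernel : Continuous hardyKernel :=
  continuous_tsum (fun n => by fun_prop) summable_inv_succ_sq
    fun n s => (norm_hardyKernel_term n s).le

theorem hardyKernel_hasSum (s : ℝ) :
    HasSum (fun n : ℕ => -(1 / ((n : ℂ) + 1) ^ 2) * Complex.exp (((n : ℂ) + 1) * I * s))
      (hardyKernel s) :=
  (Summable.of_norm (by simpa only [norm_hardyKernel_term] using summable_inv_succ_sq)).hasSum

theorem bernoulli_two_eval (x : ℝ) :
    ((Polynomial.bernoulli 2).map (algebraMap ℚ ℝ)).eval x = x ^ 2 - x + 1 / 6 := by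
  rw [Polynomial.bernoulli_def]
  simp [Finset.sum_range_succ, bernoulli_one, bernoulli_two]
  ring

/-- The left side is −2 ∑ cos(ks)/k², the Fourier series of a multiple of the second Bernoulli
polynomial. -/
theorem hardyKernel_add_conj {s : ℝ} (hs : s ∈ Icc 0 (2 * Real.pi)) :
    hardyKernel s + (starRingEnd ℂ) (hardyKernel s) =
      ((-(Real.pi ^ 2 / 3) + Real.pi * s - s ^ 2 / 2 : ℝ) : ℂ) := by
  have hpi := Real.pi_pos
  have hx : s / (2 * Real.pi) ∈ Icc (0 : ℝ) 1 :=
    ⟨by have := hs.1; positivity, by rw [div_le_one (by positivity)]; exact hs.2⟩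
  have h1 := hasSum_one_div_nat_pow_mul_cos one_ne_zero hx
  simp only [mul_one] at h1
  rw [bernoulli_two_eval] at h1
  have h2 : HasSum (fun n : ℕ => 1 / ((n : ℝ) + 1) ^ 2 * Real.cos (((n : ℝ) + 1) * s))
      (Real.pi ^ 2 / 6 - Real.pi * s / 2 + s ^ 2 / 4) := by
    -- The known series starts at index 0, where the term is zero because 1/0² = 0; it is split off
    -- to sum over k ≥ 1.
    have hval : Real.pi ^ 2 / 6 - Real.pi * s / 2 + s ^ 2 / 4 + ∑ i ∈ Finset.range 1,
        1 / (i : ℝ) ^ 2 * Real.cos (2 * Real.pi * i * (s / (2 * Real.pi))) =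
        (-1) ^ (1 + 1) * (2 * Real.pi) ^ 2 / 2 / (Nat.factorial 2) *
          ((s / (2 * Real.pi)) ^ 2 - s / (2 * Real.pi) + 1 / 6) := by
      simp [Nat.factorial]
      field_simp
      ring
    rw [← hval] at h1
    have h3 := (hasSum_nat_add_iff 1).2 h1
    refine h3.congr_fun fun n => ?_
    push_cast
    congr 2
    field_simp
  have h4 := (hardyKernel_hasSum s).add (Complex.hasSum_conj'.2 (hardyKernel_hasSum s))
  have h5 := (Complex.hasSum_ofReal.2 h2).mul_left (-2)
  have h6 : ∀ n : ℕ, -(1 / ((n : ℂ) + 1) ^ 2) * Complex.exp (((n : ℂ) + 1) * I * s) +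
      (starRingEnd ℂ) (-(1 / ((n : ℂ) + 1) ^ 2) * Complex.exp (((n : ℂ) + 1) * I * s)) =
      -2 * ((1 / ((n : ℝ) + 1) ^ 2 * Real.cos (((n : ℝ) + 1) * s) : ℝ) : ℂ) := fun n => by
    rw [Complex.add_conj,
      show -(1 / ((n : ℂ) + 1) ^ 2) = ((-(1 / ((n : ℝ) + 1) ^ 2) : ℝ) : ℂ) by push_cast; rfl,
      show ((n : ℂ) + 1) * I * s = ((((n : ℝ) + 1) * s : ℝ) : ℂ) * I by push_cast; ring,
      Complex.re_ofReal_mul, Complex.exp_ofReal_mul_I_re]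
    push_cast
    ring
  simp_rw [h6] at h4
  rw [h4.unique h5]
  push_cast
  ring

/-- The part of a periodic function with positive frequencies, normalised to vanish at `0`. -/
def hardyProj (ψ : ℝ → ℂ) (φ : ℝ) : ℂ :=
  (2 * Real.pi : ℂ)⁻¹ * ∫ s in (0 : ℝ)..2 * Real.pi,
    hardyKernel s * (deriv (deriv ψ) (φ - s) - deriv (deriv ψ) (0 - s))

theorem periodic_deriv {ψ : ℝ → ℂ} {T : ℝ} (h : Function.Periodic ψ T) :
    Function.Periodic (deriv ψ) T := fun x => by
  rw [← deriv_comp_add_const, show (fun x => ψ (x + T)) = ψ from funext h]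

/-- Integrate by parts twice: the quadratic B has B' = π − s, B'' = −1 and B(0) = B(2π). The
boundary terms with ψ' cancel, and the jump 2π of π − s yields 2πψ(φ). -/
theorem integral_hardyKernel_real {ψ : ℝ → ℂ} (hψ : ContDiff ℝ ∞ ψ)
    (hp : Function.Periodic ψ (2 * Real.pi)) (φ : ℝ) :
    ∫ s in (0 : ℝ)..2 * Real.pi, ((-(Real.pi ^ 2 / 3) + Real.pi * s - s ^ 2 / 2 : ℝ) : ℂ) *
      deriv (deriv ψ) (φ - s) = 2 * Real.pi * ψ φ - ∫ s in (0 : ℝ)..2 * Real.pi, ψ s := by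
  have hd1 : ContDiff ℝ ∞ (deriv ψ) := (contDiff_infty_iff_deriv.1 hψ).2
  have hd2 : ContDiff ℝ ∞ (deriv (deriv ψ)) := (contDiff_infty_iff_deriv.1 hd1).2
  have hintegrable : ∫ s in (0 : ℝ)..2 * Real.pi, ψ s = ∫ s in (0 : ℝ)..2 * Real.pi, ψ (φ - s) := by
    rw [intervalIntegral.integral_comp_sub_left]
    have := hp.intervalIntegral_add_eq 0 (φ - 2 * Real.pi)
    simpa using this
  have hc : Continuous (fun s : ℝ => ((-(Real.pi ^ 2 / 3) + Real.pi * s - s ^ 2 / 2 : ℝ) : ℂ) *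
      deriv (deriv ψ) (φ - s)) := by
    have := hd2.continuous
    fun_prop
  have hc' : Continuous (fun s : ℝ => ψ (φ - s)) := by
    have := hψ.continuous
    fun_prop
  rw [eq_sub_iff_add_eq, hintegrable, ← intervalIntegral.integral_add (hc.intervalIntegrable _ _)
    (hc'.intervalIntegrable _ _)]
  have hder : ∀ s : ℝ, HasDerivAt (fun s : ℝ =>
      -((-(Real.pi ^ 2 / 3) + Real.pi * s - s ^ 2 / 2 : ℝ) : ℂ) * deriv ψ (φ - s)
        - ((Real.pi - s : ℝ) : ℂ) * ψ (φ - s))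
      (((-(Real.pi ^ 2 / 3) + Real.pi * s - s ^ 2 / 2 : ℝ) : ℂ) *
      deriv (deriv ψ) (φ - s) + ψ (φ - s)) s := by
    intro s
    have e2 : HasDerivAt (fun s => ψ (φ - s)) (-deriv ψ (φ - s)) s :=
      (hψ.differentiable (by simp) (φ - s)).hasDerivAt.comp_const_sub φ s
    have e3 : HasDerivAt (fun s => deriv ψ (φ - s)) (-deriv (deriv ψ) (φ - s)) s :=
      (hd1.differentiable (by simp) (φ - s)).hasDerivAt.comp_const_sub φ s
    have e4 : HasDerivAt (fun s : ℝ => ((-(Real.pi ^ 2 / 3) + Real.pi * s - s ^ 2 / 2 : ℝ) : ℂ))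
        ((Real.pi - s : ℝ) : ℂ) s := by
      apply HasDerivAt.ofReal_comp
      have := (((hasDerivAt_id s).const_mul Real.pi).const_add (-(Real.pi ^ 2 / 3))).sub
        (((hasDerivAt_id s).pow 2).div_const 2)
      refine this.congr_deriv ?_
      simp
    have e5 : HasDerivAt (fun s : ℝ => ((Real.pi - s : ℝ) : ℂ)) (((-1 : ℝ)) : ℂ) s := by
      apply HasDerivAt.ofReal_comp
      simpa using (hasDerivAt_id s).const_sub Real.pi
    refine ((e4.neg.mul e3).sub (e5.mul e2)).congr_deriv ?_
    push_cast
    simp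
    ring
  rw [intervalIntegral.integral_eq_sub_of_hasDerivAt (fun s _ => hder s)
    ((hc.add hc').intervalIntegrable _ _)]
  have p1 : ψ (φ - 2 * Real.pi) = ψ φ := hp.sub_eq φ
  have p2 : deriv ψ (φ - 2 * Real.pi) = deriv ψ φ := (periodic_deriv hp).sub_eq φ
  rw [p1, p2]
  push_cast
  simp
  ring

/-- Conjugating the projection of ψ̄ replaces the kernel by its conjugate, so the second summand is
the negative-frequency part of ψ. The sum has the Bernoulli kernel, and the mean of ψ cancels
between φ and 0. -/
theorem hardyProj_add_conj {ψ : ℝ → ℂ} (hψ : ContDiff ℝ ∞ ψ)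
    (hp : Function.Periodic ψ (2 * Real.pi)) (φ : ℝ) :
    hardyProj ψ φ + (starRingEnd ℂ) (hardyProj (fun s => (starRingEnd ℂ) (ψ s)) φ) =
      ψ φ - ψ 0 := by
  have hd1 : ContDiff ℝ ∞ (deriv ψ) := (contDiff_infty_iff_deriv.1 hψ).2
  have hd2 : ContDiff ℝ ∞ (deriv (deriv ψ)) := (contDiff_infty_iff_deriv.1 hd1).2
  have hconj : deriv (deriv fun s => (starRingEnd ℂ) (ψ s)) =
      fun s => (starRingEnd ℂ) (deriv (deriv ψ) s) := by
    have : ∀ f : ℝ → ℂ, (deriv fun s => (starRingEnd ℂ) (f s)) =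
        fun s => (starRingEnd ℂ) (deriv f s) := fun f => funext fun s => deriv.star
    rw [this, this]
  have hE := continuous_hardyKernel
  have hc := hd2.continuous
  have hcc : Continuous (fun s => (starRingEnd ℂ) (hardyKernel s)) := Complex.continuous_conj.comp hE
  unfold hardyProj
  rw [map_mul, ← intervalIntegral.intervalIntegral_conj, hconj]
  simp only [map_mul, map_sub, map_inv₀, Complex.conj_conj, Complex.conj_ofReal, map_ofNat]
  rw [← mul_add, ← intervalIntegral.integral_add
    ((by fun_prop : Continuous _).intervalIntegrable _ _)
    ((by fun_prop : Continuous _).intervalIntegrable _ _)]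
  have : ∫ s in (0 : ℝ)..2 * Real.pi, (hardyKernel s * (deriv (deriv ψ) (φ - s) -
        deriv (deriv ψ) (0 - s)) + (starRingEnd ℂ) (hardyKernel s) * (deriv (deriv ψ) (φ - s) -
        deriv (deriv ψ) (0 - s))) = ∫ s in (0 : ℝ)..2 * Real.pi,
      (((-(Real.pi ^ 2 / 3) + Real.pi * s - s ^ 2 / 2 : ℝ) : ℂ) * deriv (deriv ψ) (φ - s) -
      ((-(Real.pi ^ 2 / 3) + Real.pi * s - s ^ 2 / 2 : ℝ) : ℂ) * deriv (deriv ψ) (0 - s)) := by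
    refine intervalIntegral.integral_congr fun s hs => ?_
    rw [uIcc_of_le (by positivity)] at hs
    rw [← hardyKernel_add_conj hs]
    ring
  rw [this, intervalIntegral.integral_sub
    ((by fun_prop : Continuous _).intervalIntegrable _ _)
    ((by fun_prop : Continuous _).intervalIntegrable _ _),
    integral_hardyKernel_real hψ hp, integral_hardyKernel_real hψ hp]
  have : (Real.pi : ℂ) ≠ 0 := by exact_mod_cast Real.pi_ne_zero
  field_simp
  ring

/-- Term-by-term integration gives ∑ b_n (w^{n+1} − 1) at w = e^{iφ}, with |b_n| ≤ C/(n+1)² from a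
bound of ψ''. The series converges uniformly on the closed disc. -/
theorem exists_hardyProj_eq_powerSeries {ψ : ℝ → ℂ} (hψ : ContDiff ℝ ∞ ψ)
    (hp : Function.Periodic ψ (2 * Real.pi)) :
    ∃ A : ℂ → ℂ, DiffContOnCl ℂ A (Metric.ball 0 1) ∧ A 1 = 0 ∧
      ∀ φ : ℝ, hardyProj ψ φ = A (Complex.exp (φ * I)) := by
  have hd1 : ContDiff ℝ ∞ (deriv ψ) := (contDiff_infty_iff_deriv.1 hψ).2
  have hd2 : ContDiff ℝ ∞ (deriv (deriv ψ)) := (contDiff_infty_iff_deriv.1 hd1).2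
  set g : ℝ → ℂ := deriv (deriv ψ) with hg
  have hgp : Function.Periodic g (2 * Real.pi) := periodic_deriv (periodic_deriv hp)
  have hgc : Continuous g := hd2.continuous
  obtain ⟨C, hC⟩ : ∃ C : ℝ, ∀ s, ‖g s‖ ≤ C := by
    obtain ⟨C, hC⟩ := (isCompact_Icc (a := (0 : ℝ)) (b := 2 * Real.pi)).exists_bound_of_continuousOn
      hgc.continuousOn
    refine ⟨C, fun s => ?_⟩
    obtain ⟨y, hy, hys⟩ := hgp.exists_mem_Ico₀ (by positivity) s
    rw [hys]
    exact hC y ⟨hy.1, hy.2.le⟩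
  have hC0 : 0 ≤ C := (norm_nonneg _).trans (hC 0)
  set c : ℕ → ℂ := fun n => ∫ r in (0 : ℝ)..2 * Real.pi, Complex.exp (-((n : ℂ) + 1) * I * r) * g r
    with hc
  have hexp : ∀ (n : ℕ) (r : ℝ), ‖Complex.exp (-((n : ℂ) + 1) * I * r)‖ = 1 := fun n r => by
    rw [show -((n : ℂ) + 1) * I * r = ((-((n : ℝ) + 1) * r : ℝ) : ℂ) * I by push_cast; ring]
    exact Complex.norm_exp_ofReal_mul_I _
  have hcb : ∀ n, ‖c n‖ ≤ C * |2 * Real.pi - 0| := fun n =>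
    intervalIntegral.norm_integral_le_of_norm_le_const fun r _ => by
      rw [norm_mul, hexp, one_mul]; exact hC r
  -- Substitute r = φ − s and shift the period interval: convolution with an exponential is
  -- multiplication of it by a Fourier coefficient of g.
  have hterm : ∀ (n : ℕ) (φ : ℝ), ∫ s in (0 : ℝ)..2 * Real.pi,
      Complex.exp (((n : ℂ) + 1) * I * s) * g (φ - s) = Complex.exp (φ * I) ^ (n + 1) * c n := by
    intro n φ
    have hper : Function.Periodic (fun r : ℝ => Complex.exp (-((n : ℂ) + 1) * I * r) * g r)
        (2 * Real.pi) := fun r => by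
      simp only [hgp r]
      congr 1
      rw [show -((n : ℂ) + 1) * I * ((r + 2 * Real.pi : ℝ) : ℂ) =
        -((n : ℂ) + 1) * I * r + ((-((n : ℤ) + 1) : ℤ) : ℂ) * (2 * Real.pi * I) by push_cast; ring]
      rw [Complex.exp_add, Complex.exp_int_mul_two_pi_mul_I, mul_one]
    have h1 : ∀ s : ℝ, Complex.exp (((n : ℂ) + 1) * I * s) * g (φ - s) =
        Complex.exp (φ * I) ^ (n + 1) *
          (Complex.exp (-((n : ℂ) + 1) * I * ((φ - s : ℝ) : ℂ)) * g (φ - s)) := fun s => by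
      rw [← mul_assoc, ← Complex.exp_nat_mul, ← Complex.exp_add]
      congr 2
      push_cast
      ring
    simp_rw [h1]
    rw [intervalIntegral.integral_const_mul,
      intervalIntegral.integral_comp_sub_left
        (fun r : ℝ => Complex.exp (-((n : ℂ) + 1) * I * r) * g r)]
    have := hper.intervalIntegral_add_eq 0 (φ - 2 * Real.pi)
    simp only [zero_add, sub_add_cancel] at this
    rw [sub_zero, ← this]
  set b : ℕ → ℂ := fun n => (2 * Real.pi : ℂ)⁻¹ * (-(1 / ((n : ℂ) + 1) ^ 2) * c n) with hb
  have hbn : ∀ n, ‖b n‖ ≤ C * (1 / ((n : ℝ) + 1) ^ 2) := fun n => by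
    have h2 : ‖-(1 / ((n : ℂ) + 1) ^ 2)‖ = 1 / ((n : ℝ) + 1) ^ 2 := by
      simpa using norm_hardyKernel_term n 0
    have h3 : ‖(2 * Real.pi : ℂ)⁻¹‖ = (2 * Real.pi)⁻¹ := by
      rw [norm_inv, norm_mul, Complex.norm_real, Real.norm_of_nonneg Real.pi_pos.le]; simp
    rw [hb, norm_mul, norm_mul, h2, h3]
    have h4 := hcb n
    rw [sub_zero, abs_of_pos (by positivity)] at h4
    calc (2 * Real.pi)⁻¹ * (1 / ((n : ℝ) + 1) ^ 2 * ‖c n‖)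
        ≤ (2 * Real.pi)⁻¹ * (1 / ((n : ℝ) + 1) ^ 2 * (C * (2 * Real.pi))) := by gcongr
      _ = C * (1 / ((n : ℝ) + 1) ^ 2) := by
        have := Real.pi_ne_zero
        field_simp
  have hsum : Summable (fun n : ℕ => 2 * (C * (1 / ((n : ℝ) + 1) ^ 2))) :=
    (summable_inv_succ_sq.mul_left C).mul_left 2
  have htb : ∀ (n : ℕ), ∀ w ∈ Metric.closedBall (0 : ℂ) 1,
      ‖b n * (w ^ (n + 1) - 1)‖ ≤ 2 * (C * (1 / ((n : ℝ) + 1) ^ 2)) := fun n w hw => by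
    rw [mem_closedBall_zero_iff] at hw
    have : ‖w ^ (n + 1) - 1‖ ≤ 2 := by
      refine (norm_sub_le _ _).trans ?_
      rw [norm_pow, norm_one]
      linarith [pow_le_one₀ (n := n + 1) (norm_nonneg w) hw]
    rw [norm_mul, mul_comm]
    exact mul_le_mul this (hbn n) (norm_nonneg _) (by norm_num)
  refine ⟨fun w => ∑' n, b n * (w ^ (n + 1) - 1), ⟨?_, ?_⟩, by simp, fun φ => ?_⟩
  · exact Complex.differentiableOn_tsum_of_summable_norm hsum (fun n => by fun_prop)
      Metric.isOpen_ball fun n w hw => htb n w (Metric.ball_subset_closedBall hw)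
  · rw [closure_ball _ one_ne_zero]
    exact continuousOn_tsum (fun n => by fun_prop) hsum htb
  · have hI : ∀ φ : ℝ, HasSum
        (fun n : ℕ => -(1 / ((n : ℂ) + 1) ^ 2) * c n * Complex.exp (φ * I) ^ (n + 1))
        (∫ s in (0 : ℝ)..2 * Real.pi, hardyKernel s * g (φ - s)) := by
      intro φ
      have := intervalIntegral.hasSum_integral_of_dominated_convergence
        (μ := MeasureTheory.volume) (a := 0) (b := 2 * Real.pi)
        (F := fun (n : ℕ) (s : ℝ) =>
          (-(1 / ((n : ℂ) + 1) ^ 2) * Complex.exp (((n : ℂ) + 1) * I * s)) * g (φ - s))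
        (f := fun s => hardyKernel s * g (φ - s))
        (fun n _ => 1 / ((n : ℝ) + 1) ^ 2 * C) (fun n => ?_) (fun n => ?_) ?_ ?_ ?_
      · refine this.congr_fun fun n => ?_
        rw [mul_assoc, mul_comm (c n), ← hterm, ← intervalIntegral.integral_const_mul]
        simp only [mul_assoc]
      · exact (by fun_prop : Continuous _).aestronglyMeasurable
      · refine Eventually.of_forall fun s _ => ?_
        rw [norm_mul, norm_hardyKernel_term]
        gcongr
        exact hC _
      · exact Eventually.of_forall fun s _ => summable_inv_succ_sq.mul_right C
      · exact intervalIntegrable_const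
      · exact Eventually.of_forall fun s _ => (hardyKernel_hasSum s).mul_right _
    have h1 := ((hI φ).sub (hI 0)).mul_left ((2 * Real.pi : ℂ)⁻¹)
    rw [← intervalIntegral.integral_sub] at h1
    · unfold hardyProj
      have h2 := h1.tsum_eq
      simp_rw [← mul_sub] at h2
      rw [← h2]
      refine tsum_congr fun n => ?_
      simp [hb]
      ring
    · exact ((continuous_hardyKernel.mul (hgc.comp (by fun_prop))).intervalIntegrable _ _)
    · exact ((continuous_hardyKernel.mul (hgc.comp (by fun_prop))).intervalIntegrable _ _)

end Projection

/-! ### Uniqueness of the holomorphic splitting, the Cayley transform and dilations. -/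

noncomputable section Uniqueness

open Complex (I)

/-- By the maximum principle e^G and e^{−G} both have modulus ≤ 1, hence |e^G| = 1 throughout. So
e^G is constant in the disc and G' = 0. -/
theorem DiffContOnCl.eq_center_of_re_eq_zero {G : ℂ → ℂ} (hG : DiffContOnCl ℂ G (Metric.ball 0 1))
    (hre : ∀ w : ℂ, ‖w‖ = 1 → (G w).re = 0) : ∀ w ∈ Metric.closedBall (0 : ℂ) 1, G w = G 0 := by
  have hexp : ∀ H : ℂ → ℂ, DiffContOnCl ℂ H (Metric.ball 0 1) →
      DiffContOnCl ℂ (fun w => Complex.exp (H w)) (Metric.ball 0 1) := fun H hH =>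
    Complex.differentiable_exp.diffContOnCl.comp hH (mapsTo_univ _ _)
  have hle : ∀ H : ℂ → ℂ, DiffContOnCl ℂ H (Metric.ball 0 1) → (∀ w : ℂ, ‖w‖ = 1 → (H w).re = 0) →
      ∀ w ∈ Metric.closedBall (0 : ℂ) 1, ‖Complex.exp (H w)‖ ≤ 1 := by
    intro H hH h0 w hw
    refine Complex.norm_le_of_forall_mem_frontier_norm_le Metric.isBounded_ball (hexp H hH)
      (fun z hz => ?_) (by rwa [closure_ball _ one_ne_zero])
    rw [frontier_ball _ one_ne_zero, mem_sphere_zero_iff_norm] at hz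
    rw [Complex.norm_exp, h0 z hz, Real.exp_zero]
  have h1 := hle G hG hre
  have h2 := hle (fun w => -G w) hG.neg (fun w hw => by simp [hre w hw])
  have hmax : IsMaxOn (norm ∘ fun w => Complex.exp (G w)) (Metric.ball 0 1) 0 := by
    intro w hw
    have e1 := h1 w (Metric.ball_subset_closedBall hw)
    have e2 := h2 0 (by simp)
    rw [Complex.norm_exp, Real.exp_le_one_iff] at e2
    simp only [mem_ofPred_eq, Function.comp_apply]
    refine e1.trans ?_
    rw [Complex.norm_exp, Real.one_le_exp_iff]
    simpa using e2
  have hconst := Complex.eqOn_closedBall_of_isMaxOn_norm (hexp G hG) hmax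
  have hder : ∀ w ∈ Metric.ball (0 : ℂ) 1, deriv G w = 0 := by
    intro w hw
    have e1 : HasDerivAt G (deriv G w) w :=
      (hG.differentiableAt Metric.isOpen_ball hw).hasDerivAt
    have e2 : HasDerivAt (fun w => Complex.exp (G w)) 0 w := by
      refine (hasDerivAt_const w (Complex.exp (G 0))).congr_of_eventuallyEq ?_
      filter_upwards [Metric.isOpen_ball.mem_nhds hw] with z hz
      exact hconst (Metric.ball_subset_closedBall hz)
    have e3 := e1.cexp.unique e2
    simpa [Complex.exp_ne_zero] using e3
  have hc : EqOn G (fun _ => G 0) (Metric.ball 0 1) := fun w hw =>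
    Metric.isOpen_ball.is_const_of_deriv_eq_zero (convex_ball (0 : ℂ) 1).isPreconnected
      hG.differentiableOn hder hw (Metric.mem_ball_self one_pos)
  have := hc.of_subset_closure hG.continuousOn continuousOn_const subset_closure subset_rfl
  rwa [closure_ball _ one_ne_zero] at this

/-- A function on the circle extends holomorphically both to the disc and to its exterior only if
it is constant. -/
theorem eq_zero_of_add_conj_eq_zero {A B : ℂ → ℂ} (hA : DiffContOnCl ℂ A (Metric.ball 0 1))
    (hB : DiffContOnCl ℂ B (Metric.ball 0 1))
    (h : ∀ w : ℂ, ‖w‖ = 1 → A w + (starRingEnd ℂ) (B w) = 0) (h1 : A 1 = 0) :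
    ∀ w ∈ Metric.closedBall (0 : ℂ) 1, A w = 0 := by
  -- On the circle Re(A + B) = 0 and Im(A − B) = 0, so A + B and I(A − B) are both constant on the
  -- closed disc; A is half the sum of A + B and A − B.
  have e1 := (hA.add hB).eq_center_of_re_eq_zero (fun w hw => by
    have := congrArg Complex.re (h w hw)
    simpa using this)
  have e2 := ((hA.sub hB).const_smul I).eq_center_of_re_eq_zero (fun w hw => by
    have := congrArg Complex.im (h w hw)
    simp at this ⊢
    linarith)
  have hone : (1 : ℂ) ∈ Metric.closedBall (0 : ℂ) 1 := by simp
  intro w hw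
  have f1 := (e1 w hw).trans (e1 1 hone).symm
  have f2 := (e2 w hw).trans (e2 1 hone).symm
  simp only [Pi.add_apply, Pi.smul_apply, Pi.sub_apply, smul_eq_mul] at f1 f2
  have f3 := mul_left_cancel₀ Complex.I_ne_zero f2
  rw [← h1]
  linear_combination (f1 + f3) / 2

/-- The Cayley transform of the lower half-plane to the unit disc. -/
def cayley (z : ℂ) : ℂ := (z + I) / (z - I)

theorem sub_I_ne_zero {z : ℂ} (hz : z.im ≤ 0) : z - I ≠ 0 := fun h => by
  have := congrArg Complex.im h
  simp at this
  linarith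

theorem norm_cayley_le_one {z : ℂ} (hz : z.im ≤ 0) : ‖cayley z‖ ≤ 1 := by
  unfold cayley
  rw [norm_div, div_le_one (norm_pos_iff.2 (sub_I_ne_zero hz)), ← sq_le_sq₀ (norm_nonneg _)
    (norm_nonneg _), ← Complex.normSq_eq_norm_sq, ← Complex.normSq_eq_norm_sq,
    Complex.normSq_apply, Complex.normSq_apply]
  simp
  nlinarith

theorem norm_cayley_lt_one {z : ℂ} (hz : z.im < 0) : ‖cayley z‖ < 1 := by
  unfold cayley
  rw [norm_div, div_lt_one (norm_pos_iff.2 (sub_I_ne_zero hz.le)), ← sq_lt_sq₀ (norm_nonneg _)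
    (norm_nonneg _), ← Complex.normSq_eq_norm_sq, ← Complex.normSq_eq_norm_sq,
    Complex.normSq_apply, Complex.normSq_apply]
  simp
  nlinarith

theorem closure_lower : closure {z : ℂ | z.im < 0} = {z : ℂ | z.im ≤ 0} :=
  Complex.closure_setOfPred_im_lt 0

theorem isOpen_lower : IsOpen {z : ℂ | z.im < 0} := isOpen_lt Complex.continuous_im continuous_const

theorem DiffContOnCl.comp_cayley {A : ℂ → ℂ} (hA : DiffContOnCl ℂ A (Metric.ball 0 1)) :
    DiffContOnCl ℂ (fun z => A (cayley z)) {z : ℂ | z.im < 0} := by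
  have hc : DiffContOnCl ℂ cayley {z : ℂ | z.im < 0} := by
    constructor
    · intro z hz
      have := sub_I_ne_zero (le_of_lt hz : z.im ≤ 0)
      have h : DifferentiableAt ℂ (fun z : ℂ => (z + I) / (z - I)) z := by
        fun_prop (disch := assumption)
      exact h.differentiableWithinAt
    · rw [closure_lower]
      intro z hz
      have := sub_I_ne_zero hz
      have h : ContinuousAt (fun z : ℂ => (z + I) / (z - I)) z := by
        fun_prop (disch := assumption)
      exact h.continuousWithinAt
  exact hA.comp hc fun z hz => by simpa using norm_cayley_lt_one hz

/-- The coordinate on the circle of the real point `t`. -/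
def circleAngle (t : ℝ) : ℝ := Real.pi - 2 * Real.arctan t

/-- Links the angle to the disc coordinate: real t is the boundary point (t + i)/(t − i), and t → ±∞
tends to w = 1. -/
theorem exp_circleAngle (t : ℝ) : Complex.exp (circleAngle t * I) = cayley t := by
  set a := Real.arctan t with ha
  have hc : Real.cos a ≠ 0 := (Real.cos_arctan_pos t).ne'
  have ht : t = Real.sin a / Real.cos a := by rw [← Real.tan_eq_sin_div_cos, ha, Real.tan_arctan]
  have hcC : (Real.cos a : ℂ) ≠ 0 := by exact_mod_cast hc
  have h0 : (t : ℂ) - I ≠ 0 := sub_I_ne_zero (by simp)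
  unfold cayley circleAngle
  rw [eq_div_iff h0, show ((Real.pi - 2 * Real.arctan t : ℝ) : ℂ) * I =
    Real.pi * I + ((a : ℂ) * (-I) + (a : ℂ) * (-I)) by rw [← ha]; push_cast; ring,
    Complex.exp_add, Complex.exp_add, Complex.exp_pi_mul_I,
    show (a : ℂ) * -I = -(a : ℂ) * I by ring, Complex.exp_mul_I, Complex.cos_neg, Complex.sin_neg]
  rw [ht]
  push_cast at hcC ⊢
  have hsq := Complex.sin_sq_add_cos_sq (a : ℂ)
  field_simp
  linear_combination (Complex.sin a + I * Complex.cos a) * hsq +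
    (Complex.cos a * Complex.sin a ^ 2 * I -
      2 * Complex.cos a ^ 2 * Complex.sin a - Complex.sin a ^ 3) * Complex.I_sq

theorem sin_half_circleAngle (t : ℝ) : Real.sin (circleAngle t / 2) = Real.cos (Real.arctan t) := by
  rw [circleAngle, show (Real.pi - 2 * Real.arctan t) / 2 = Real.pi / 2 - Real.arctan t by ring,
    Real.sin_pi_div_two_sub]

theorem cos_half_circleAngle (t : ℝ) : Real.cos (circleAngle t / 2) = Real.sin (Real.arctan t) := by
  rw [circleAngle, show (Real.pi - 2 * Real.arctan t) / 2 = Real.pi / 2 - Real.arctan t by ring,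
    Real.cos_pi_div_two_sub]

theorem circleSymbol_circleAngle {M m : ℕ} (q : Eu M → Eu m → ℝ → ℂ) (x : Eu M) (η : Eu m)
    (t : ℝ) : circleSymbol q (x, η, circleAngle t) = q x η t := by
  simp only [circleSymbol, sin_half_circleAngle, cos_half_circleAngle,
    (Real.cos_arctan_pos t).ne', if_false]
  rw [← Real.tan_eq_sin_div_cos, Real.tan_arctan]

theorem contDiff_circleAngle : ContDiff ℝ ∞ circleAngle :=
  contDiff_const.sub (contDiff_const.mul Real.contDiff_arctan)

/-- The inverse of the Cayley transform. -/
theorem exists_real_cayley_eq {w : ℂ} (hw : ‖w‖ = 1) (h1 : w ≠ 1) : ∃ t : ℝ, cayley t = w := by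
  have h0 : w - 1 ≠ 0 := sub_ne_zero.2 h1
  set z : ℂ := I * (w + 1) / (w - 1) with hz
  have hwc : (starRingEnd ℂ) w * w = 1 := by
    rw [mul_comm, Complex.mul_conj, Complex.normSq_eq_norm_sq, hw]; simp
  have hw0 : w ≠ 0 := by rintro rfl; simp at hw
  have hci : (starRingEnd ℂ) w = w⁻¹ := eq_inv_of_mul_eq_one_left hwc
  have hre : (starRingEnd ℂ) z = z := by
    rw [hz]
    simp only [map_div₀, map_mul, map_add, map_sub, map_one, Complex.conj_I, hci]
    have h2 : w⁻¹ - 1 ≠ 0 := by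
      rw [sub_ne_zero]
      intro h
      exact h1 (by rw [← inv_inv w, h, inv_one])
    rw [div_eq_div_iff h2 h0]
    field_simp
    ring
  obtain ⟨t, ht⟩ := Complex.conj_eq_iff_real.1 hre
  refine ⟨t, ?_⟩
  rw [← ht]
  unfold cayley
  have h3 : z - I ≠ 0 := by rw [ht]; exact sub_I_ne_zero (by simp)
  rw [div_eq_iff h3, hz]
  field_simp
  ring

/-- The action of the dilation `z ↦ s z` in the disc coordinate. -/
def discDilation (s : ℝ) (w : ℂ) : ℂ := ((s + 1) * w + (s - 1)) / ((s - 1) * w + (s + 1))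

theorem discDilation_denom_ne_zero {s : ℝ} (hs : 0 < s) {w : ℂ} (hw : ‖w‖ ≤ 1) :
    ((s : ℂ) - 1) * w + (s + 1) ≠ 0 := by
  intro h
  have h1 : ((s : ℂ) - 1) * w = -(s + 1) := eq_neg_of_add_eq_zero_left h
  have h2 := congrArg norm h1
  rw [norm_mul, norm_neg, show (s : ℂ) - 1 = ((s - 1 : ℝ) : ℂ) by push_cast; rfl,
    show (s : ℂ) + 1 = ((s + 1 : ℝ) : ℂ) by push_cast; rfl, Complex.norm_real, Complex.norm_real,
    Real.norm_eq_abs, Real.norm_eq_abs, abs_of_pos (by linarith : 0 < s + 1)] at h2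
  have h3 : |s - 1| < s + 1 := abs_lt.2 ⟨by linarith, by linarith⟩
  nlinarith [abs_nonneg (s - 1), norm_nonneg w]

theorem norm_discDilation_lt {s : ℝ} (hs : 0 < s) {w : ℂ} (hw : ‖w‖ < 1) :
    ‖discDilation s w‖ < 1 := by
  unfold discDilation
  rw [norm_div, div_lt_one (norm_pos_iff.2 (discDilation_denom_ne_zero hs hw.le)),
    ← sq_lt_sq₀ (norm_nonneg _) (norm_nonneg _), ← Complex.normSq_eq_norm_sq,
    ← Complex.normSq_eq_norm_sq, Complex.normSq_apply, Complex.normSq_apply]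
  have h1 : w.re * w.re + w.im * w.im < 1 := by
    rw [← Complex.normSq_apply, Complex.normSq_eq_norm_sq]
    exact pow_lt_one₀ (norm_nonneg _) hw (by norm_num)
  simp
  nlinarith

theorem DiffContOnCl.comp_discDilation {A : ℂ → ℂ} (hA : DiffContOnCl ℂ A (Metric.ball 0 1))
    {s : ℝ} (hs : 0 < s) : DiffContOnCl ℂ (fun w => A (discDilation s w)) (Metric.ball 0 1) := by
  have hc : DiffContOnCl ℂ (discDilation s) (Metric.ball 0 1) := by
    constructor
    · intro w hw
      have := discDilation_denom_ne_zero hs (mem_ball_zero_iff.1 hw).le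
      have h : DifferentiableAt ℂ
          (fun w : ℂ => ((s + 1) * w + (s - 1)) / ((s - 1) * w + (s + 1))) w := by
        fun_prop (disch := assumption)
      exact h.differentiableWithinAt
    · rw [closure_ball _ one_ne_zero]
      intro w hw
      have := discDilation_denom_ne_zero hs (mem_closedBall_zero_iff.1 hw)
      have h : ContinuousAt
          (fun w : ℂ => ((s + 1) * w + (s - 1)) / ((s - 1) * w + (s + 1))) w := by
        fun_prop (disch := assumption)
      exact h.continuousWithinAt
  exact hA.comp hc fun w hw => by
    simpa using norm_discDilation_lt hs (mem_ball_zero_iff.1 hw)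

theorem discDilation_one {s : ℝ} (hs : 0 < s) : discDilation s 1 = 1 := by
  unfold discDilation
  rw [div_eq_one_iff_eq (discDilation_denom_ne_zero hs (by simp))]
  ring

theorem discDilation_cayley {s : ℝ} (hs : 0 < s) (t : ℝ) :
    discDilation s (cayley t) = cayley ((s * t : ℝ) : ℂ) := by
  have h1 : (t : ℂ) - I ≠ 0 := sub_I_ne_zero (by simp)
  have h2 : ((s * t : ℝ) : ℂ) - I ≠ 0 := sub_I_ne_zero (by simp)
  have h3 := discDilation_denom_ne_zero hs (norm_cayley_le_one (z := t) (by simp))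
  unfold discDilation
  rw [div_eq_iff h3]
  unfold cayley at h3 ⊢
  push_cast at h2 ⊢
  field_simp
  ring

/-- Functions on the line that are transported by dilations have transported holomorphic parts. -/
theorem hardyPart_dilation {A B A' B' : ℂ → ℂ} (hA : DiffContOnCl ℂ A (Metric.ball 0 1))
    (hB : DiffContOnCl ℂ B (Metric.ball 0 1)) (hA' : DiffContOnCl ℂ A' (Metric.ball 0 1))
    (hB' : DiffContOnCl ℂ B' (Metric.ball 0 1)) (hA1 : A 1 = 0) (hB1 : B 1 = 0) (hA'1 : A' 1 = 0)
    (hB'1 : B' 1 = 0) {s : ℝ} (hs : 0 < s)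
    (h : ∀ t : ℝ, A' (cayley ((s * t : ℝ) : ℂ)) + (starRingEnd ℂ) (B' (cayley ((s * t : ℝ) : ℂ))) =
      A (cayley t) + (starRingEnd ℂ) (B (cayley t))) (t : ℝ) :
    A' (cayley ((s * t : ℝ) : ℂ)) = A (cayley t) := by
  -- Uniqueness for the pair A' ∘ D − A, B' ∘ D − B, where D is the dilation of the disc. Every
  -- boundary point except 1 comes from a real t, and at 1, which D fixes, all terms vanish.
  have key := eq_zero_of_add_conj_eq_zero ((hA'.comp_discDilation hs).sub hA)
    ((hB'.comp_discDilation hs).sub hB) (fun w hw => ?_) (by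
      simp [discDilation_one hs, hA1, hA'1]) (cayley t) (by
      simpa using norm_cayley_le_one (z := t) (by simp))
  · simp only [Pi.sub_apply, discDilation_cayley hs] at key
    exact sub_eq_zero.1 key
  · by_cases h1 : w = 1
    · subst h1
      simp [discDilation_one hs, hA1, hA'1, hB1, hB'1]
    · obtain ⟨t, rfl⟩ := exists_real_cayley_eq hw h1
      have := h t
      simp only [Pi.sub_apply, discDilation_cayley hs, map_sub]
      linear_combination this

end Uniqueness

/-! ### One-sided Fourier transforms on the lower half-plane. -/

noncomputable section Laplace

open Complex (I)
open MeasureTheory FourierTransform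

/-- The one-sided Fourier transform, on the closed lower half-plane. -/
def lowerLaplace (φ : SchwartzMap ℝ ℂ) (z : ℂ) : ℂ :=
  ∫ x in Ioi (0 : ℝ), Complex.exp (-I * x * z) * φ x

theorem norm_exp_neg_I_mul_le {x : ℝ} (hx : 0 ≤ x) {z : ℂ} (hz : z.im ≤ 0) :
    ‖Complex.exp (-I * x * z)‖ ≤ 1 := by
  rw [Complex.norm_exp, Real.exp_le_one_iff]
  simp
  nlinarith

theorem integrableOn_lowerLaplace (φ : SchwartzMap ℝ ℂ) {z : ℂ} (hz : z.im ≤ 0) :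
    IntegrableOn (fun x : ℝ => Complex.exp (-I * x * z) * φ x) (Ioi 0) := by
  have h1 : IntegrableOn φ (Ioi 0) := φ.integrable.integrableOn
  refine Integrable.mono h1 ((by fun_prop : Continuous fun x : ℝ => Complex.exp (-I * x * z)).mul
    φ.continuous).aestronglyMeasurable ?_
  refine (ae_restrict_iff' measurableSet_Ioi).2 (Eventually.of_forall fun x hx => ?_)
  rw [norm_mul]
  exact mul_le_of_le_one_left (norm_nonneg _) (norm_exp_neg_I_mul_le (le_of_lt hx) hz)

theorem norm_lowerLaplace_le (φ : SchwartzMap ℝ ℂ) {z : ℂ} (hz : z.im ≤ 0) :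
    ‖lowerLaplace φ z‖ ≤ ∫ x in Ioi (0 : ℝ), ‖φ x‖ := by
  refine norm_integral_le_of_norm_le φ.integrable.norm.integrableOn ?_
  refine (ae_restrict_iff' measurableSet_Ioi).2 (Eventually.of_forall fun x hx => ?_)
  rw [norm_mul]
  exact mul_le_of_le_one_left (norm_nonneg _) (norm_exp_neg_I_mul_le (le_of_lt hx) hz)

theorem diffContOnCl_lowerLaplace (φ : SchwartzMap ℝ ℂ) :
    DiffContOnCl ℂ (lowerLaplace φ) {z : ℂ | z.im < 0} := by
  constructor
  · intro z hz
    have hintegrable : IntegrableOn (fun x : ℝ => ‖x‖ * ‖φ x‖) (Ioi 0) := by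
      simpa using (φ.integrable_pow_mul volume 1).integrableOn
    have := (hasDerivAt_integral_of_dominated_loc_of_deriv_le
      (μ := volume.restrict (Ioi (0 : ℝ))) (bound := fun x => ‖x‖ * ‖φ x‖)
      (F := fun (z : ℂ) (x : ℝ) => Complex.exp (-I * x * z) * φ x)
      (F' := fun (z : ℂ) (x : ℝ) => Complex.exp (-I * x * z) * (-I * x) * φ x)
      (isOpen_lower.mem_nhds hz) ?_ (integrableOn_lowerLaplace φ (le_of_lt hz)) ?_ ?_ hintegrable ?_).2
    · exact this.differentiableAt.differentiableWithinAt
    · exact Eventually.of_forall fun w => ((by fun_prop :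
        Continuous fun x : ℝ => Complex.exp (-I * x * w)).mul φ.continuous).aestronglyMeasurable
    · exact ((by fun_prop : Continuous fun x : ℝ => Complex.exp (-I * x * z) * (-I * x)).mul
        φ.continuous).aestronglyMeasurable
    · refine (ae_restrict_iff' measurableSet_Ioi).2 (Eventually.of_forall fun x hx w hw => ?_)
      rw [norm_mul, norm_mul]
      gcongr
      refine (mul_le_of_le_one_left (norm_nonneg _)
        (norm_exp_neg_I_mul_le (le_of_lt hx) (le_of_lt hw))).trans ?_
      simp
    · refine Eventually.of_forall fun x w _ => ?_
      have h1 : HasDerivAt (fun w : ℂ => -I * x * w) (-I * x) w := by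
        simpa using (hasDerivAt_id w).const_mul (-I * x)
      exact h1.cexp.mul_const (φ x)
  · rw [closure_lower]
    intro z hz
    refine continuousWithinAt_of_dominated (bound := fun x => ‖φ x‖) ?_ ?_
      φ.integrable.norm.integrableOn ?_
    · exact Eventually.of_forall fun w => ((by fun_prop :
        Continuous fun x : ℝ => Complex.exp (-I * x * w)).mul φ.continuous).aestronglyMeasurable
    · filter_upwards [self_mem_nhdsWithin] with w hw
      refine (ae_restrict_iff' measurableSet_Ioi).2 (Eventually.of_forall fun x hx => ?_)
      rw [norm_mul]
      exact mul_le_of_le_one_left (norm_nonneg _) (norm_exp_neg_I_mul_le (le_of_lt hx) hw)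
    · exact Eventually.of_forall fun x => by fun_prop

/-- Integration by parts; the boundary term at 0 is the source both of the 1/z decay and of the
whole expansion at infinity. -/
theorem lowerLaplace_derivCLM (φ : SchwartzMap ℝ ℂ) {z : ℂ} (hz : z.im ≤ 0) :
    lowerLaplace (SchwartzMap.derivCLM ℂ ℂ φ) z = I * z * lowerLaplace φ z - φ 0 := by
  have hd : ∀ x : ℝ, HasDerivAt (fun x : ℝ => Complex.exp (-I * x * z) * φ x)
      (Complex.exp (-I * x * z) * (SchwartzMap.derivCLM ℂ ℂ φ) x -
        I * z * (Complex.exp (-I * x * z) * φ x)) x := by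
    intro x
    have h1 : HasDerivAt (fun x : ℝ => -I * (x : ℂ) * z) (-I * z) x := by
      have := ((Complex.ofRealCLM.hasDerivAt (x := x)).const_mul (-I)).mul_const z
      simpa using this
    have h2 : HasDerivAt φ (deriv φ x) x := φ.differentiableAt.hasDerivAt
    refine (h1.cexp.mul h2).congr_deriv ?_
    rw [SchwartzMap.derivCLM_apply]
    ring
  have hi1 := integrableOn_lowerLaplace (SchwartzMap.derivCLM ℂ ℂ φ) hz
  have hi2 := (integrableOn_lowerLaplace φ hz).const_mul (I * z)
  have hlim : Tendsto (fun x : ℝ => Complex.exp (-I * x * z) * φ x) atTop (𝓝 0) := by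
    have h0 : Tendsto φ atTop (𝓝 0) := φ.tendsto_cocompact.mono_left atTop_le_cocompact
    refine squeeze_zero_norm' ?_ (tendsto_zero_iff_norm_tendsto_zero.1 h0)
    filter_upwards [eventually_ge_atTop 0] with x hx
    rw [norm_mul]
    exact mul_le_of_le_one_left (norm_nonneg _) (norm_exp_neg_I_mul_le hx hz)
  have := integral_Ioi_of_hasDerivAt_of_tendsto (a := (0 : ℝ)) (hd 0).continuousAt.continuousWithinAt
    (fun x _ => hd x) (hi1.sub hi2) hlim
  rw [integral_sub hi1 hi2, integral_const_mul] at this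
  simp only [Complex.ofReal_zero, mul_zero, zero_mul, Complex.exp_zero, one_mul, zero_sub] at this
  unfold lowerLaplace
  linear_combination this

theorem exists_norm_mul_lowerLaplace_le (φ : SchwartzMap ℝ ℂ) :
    ∃ C : ℝ, ∀ z : ℂ, z.im ≤ 0 → ‖z‖ * ‖lowerLaplace φ z‖ ≤ C := by
  refine ⟨(∫ x in Ioi (0 : ℝ), ‖SchwartzMap.derivCLM ℂ ℂ φ x‖) + ‖φ 0‖, fun z hz => ?_⟩
  have h1 : I * (z * lowerLaplace φ z) = lowerLaplace (SchwartzMap.derivCLM ℂ ℂ φ) z + φ 0 := by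
    rw [lowerLaplace_derivCLM φ hz]; ring
  have h2 := congrArg norm h1
  rw [norm_mul, Complex.norm_I, one_mul, norm_mul] at h2
  rw [h2]
  exact (norm_add_le _ _).trans (by gcongr; exact norm_lowerLaplace_le _ hz)

/-- The one-sided transform in the disc coordinate. -/
def discLaplace (φ : SchwartzMap ℝ ℂ) (w : ℂ) : ℂ :=
  if w = 1 then 0 else lowerLaplace φ (I * (w + 1) / (w - 1))

theorem invCayley_im {w : ℂ} (hw : w ≠ 1) :
    (I * (w + 1) / (w - 1)).im = (‖w‖ ^ 2 - 1) / ‖w - 1‖ ^ 2 := by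
  have h0 : w - 1 ≠ 0 := sub_ne_zero.2 hw
  rw [Complex.div_im, ← Complex.normSq_eq_norm_sq, ← Complex.normSq_eq_norm_sq]
  have h1 : Complex.normSq (w - 1) ≠ 0 := by simpa using h0
  rw [← sub_div, Complex.normSq_apply w]
  congr 1
  simp
  ring

theorem invCayley_cayley (t : ℝ) : I * (cayley t + 1) / (cayley t - 1) = t := by
  have h1 : (t : ℂ) - I ≠ 0 := sub_I_ne_zero (by simp)
  have h2 : cayley t - 1 = 2 * I / (t - I) := by
    unfold cayley; field_simp; ring
  have h3 : cayley t + 1 = 2 * t / (t - I) := by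
    unfold cayley; field_simp; ring
  have hI := Complex.I_ne_zero
  rw [h2, h3]
  field_simp

theorem cayley_ne_one (t : ℝ) : cayley t ≠ 1 := by
  intro h
  have h1 : (t : ℂ) - I ≠ 0 := sub_I_ne_zero (by simp)
  unfold cayley at h
  rw [div_eq_one_iff_eq h1] at h
  have := congrArg Complex.im h
  simp at this
  linarith

theorem discLaplace_cayley (φ : SchwartzMap ℝ ℂ) (t : ℝ) :
    discLaplace φ (cayley t) = lowerLaplace φ t := by
  rw [discLaplace, if_neg (cayley_ne_one t), invCayley_cayley]

/-- Away from w = 1 this is a composition. At w = 1 the decay |z| |lowerLaplace φ z| ≤ C becomes a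
bound C|w − 1|, because |w + 1| > 1 nearby, so the value 0 there makes the function continuous. -/
theorem diffContOnCl_discLaplace (φ : SchwartzMap ℝ ℂ) :
    DiffContOnCl ℂ (discLaplace φ) (Metric.ball 0 1) := by
  have hl := diffContOnCl_lowerLaplace φ
  have hev : ∀ w : ℂ, w ≠ 1 →
      discLaplace φ =ᶠ[𝓝 w] fun w => lowerLaplace φ (I * (w + 1) / (w - 1)) := fun w hw => by
    filter_upwards [isOpen_ne.mem_nhds hw] with z hz
    exact if_neg hz
  constructor
  · intro w hw
    rw [mem_ball_zero_iff] at hw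
    have hw1 : w ≠ 1 := by rintro rfl; simp at hw
    have h0 : w - 1 ≠ 0 := sub_ne_zero.2 hw1
    have him : (I * (w + 1) / (w - 1)).im < 0 := by
      rw [invCayley_im hw1]
      have : 0 < ‖w - 1‖ := norm_pos_iff.2 h0
      refine div_neg_of_neg_of_pos ?_ (by positivity)
      nlinarith [norm_nonneg w]
    have h1 : DifferentiableAt ℂ (fun w : ℂ => I * (w + 1) / (w - 1)) w := by
      fun_prop (disch := assumption)
    have h2 : DifferentiableAt ℂ (lowerLaplace φ) (I * (w + 1) / (w - 1)) :=
      hl.differentiableAt isOpen_lower him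
    have h3 : DifferentiableAt ℂ (fun w => lowerLaplace φ (I * (w + 1) / (w - 1))) w :=
      DifferentiableAt.comp (g := lowerLaplace φ) w h2 h1
    exact ((hev w hw1).differentiableAt_iff.2 h3).differentiableWithinAt
  · rw [closure_ball _ one_ne_zero]
    have hcl := hl.continuousOn
    rw [closure_lower] at hcl
    have him : ∀ w ∈ Metric.closedBall (0 : ℂ) 1, w ≠ 1 → (I * (w + 1) / (w - 1)).im ≤ 0 := by
      intro w hw hw1
      rw [mem_closedBall_zero_iff] at hw
      rw [invCayley_im hw1]
      refine div_nonpos_of_nonpos_of_nonneg ?_ (by positivity)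
      nlinarith [norm_nonneg w]
    intro w hw
    by_cases hw1 : w = 1
    · subst hw1
      obtain ⟨C, hC⟩ := exists_norm_mul_lowerLaplace_le φ
      have hC0 : 0 ≤ C := (by positivity : (0 : ℝ) ≤ _).trans (hC 0 (by simp))
      have hb : ∀ᶠ w in 𝓝[Metric.closedBall (0 : ℂ) 1] 1, ‖discLaplace φ w‖ ≤ C * ‖w - 1‖ := by
        have h1 : ∀ᶠ w in 𝓝 (1 : ℂ), 1 < ‖w + 1‖ := by
          have : ContinuousAt (fun w : ℂ => ‖w + 1‖) 1 := by fun_prop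
          refine this.eventually_const_lt ?_
          norm_num
        filter_upwards [self_mem_nhdsWithin, mem_nhdsWithin_of_mem_nhds h1] with w hw hw2
        unfold discLaplace
        split_ifs with hw1
        · simp; positivity
        · have h0 : 0 < ‖w - 1‖ := norm_pos_iff.2 (sub_ne_zero.2 hw1)
          have := hC _ (him w hw hw1)
          rw [norm_div, norm_mul, Complex.norm_I, one_mul, div_mul_eq_mul_div,
            div_le_iff₀ h0] at this
          refine le_trans ?_ this
          exact le_mul_of_one_le_left (norm_nonneg _) hw2.le
      have hz : discLaplace φ 1 = 0 := if_pos rfl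
      rw [ContinuousWithinAt, hz]
      refine squeeze_zero_norm' hb ?_
      have : ContinuousAt (fun w : ℂ => C * ‖w - 1‖) 1 := by fun_prop
      have h2 := this.tendsto
      simp only [sub_self, norm_zero, mul_zero] at h2
      exact h2.mono_left nhdsWithin_le_nhds
    · have h0 : w - 1 ≠ 0 := sub_ne_zero.2 hw1
      have h1 : ContinuousAt (fun w : ℂ => I * (w + 1) / (w - 1)) w := by
        fun_prop (disch := assumption)
      have h2 : ContinuousWithinAt (fun w => lowerLaplace φ (I * (w + 1) / (w - 1)))
          (Metric.closedBall (0 : ℂ) 1 ∩ {1}ᶜ) w :=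
        ContinuousWithinAt.comp (g := lowerLaplace φ) (f := fun w : ℂ => I * (w + 1) / (w - 1))
          (hcl _ (him w hw hw1)) h1.continuousWithinAt fun z hz => him z hz.1 hz.2
      have h3 := h2.congr_of_eventuallyEq (mem_nhdsWithin_of_mem_nhds (hev w hw1))
        ((hev w hw1).eq_of_nhds)
      exact (continuousWithinAt_inter (isOpen_compl_singleton.mem_nhds hw1)).1 h3

theorem lowerLaplace_eq_fourier (φ : SchwartzMap ℝ ℂ) (t : ℝ) :
    lowerLaplace φ t = 𝓕 ((Ioi (0 : ℝ)).indicator φ) (t / (2 * Real.pi)) := by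
  rw [Real.fourier_real_eq_integral_exp_smul, lowerLaplace, ← integral_indicator measurableSet_Ioi]
  congr 1
  ext x
  by_cases hx : x ∈ Ioi (0 : ℝ)
  · rw [indicator_of_mem hx, indicator_of_mem hx, smul_eq_mul]
    congr 2
    have : (Real.pi : ℂ) ≠ 0 := by exact_mod_cast Real.pi_ne_zero
    push_cast
    field_simp
  · rw [indicator_of_notMem hx, indicator_of_notMem hx, smul_zero]

/-- Up to the 2π in the normalisation this is the Fourier transform of φ cut off to the half-line.
The cut-off times any power of x is integrable, so every derivative exists and is bounded. -/
theorem lowerLaplace_contDiff_and_bounded (φ : SchwartzMap ℝ ℂ) :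
    ContDiff ℝ ∞ (fun t : ℝ => lowerLaplace φ t) ∧
      ∀ n : ℕ, ∃ C : ℝ, ∀ t : ℝ, ‖iteratedDeriv n (fun t : ℝ => lowerLaplace φ t) t‖ ≤ C := by
  set f : ℝ → ℂ := (Ioi (0 : ℝ)).indicator φ with hf
  have hfi : ∀ n : ℕ, Integrable (fun x : ℝ => x ^ n • f x) := fun n => by
    have h1 := (φ.integrable_pow_mul volume n).indicator (measurableSet_Ioi (a := (0 : ℝ)))
    refine h1.mono ?_ (Eventually.of_forall fun x => ?_)
    · exact ((by fun_prop : Continuous fun x : ℝ => x ^ n).aestronglyMeasurable.smul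
        (φ.continuous.aestronglyMeasurable.indicator measurableSet_Ioi))
    · by_cases hx : x ∈ Ioi (0 : ℝ) <;> simp [hf, hx]
  have hcd : ContDiff ℝ ∞ (𝓕 f) := Real.contDiff_fourier (N := ⊤) fun n _ => by
    simpa [norm_smul] using (hfi n).norm
  have heq : (fun t : ℝ => lowerLaplace φ t) = fun t => 𝓕 f ((2 * Real.pi)⁻¹ * t) := by
    ext t
    rw [lowerLaplace_eq_fourier, div_eq_inv_mul]
  rw [heq]
  refine ⟨hcd.comp (contDiff_const.mul contDiff_id), fun n => ?_⟩
  refine ⟨|(2 * Real.pi)⁻¹ ^ n| * ∫ x : ℝ, ‖(-2 * Real.pi * I * (x : ℂ)) ^ n • f x‖, fun t => ?_⟩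
  have hit := congrFun (iteratedDeriv_comp_const_smul (f := 𝓕 f) (n := n)
    (hcd.of_le (by exact_mod_cast le_top)) (2 * Real.pi)⁻¹) t
  rw [hit, norm_smul, Real.norm_eq_abs, Real.iteratedDeriv_fourier (N := ⊤) (fun n _ => hfi n)
    (by exact_mod_cast le_top)]
  gcongr
  exact VectorFourier.norm_fourierIntegral_le_integral_norm _ _ _ _ _

end Laplace

/-! ### Borel's lemma and a criterion for Schwartz functions. -/

noncomputable section OneSidedTransform

open Complex (I)
open MeasureTheory FourierTransform

/-- **Borel's lemma**: every sequence is the sequence of derivatives at `0` of a compactly supported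
smooth function. -/
theorem exists_contDiff_iteratedDeriv_eq (c : ℕ → ℂ) :
    ∃ b : ℝ → ℂ, ContDiff ℝ ∞ b ∧ HasCompactSupport b ∧ ∀ n, iteratedDeriv n b 0 = c n := by
  let χ : ContDiffBump (0 : ℝ) := ⟨1, 2, one_pos, by norm_num⟩
  let h : ℕ → ℝ → ℝ := fun n s => s ^ n * χ s
  have hh : ∀ n, ContDiff ℝ ∞ (h n) := fun n => (contDiff_id.pow n).mul χ.contDiff
  have hsupp : ∀ n, HasCompactSupport (h n) := fun n => χ.hasCompactSupport.mul_left
  have hbd : ∀ n k, ∃ C, ∀ x, ‖iteratedDeriv k (h n) x‖ ≤ C := fun n k => by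
    obtain ⟨C, hC⟩ := ((hsupp n).iteratedFDeriv (𝕜 := ℝ) k).exists_bound_of_continuous
      ((hh n).continuous_iteratedFDeriv (m := k) (by exact_mod_cast le_top))
    exact ⟨C, fun x => by rw [← norm_iteratedFDeriv_eq_norm_iteratedDeriv]; exact hC x⟩
  choose B hB using hbd
  have hB0 : ∀ n k, 0 ≤ B n k := fun n k => (norm_nonneg _).trans (hB n k 0)
  have hzero : ∀ n k, iteratedDeriv k (h n) 0 = if k = n then (n.factorial : ℝ) else 0 := by
    intro n k
    have e : h n =ᶠ[𝓝 0] fun s => s ^ n := by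
      filter_upwards [χ.eventuallyEq_one] with s hs
      simp [h, hs]
    rw [e.iteratedDeriv_eq, iteratedDeriv_fun_pow_zero]
    split_ifs <;> simp
  -- The n-th term is compressed by `L n` and divided by `L n ^ n`, so for k < n its k-th derivative
  -- is at most B n k ‖c n‖ / L n, and `L n` is large enough to make this ≤ 2^{−n}. The terms n ≤ k
  -- are finitely many and keep their own bound in `v`.
  let L : ℕ → ℝ := fun n => 1 + 2 ^ n * ‖c n‖ * ∑ k ∈ Finset.range n, B n k
  have hL1 : ∀ n, 1 ≤ L n := fun n => by
    have : 0 ≤ 2 ^ n * ‖c n‖ * ∑ k ∈ Finset.range n, B n k :=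
      mul_nonneg (by positivity) (Finset.sum_nonneg fun k _ => hB0 n k)
    simp only [L]; linarith
  have hL0 : ∀ n, 0 < L n := fun n => one_pos.trans_le (hL1 n)
  let a : ℕ → ℂ := fun n => (((n.factorial : ℝ) * L n ^ n)⁻¹ : ℝ) • c n
  let T : ℕ → ℝ → ℂ := fun n s => h n (L n * s) • a n
  have hhL : ∀ n, ContDiff ℝ ∞ fun s => h n (L n * s) := fun n =>
    (hh n).comp (contDiff_const.mul contDiff_id)
  have hT : ∀ n, ContDiff ℝ ∞ (T n) := fun n => (hhL n).smul contDiff_const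
  have hTd : ∀ n k s, iteratedDeriv k (T n) s = (L n ^ k * iteratedDeriv k (h n) (L n * s)) • a n := by
    intro n k s
    have h1 := iteratedDeriv_smul_const (x := s) (n := k)
      (((hhL n).of_le (by exact_mod_cast le_top)).contDiffAt) (a n)
    have h2 := congrFun (iteratedDeriv_comp_const_smul (n := k)
      ((hh n).of_le (by exact_mod_cast le_top)) (L n)) s
    rw [h2] at h1
    exact h1
  have hfac : ∀ n : ℕ, (1 : ℝ) ≤ n.factorial := fun n => by exact_mod_cast n.factorial_pos
  have ha : ∀ n, ‖a n‖ ≤ ‖c n‖ / L n ^ n := fun n => by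
    have := hL0 n
    simp only [a]
    rw [norm_smul, Real.norm_of_nonneg (by positivity), inv_mul_eq_div]
    refine div_le_div_of_nonneg_left (norm_nonneg _) (by positivity) ?_
    exact le_mul_of_one_le_left (by positivity) (hfac n)
  let v : ℕ → ℕ → ℝ := fun k n =>
    (1 / 2 : ℝ) ^ n + if n ∈ Finset.range (k + 1) then L n ^ k * B n k * ‖a n‖ else 0
  have hv : ∀ k, Summable (v k) := fun k =>
    (summable_geometric_of_lt_one (by norm_num) (by norm_num)).add
      (summable_of_ne_finset_zero (s := Finset.range (k + 1)) fun n hn => if_neg hn)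
  have hTv : ∀ k n s, ‖iteratedFDeriv ℝ k (T n) s‖ ≤ v k n := by
    intro k n s
    rw [norm_iteratedFDeriv_eq_norm_iteratedDeriv, hTd, norm_smul, norm_mul, norm_pow,
      Real.norm_of_nonneg (hL0 n).le]
    have h1 : L n ^ k * ‖iteratedDeriv k (h n) (L n * s)‖ * ‖a n‖ ≤ L n ^ k * B n k * ‖a n‖ := by
      have := hL0 n
      gcongr
      exact hB n k _
    refine h1.trans ?_
    simp only [v]
    split_ifs with hn
    · exact le_add_of_nonneg_left (by positivity)
    · rw [Finset.mem_range, not_lt] at hn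
      have hL := hL0 n
      have h2 : L n ^ k * B n k * ‖a n‖ ≤ L n ^ k * B n k * (‖c n‖ / L n ^ n) := by
        have := hB0 n k
        gcongr
        exact ha n
      refine h2.trans ?_
      rw [add_zero, mul_div_assoc', div_le_iff₀ (by positivity), one_div, inv_pow,
        inv_mul_eq_div, le_div_iff₀ (by positivity)]
      have h3 : B n k ≤ ∑ k ∈ Finset.range n, B n k :=
        Finset.single_le_sum (f := fun k => B n k) (fun k _ => hB0 n k) (Finset.mem_range.2 hn)
      have h4 : 2 ^ n * ‖c n‖ * B n k ≤ L n := by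
        have : 2 ^ n * ‖c n‖ * B n k ≤ 2 ^ n * ‖c n‖ * ∑ k ∈ Finset.range n, B n k := by gcongr
        simp only [L]; linarith
      calc L n ^ k * B n k * ‖c n‖ * 2 ^ n = L n ^ k * (2 ^ n * ‖c n‖ * B n k) := by ring
        _ ≤ L n ^ k * L n := by gcongr
        _ = L n ^ (k + 1) := (pow_succ _ _).symm
        _ ≤ L n ^ n := pow_le_pow_right₀ (hL1 n) hn
  have hTz : ∀ n s, s ∉ Metric.closedBall (0 : ℝ) 2 → T n s = 0 := by
    intro n s hs
    rw [mem_closedBall_zero_iff, not_le] at hs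
    have : χ (L n * s) = 0 := by
      refine χ.zero_of_le_dist ?_
      rw [dist_zero_right, norm_mul, Real.norm_of_nonneg (hL0 n).le]
      exact hs.le.trans (le_mul_of_one_le_left (norm_nonneg _) (hL1 n))
    simp [T, h, this]
  refine ⟨fun s => ∑' n, T n s, contDiff_tsum (N := ⊤) hT (fun k _ => hv k) (fun k n s _ => hTv k n s),
    HasCompactSupport.intro (isCompact_closedBall (0 : ℝ) 2) fun s hs => ?_, fun k => ?_⟩
  · simp [hTz _ s hs]
  · rw [iteratedDeriv_eq_iteratedFDeriv, iteratedFDeriv_tsum_apply (N := ⊤) hT (fun k _ => hv k)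
      (fun k n s _ => hTv k n s) (by exact_mod_cast le_top)]
    have hsum : Summable fun n => iteratedFDeriv ℝ k (T n) 0 :=
      Summable.of_norm_bounded (hv k) fun n => hTv k n 0
    have happ := (ContinuousMultilinearMap.apply ℝ (fun _ : Fin k => ℝ) ℂ (fun _ => 1)).map_tsum hsum
    simp only [ContinuousMultilinearMap.apply_apply] at happ
    rw [happ, tsum_eq_single k]
    · rw [← iteratedDeriv_eq_iteratedFDeriv, hTd, mul_zero, hzero, if_pos rfl]
      have := hL0 k
      have h5 : (k.factorial : ℝ) ≠ 0 := by positivity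
      simp only [a]
      rw [smul_smul]
      convert one_smul ℝ (c k) using 2
      field_simp
    · intro n hn
      rw [← iteratedDeriv_eq_iteratedFDeriv, hTd, mul_zero, hzero, if_neg (Ne.symm hn)]
      simp

/-- If `h` is rapidly decreasing and `h'`, `h''` are bounded, then `h'` is rapidly decreasing. -/
theorem rapidDecay_deriv {h : ℝ → ℂ} (hh : ContDiff ℝ ∞ h)
    (hdec : ∀ N : ℕ, ∃ C, ∀ t : ℝ, |t| ^ N * ‖h t‖ ≤ C) {K₁ K₂ : ℝ} (h1 : ∀ t, ‖deriv h t‖ ≤ K₁)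
    (h2 : ∀ t, ‖deriv (deriv h) t‖ ≤ K₂) (N : ℕ) :
    ∃ C, ∀ t : ℝ, |t| ^ N * ‖deriv h t‖ ≤ C := by
  obtain ⟨C, hC⟩ := hdec (2 * N)
  have hd1 : ContDiff ℝ ∞ (deriv h) := (contDiff_infty_iff_deriv.1 hh).2
  have hK₁ : 0 ≤ K₁ := (norm_nonneg _).trans (h1 0)
  have hK₂ : 0 ≤ K₂ := (norm_nonneg _).trans (h2 0)
  have hC0 : 0 ≤ C := (by positivity : (0 : ℝ) ≤ _).trans (hC 0)
  refine ⟨K₁ + (2 * C + K₂), fun t => ?_⟩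
  rcases le_total |t| 1 with ht | ht
  · have : |t| ^ N * ‖deriv h t‖ ≤ 1 * K₁ := by
      gcongr
      · exact pow_le_one₀ (abs_nonneg _) ht
      · exact h1 t
    linarith
  have htp : 0 < |t| := one_pos.trans_le ht
  -- A difference quotient with step |t|^{−N}, taken away from the origin so that |t + ε| ≥ |t|.
  -- Decay of h of order 2N makes both values O(δ²), and h'' costs K₂δ, so h' is O(δ).
  set δ : ℝ := (|t| ^ N)⁻¹ with hδ
  have hδ0 : 0 < δ := by positivity
  have htδ : |t| ^ N = δ⁻¹ := by rw [hδ, inv_inv]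
  obtain ⟨ε, hε, htε⟩ : ∃ ε : ℝ, |ε| = δ ∧ |t| ≤ |t + ε| := by
    rcases le_total 0 t with h0 | h0
    · refine ⟨δ, abs_of_pos hδ0, ?_⟩
      rw [abs_of_nonneg h0, abs_of_nonneg (by linarith)]; linarith
    · refine ⟨-δ, by rw [abs_neg, abs_of_pos hδ0], ?_⟩
      rw [abs_of_nonpos h0, abs_of_nonpos (by linarith)]; linarith
  have hsmall : ∀ s : ℝ, |t| ≤ |s| → ‖h s‖ ≤ C * δ ^ 2 := by
    intro s hs
    have h3 : |t| ^ (2 * N) * ‖h s‖ ≤ C := (by gcongr : _ ≤ |s| ^ (2 * N) * ‖h s‖).trans (hC s)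
    rw [mul_comm 2 N, pow_mul, htδ, inv_pow, inv_mul_le_iff₀ (by positivity)] at h3
    linarith
  have hder : ∀ s, HasDerivAt (fun s : ℝ => h s - (s : ℝ) • deriv h t) (deriv h s - deriv h t) s := by
    intro s
    have := ((hh.differentiable (by simp)) s).hasDerivAt.sub
      ((hasDerivAt_id s).smul_const (deriv h t))
    rw [one_smul] at this
    exact this
  have hder2 : ∀ s, HasDerivAt (deriv h) (deriv (deriv h) s) s := fun s =>
    ((hd1.differentiable (by simp)) s).hasDerivAt
  have hbound : ∀ s ∈ uIcc t (t + ε), ‖deriv h s - deriv h t‖ ≤ K₂ * δ := by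
    intro s hs
    have := (convex_univ (𝕜 := ℝ) (E := ℝ)).norm_image_sub_le_of_norm_hasDerivWithin_le
      (fun x _ => (hder2 x).hasDerivWithinAt) (fun x _ => h2 x) (mem_univ t) (mem_univ s)
    refine this.trans ?_
    gcongr
    rw [Real.norm_eq_abs, ← hε]
    simpa using abs_sub_left_of_mem_uIcc hs
  have hmv := (convex_uIcc t (t + ε)).norm_image_sub_le_of_norm_hasDerivWithin_le
    (fun x _ => (hder x).hasDerivWithinAt) hbound left_mem_uIcc right_mem_uIcc
  have hεn : ‖t + ε - t‖ = δ := by rw [add_sub_cancel_left, Real.norm_eq_abs, hε]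
  rw [hεn] at hmv
  have hkey : δ * ‖deriv h t‖ ≤ (2 * C + K₂) * δ ^ 2 := by
    have e1 : ‖ε • deriv h t‖ = δ * ‖deriv h t‖ := by rw [norm_smul, Real.norm_eq_abs, hε]
    rw [← e1]
    have e2 : ε • deriv h t = h (t + ε) - h t - ((h (t + ε) - (t + ε) • deriv h t) -
        (h t - t • deriv h t)) := by
      rw [add_smul]; abel
    rw [e2]
    have := norm_sub_le (h (t + ε) - h t) ((h (t + ε) - (t + ε) • deriv h t) - (h t - t • deriv h t))
    have h4 := norm_sub_le (h (t + ε)) (h t)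
    have h5 := hsmall _ htε
    have h6 := hsmall t le_rfl
    nlinarith
  have : |t| ^ N * ‖deriv h t‖ ≤ 2 * C + K₂ := by
    rw [htδ, inv_mul_le_iff₀ hδ0]
    have : δ * ‖deriv h t‖ ≤ δ * ((2 * C + K₂) * δ) := by linarith [sq δ, hkey, mul_comm δ ((2 * C + K₂) * δ), mul_assoc (2 * C + K₂) δ δ]
    linarith [le_of_mul_le_mul_left this hδ0]
  linarith

/-- A rapidly decreasing smooth function all of whose derivatives are bounded is a Schwartz
function. -/
theorem exists_schwartzMap_of_rapidDecay {h : ℝ → ℂ} (hh : ContDiff ℝ ∞ h)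
    (hdec : ∀ N : ℕ, ∃ C, ∀ t : ℝ, |t| ^ N * ‖h t‖ ≤ C)
    (hb : ∀ n : ℕ, ∃ C, ∀ t, ‖iteratedDeriv n h t‖ ≤ C) : ∃ r : SchwartzMap ℝ ℂ, ∀ t, r t = h t := by
  have key : ∀ n N : ℕ, ∃ C, ∀ t : ℝ, |t| ^ N * ‖iteratedDeriv n h t‖ ≤ C := by
    intro n
    induction n with
    | zero => simpa using hdec
    | succ n ih =>
      have hn : ContDiff ℝ ∞ (iteratedDeriv n h) :=
        ContDiff.iterate_deriv n hh |> (iteratedDeriv_eq_iterate (f := h) (n := n) ▸ ·)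
      obtain ⟨K₁, hK₁⟩ := hb (n + 1)
      obtain ⟨K₂, hK₂⟩ := hb (n + 2)
      simp only [iteratedDeriv_succ] at hK₁ hK₂ ⊢
      exact rapidDecay_deriv hn ih hK₁ hK₂
  refine ⟨⟨h, hh, fun k n => ?_⟩, fun t => rfl⟩
  obtain ⟨C, hC⟩ := key n k
  exact ⟨C, fun x => by
    rw [norm_iteratedFDeriv_eq_norm_iteratedDeriv, Real.norm_eq_abs]; exact hC x⟩

end OneSidedTransform

/-! ### Smooth functions on the circle with holomorphic extension belong to 𝓗⁺. -/

noncomputable section CircleTransform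

open Complex (I)
open MeasureTheory FourierTransform

/-- arctan(1/u) = ±π/2 − arctan u, and the sign only shifts the angle by a period. Hence u ↦ G(2
arctan u) is the smooth chart at infinity. -/
theorem circleAngle_inv {u : ℝ} (hu : u ≠ 0) {G : ℝ → ℂ} (hp : Function.Periodic G (2 * Real.pi)) :
    G (circleAngle u⁻¹) = G (2 * Real.arctan u) := by
  rcases lt_or_gt_of_ne hu with h | h
  · rw [circleAngle, Real.arctan_inv_of_neg h, ← hp (2 * Real.arctan u)]
    congr 1; ring
  · rw [circleAngle, Real.arctan_inv_of_pos h]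
    congr 1; ring

theorem one_sub_cos_circleAngle (t : ℝ) : 1 - Real.cos (circleAngle t) = 2 / (1 + t ^ 2) := by
  have h := Real.cos_sq_arctan t
  rw [circleAngle, Real.cos_pi_sub, Real.cos_two_mul, h]
  ring

theorem hasDerivAt_circleAngle (t : ℝ) :
    HasDerivAt circleAngle (-(1 - Real.cos (circleAngle t))) t := by
  rw [one_sub_cos_circleAngle]
  have := ((Real.hasDerivAt_arctan t).const_mul 2).const_sub Real.pi
  refine this.congr_deriv ?_
  ring

/-- In the angle, d/dt is the vector field −(1 − cos φ) d/dφ, which maps smooth periodic functions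
to such functions; these are bounded. -/
theorem exists_iteratedDeriv_comp_circleAngle_le (n : ℕ) : ∀ {G : ℝ → ℂ}, ContDiff ℝ ∞ G →
    Function.Periodic G (2 * Real.pi) →
    ∃ C : ℝ, ∀ t, ‖iteratedDeriv n (fun t => G (circleAngle t)) t‖ ≤ C := by
  induction n with
  | zero =>
    intro G hG hp
    obtain ⟨C, hC⟩ := (hp.compact_of_continuous Real.two_pi_pos.ne' hG.continuous).isBounded.exists_norm_le
    exact ⟨C, fun t => by simpa using hC _ (mem_range_self _)⟩
  | succ n ih =>
    intro G hG hp
    have hd : deriv (fun t => G (circleAngle t)) = fun t =>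
        (fun φ : ℝ => -(1 - Real.cos φ) • deriv G φ) (circleAngle t) := by
      ext t
      exact ((hG.differentiable (by simp) _).hasDerivAt.scomp t (hasDerivAt_circleAngle t)).deriv
    rw [iteratedDeriv_succ', hd]
    refine ih (G := fun φ : ℝ => -(1 - Real.cos φ) • deriv G φ) ?_ fun φ => ?_
    · exact ((contDiff_const.sub Real.contDiff_cos).neg).smul (contDiff_infty_iff_deriv.1 hG).2
    · simp only [periodic_deriv hp φ, Real.cos_add_two_pi]

theorem iterate_derivCLM_apply (φ : SchwartzMap ℝ ℂ) (n : ℕ) (x : ℝ) :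
    ((SchwartzMap.derivCLM ℂ ℂ)^[n] φ) x = iteratedDeriv n φ x := by
  induction n generalizing x with
  | zero => simp
  | succ n ih =>
    rw [Function.iterate_succ_apply', SchwartzMap.derivCLM_apply, iteratedDeriv_succ]
    congr 1
    ext y
    exact ih y

theorem lowerLaplace_expansion (φ : SchwartzMap ℝ ℂ) {t : ℝ} (ht : t ≠ 0) (N : ℕ) :
    lowerLaplace φ t = ∑ j ∈ Finset.range N, iteratedDeriv j φ 0 * ((I * t)⁻¹) ^ (j + 1) +
      ((I * t)⁻¹) ^ N * lowerLaplace ((SchwartzMap.derivCLM ℂ ℂ)^[N] φ) t := by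
  induction N with
  | zero => simp
  | succ N ih =>
    have hIt : I * (t : ℂ) ≠ 0 := mul_ne_zero Complex.I_ne_zero (by exact_mod_cast ht)
    rw [ih, Finset.sum_range_succ, Function.iterate_succ_apply',
      lowerLaplace_derivCLM _ (by simp), iterate_derivCLM_apply]
    have : ((I * (t : ℂ))⁻¹) ^ (N + 1) * (I * t * lowerLaplace ((SchwartzMap.derivCLM ℂ ℂ)^[N] φ) t) =
        ((I * t)⁻¹) ^ N * lowerLaplace ((SchwartzMap.derivCLM ℂ ℂ)^[N] φ) t := by
      rw [pow_succ, mul_assoc, inv_mul_cancel_left₀ hIt]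
    rw [mul_sub, this]
    ring

/-- A smooth function on the circle that vanishes at the point at infinity is a one-sided transform
up to a Schwartz function. -/
theorem exists_sub_lowerLaplace_schwartz {G : ℝ → ℂ} (hG : ContDiff ℝ ∞ G)
    (hp : Function.Periodic G (2 * Real.pi)) (h0 : G 0 = 0) :
    ∃ b r : SchwartzMap ℝ ℂ, ∀ t : ℝ, G (circleAngle t) = lowerLaplace b t + r t := by
  set g : ℝ → ℂ := fun u => G (2 * Real.arctan u) with hg
  have hgs : ContDiff ℝ ∞ g := hG.comp (contDiff_const.mul Real.contDiff_arctan)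
  let c : ℕ → ℂ := fun k => ((k.factorial : ℝ)⁻¹ : ℝ) • iteratedDeriv k g 0
  -- The expansion of the transform of b has terms b^{(j)}(0)/(it)^{j+1}. To match the Taylor terms
  -- c_{j+1} t^{−j−1} of G at infinity, take b^{(j)}(0) = i^{j+1} c_{j+1}; no constant term is left
  -- since G(0) = 0.
  obtain ⟨b₀, hb₀, hbc, hb⟩ := exists_contDiff_iteratedDeriv_eq fun j => I ^ (j + 1) * c (j + 1)
  let b : SchwartzMap ℝ ℂ := hbc.toSchwartzMap hb₀
  have hbd : ∀ j, iteratedDeriv j b 0 = I ^ (j + 1) * c (j + 1) := hb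
  have hc0 : c 0 = 0 := by simp [c, hg, h0]
  obtain ⟨hl, hlb⟩ := lowerLaplace_contDiff_and_bounded b
  set h : ℝ → ℂ := fun t => G (circleAngle t) - lowerLaplace b t with hh
  have hGs : ContDiff ℝ ∞ fun t => G (circleAngle t) := hG.comp contDiff_circleAngle
  have hhs : ContDiff ℝ ∞ h := hGs.sub hl
  obtain ⟨r, hr⟩ : ∃ r : SchwartzMap ℝ ℂ, ∀ t, r t = h t := by
    refine exists_schwartzMap_of_rapidDecay hhs (fun N => ?_) fun n => ?_
    · have ht := taylor_isLittleO_univ (x₀ := 0) (n := N)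
        (hgs.of_le (by exact_mod_cast le_top : ((N : ℕ) : WithTop ℕ∞) ≤ ∞))
      have ht1 := ((ht.bound one_pos))
      have ht2 := tendsto_inv₀_cobounded (α := ℝ) |>.eventually ht1
      set K := ∫ x in Ioi (0 : ℝ), ‖((SchwartzMap.derivCLM ℂ ℂ)^[N] b) x‖
      have hev : ∀ᶠ t in Bornology.cobounded ℝ, |t| ^ N * ‖h t‖ ≤ 1 + K := by
        filter_upwards [ht2, (Bornology.eventually_ne_cobounded (0 : ℝ))] with t hT ht0
        have htC : (t : ℂ) ≠ 0 := by exact_mod_cast ht0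
        have e1 : G (circleAngle t) = g t⁻¹ := by
          have := circleAngle_inv (inv_ne_zero ht0) hp
          rwa [inv_inv] at this
        have e2 : taylorWithinEval g N univ 0 t⁻¹ =
            ∑ j ∈ Finset.range N, iteratedDeriv j b 0 * ((I * t)⁻¹) ^ (j + 1) := by
          rw [taylor_within_apply, Finset.sum_range_succ']
          simp only [iteratedDerivWithin_univ]
          have : ((Nat.factorial 0 : ℝ)⁻¹ * (t⁻¹ - 0) ^ 0) • iteratedDeriv 0 g 0 = c 0 := by
            simp [c]
          rw [this, hc0, add_zero]
          refine Finset.sum_congr rfl fun j _ => ?_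
          rw [hbd, mul_inv, mul_pow, inv_pow I]
          simp only [c, sub_zero, Complex.real_smul]
          have := pow_ne_zero (j + 1) Complex.I_ne_zero
          push_cast
          field_simp
        have e3 : h t = (g t⁻¹ - taylorWithinEval g N univ 0 t⁻¹) -
            ((I * t)⁻¹) ^ N * lowerLaplace ((SchwartzMap.derivCLM ℂ ℂ)^[N] b) t := by
          rw [e2, hh]
          simp only [e1]
          rw [lowerLaplace_expansion b ht0 N]
          ring
        have hpos : 0 < |t| := abs_pos.2 ht0
        have e4 : ‖((I * (t : ℂ))⁻¹) ^ N * lowerLaplace ((SchwartzMap.derivCLM ℂ ℂ)^[N] b) t‖ ≤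
            (|t| ^ N)⁻¹ * K := by
          rw [norm_mul, norm_pow, norm_inv, norm_mul, Complex.norm_I, one_mul, Complex.norm_real,
            Real.norm_eq_abs, inv_pow]
          gcongr
          exact norm_lowerLaplace_le _ (by simp)
        have e5 : ‖g t⁻¹ - taylorWithinEval g N univ 0 t⁻¹‖ ≤ (|t| ^ N)⁻¹ := by
          refine hT.trans_eq ?_
          rw [one_mul, sub_zero, norm_pow, norm_inv, inv_pow, Real.norm_eq_abs]
        rw [e3]
        calc |t| ^ N * _ ≤ |t| ^ N * ((|t| ^ N)⁻¹ + (|t| ^ N)⁻¹ * K) := by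
              gcongr
              exact (norm_sub_le _ _).trans (add_le_add e5 e4)
          _ = 1 + K := by field_simp
      have hcont : Continuous fun t : ℝ => |t| ^ N * ‖h t‖ := by
        have := hhs.continuous; fun_prop
      rw [Metric.cobounded_eq_cocompact, Filter.eventually_iff, mem_cocompact] at hev
      obtain ⟨T, hTc, hT⟩ := hev
      obtain ⟨C', hC'⟩ := hTc.exists_bound_of_continuousOn hcont.continuousOn
      refine ⟨max C' (1 + K), fun t => ?_⟩
      by_cases htT : t ∈ T
      · exact (le_abs_self _).trans ((hC' t htT).trans (le_max_left _ _))
      · exact (hT htT : _ ≤ 1 + K).trans (le_max_right _ _)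
    · obtain ⟨C₁, hC₁⟩ := exists_iteratedDeriv_comp_circleAngle_le n hG hp
      obtain ⟨C₂, hC₂⟩ := hlb n
      refine ⟨C₁ + C₂, fun t => ?_⟩
      rw [hh, iteratedDeriv_fun_sub (hGs.of_le (by exact_mod_cast le_top)).contDiffAt
        (hl.of_le (by exact_mod_cast le_top)).contDiffAt]
      exact (norm_sub_le _ _).trans (add_le_add (hC₁ t) (hC₂ t))
  exact ⟨b, r, fun t => by rw [hr]; simp [hh]⟩

/-- A Schwartz function is the sum of a one-sided transform and a conjugate of one. -/
theorem exists_eq_lowerLaplace_add_conj (r : SchwartzMap ℝ ℂ) :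
    ∃ ρ₁ ρ₂ : SchwartzMap ℝ ℂ, ∀ t : ℝ,
      r t = lowerLaplace ρ₁ t + (starRingEnd ℂ) (lowerLaplace ρ₂ t) := by
  have hpi : 2 * Real.pi ≠ 0 := Real.two_pi_pos.ne'
  let e : ℝ ≃L[ℝ] ℝ := ContinuousLinearEquiv.unitsEquivAut ℝ (Units.mk0 (2 * Real.pi) hpi)
  let r' : SchwartzMap ℝ ℂ := SchwartzMap.compCLMOfContinuousLinearEquiv ℂ e r
  let ρ : SchwartzMap ℝ ℂ := 𝓕⁻ r'
  -- Reflected and conjugated, so that the integral of the inverse transform over the negative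
  -- half-line is the conjugate of a one-sided transform.
  let ρ₂ : SchwartzMap ℝ ℂ := SchwartzMap.postcompCLM (𝕜 := ℝ) (Complex.conjCLE : ℂ →L[ℝ] ℂ)
    (SchwartzMap.compCLMOfContinuousLinearEquiv ℝ (ContinuousLinearEquiv.neg ℝ) ρ)
  have hρ₂ : ∀ s, ρ₂ s = (starRingEnd ℂ) (ρ (-s)) := fun s => rfl
  refine ⟨ρ, ρ₂, fun t => ?_⟩
  have h1 : 𝓕 ρ = r' := by simp [ρ]
  have h2 : r t = 𝓕 (ρ : ℝ → ℂ) (t / (2 * Real.pi)) := by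
    rw [← SchwartzMap.fourier_coe, h1]
    change r t = r (t / (2 * Real.pi) * (2 * Real.pi))
    rw [div_mul_cancel₀ _ hpi]
  have h3 : ∀ v : ℝ, Complex.exp (↑(-2 * Real.pi * v * (t / (2 * Real.pi))) * I) • ρ v =
      Complex.exp (-I * v * t) * ρ v := by
    intro v
    rw [smul_eq_mul]
    congr 2
    have : (Real.pi : ℂ) ≠ 0 := by exact_mod_cast Real.pi_ne_zero
    push_cast
    field_simp
  have hintegrable : Integrable fun v : ℝ => Complex.exp (-I * v * t) * ρ v := by
    refine ρ.integrable.mono ((by fun_prop : Continuous fun x : ℝ => Complex.exp (-I * x * t)).mul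
      ρ.continuous).aestronglyMeasurable (Eventually.of_forall fun v => ?_)
    rw [norm_mul, Complex.norm_exp]
    simp
  rw [h2, Real.fourier_real_eq_integral_exp_smul]
  simp only [h3]
  rw [← intervalIntegral.integral_Iic_add_Ioi (b := 0) hintegrable.integrableOn hintegrable.integrableOn, add_comm]
  congr 1
  have := integral_comp_neg_Ioi 0 fun v : ℝ => Complex.exp (-I * v * t) * ρ v
  rw [neg_zero] at this
  rw [← this, lowerLaplace, ← integral_conj]
  congr 1
  ext v
  rw [hρ₂, map_mul, ← Complex.exp_conj]
  simp

/-- G is a sum of transforms of b and ρ₁ and a conjugate transform of ρ₂. All three are continuous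
on the closed disc with value 0 at 1, so uniqueness applied to A minus the first two leaves nothing:
G is the transform of b + ρ₁. -/
theorem memHPlus_comp_circleAngle {G : ℝ → ℂ} {A : ℂ → ℂ} (hG : ContDiff ℝ ∞ G)
    (hA : DiffContOnCl ℂ A (Metric.ball 0 1)) (h1 : A 1 = 0)
    (h : ∀ φ : ℝ, G φ = A (Complex.exp (φ * I))) : MemHPlus fun t => G (circleAngle t) := by
  have hp : Function.Periodic G (2 * Real.pi) := fun φ => by
    rw [h, h, Complex.ofReal_add, add_mul, Complex.ofReal_mul, Complex.ofReal_ofNat,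
      Complex.exp_add, Complex.exp_two_pi_mul_I, mul_one]
  obtain ⟨b, r, hbr⟩ := exists_sub_lowerLaplace_schwartz hG hp (by rw [h]; simpa using h1)
  obtain ⟨ρ₁, ρ₂, hρ⟩ := exists_eq_lowerLaplace_add_conj r
  have hz := eq_zero_of_add_conj_eq_zero
    (A := fun w => A w - discLaplace b w - discLaplace ρ₁ w) (B := fun w => -discLaplace ρ₂ w)
    ((hA.sub (diffContOnCl_discLaplace b)).sub (diffContOnCl_discLaplace ρ₁))
    (diffContOnCl_discLaplace ρ₂).neg (fun w hw => by
      by_cases hw1 : w = 1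
      · subst hw1
        simp [discLaplace, h1]
      · obtain ⟨t, rfl⟩ := exists_real_cayley_eq hw hw1
        simp only [discLaplace_cayley, map_neg]
        rw [← exp_circleAngle, ← h, hbr, hρ]
        ring) (by simp [discLaplace, h1])
  refine ⟨b + ρ₁, fun t => ?_⟩
  have := hz (cayley t) (by
    rw [mem_closedBall_zero_iff]; exact norm_cayley_le_one (by simp))
  simp only [discLaplace_cayley] at this
  rw [← exp_circleAngle, ← h] at this
  have hadd : lowerLaplace (b + ρ₁) t = lowerLaplace b t + lowerLaplace ρ₁ t := by
    unfold lowerLaplace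
    rw [← integral_add (integrableOn_lowerLaplace b (by simp)) (integrableOn_lowerLaplace ρ₁ (by simp))]
    congr 1
    ext x
    rw [add_apply, mul_add]
  change _ = lowerLaplace (b + ρ₁) t
  rw [hadd]
  linear_combination this

end CircleTransform

/-! ### The two factors and the logarithm of the symbol. -/

noncomputable section Factors

open Complex (I)

variable {M m : ℕ}

/-- The integral defining the projection is not visibly invariant under dilations of the line. But
it gives the holomorphic part of a splitting that is unique, and dilations carry such splittings to
each other. -/
theorem hardyProj_dilation {ψ ψ' : ℝ → ℂ} (hψ : ContDiff ℝ ∞ ψ)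
    (hp : Function.Periodic ψ (2 * Real.pi)) (hψ' : ContDiff ℝ ∞ ψ')
    (hp' : Function.Periodic ψ' (2 * Real.pi)) {s : ℝ} (hs : 0 < s) (h0 : ψ' 0 = ψ 0)
    (h : ∀ t, ψ' (circleAngle (s * t)) = ψ (circleAngle t)) (t : ℝ) :
    hardyProj ψ' (circleAngle (s * t)) = hardyProj ψ (circleAngle t) := by
  have conj_smooth : ∀ {ψ : ℝ → ℂ}, ContDiff ℝ ∞ ψ → ContDiff ℝ ∞ fun s => (starRingEnd ℂ) (ψ s) :=
    fun h => Complex.conjCLE.contDiff.comp h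
  have conj_per : ∀ {ψ : ℝ → ℂ}, Function.Periodic ψ (2 * Real.pi) →
      Function.Periodic (fun s => (starRingEnd ℂ) (ψ s)) (2 * Real.pi) := fun h s => by simp only [h s]
  obtain ⟨A, hA, hA1, hAψ⟩ := exists_hardyProj_eq_powerSeries hψ hp
  obtain ⟨B, hB, hB1, hBψ⟩ := exists_hardyProj_eq_powerSeries (conj_smooth hψ) (conj_per hp)
  obtain ⟨A', hA', hA'1, hA'ψ⟩ := exists_hardyProj_eq_powerSeries hψ' hp'
  obtain ⟨B', hB', hB'1, hB'ψ⟩ := exists_hardyProj_eq_powerSeries (conj_smooth hψ') (conj_per hp')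
  have := hardyPart_dilation hA hB hA' hB' hA1 hB1 hA'1 hB'1 hs (fun t => by
    rw [← exp_circleAngle, ← exp_circleAngle, ← hAψ, ← hBψ, ← hA'ψ, ← hB'ψ,
      hardyProj_add_conj hψ hp, hardyProj_add_conj hψ' hp', h, h0]) t
  rwa [← exp_circleAngle, ← exp_circleAngle, ← hAψ, ← hA'ψ] at this

/-- The projection `hardyProj`, acting in the last variable. -/
def hardyProjLast (F : Eu M × (Eu m × ℝ) → ℂ) : Eu M × (Eu m × ℝ) → ℂ := fun p =>
  hardyProj (fun s => F (p.1, p.2.1, s)) p.2.2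

theorem deriv_last {F : Eu M × (Eu m × ℝ) → ℂ} (hF : ContDiff ℝ ∞ F) (x : Eu M) (η : Eu m) :
    deriv (fun s : ℝ => F (x, η, s)) = fun s => dirDeriv (dirXin M m) F (x, η, s) := by
  ext s
  have h1 : HasDerivAt (fun s : ℝ => (x, η, s)) (dirXin M m) s :=
    (hasDerivAt_const s x).prodMk ((hasDerivAt_const s η).prodMk (hasDerivAt_id s))
  exact ((hF.differentiable (by simp) (x, η, s)).hasFDerivAt.comp_hasDerivAt s h1).deriv

theorem LocSmoothBdd.dirDeriv {F : Eu M × (Eu m × ℝ) → ℂ} {S : Set (Eu M)} (hS : IsOpen S)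
    (h : LocSmoothBdd S F) (w : Eu M × (Eu m × ℝ)) : LocSmoothBdd S (dirDeriv w F) :=
  fun v => (h v).fderiv_apply hS w

theorem LocSmoothBdd.hardyProjLast {F : Eu M × (Eu m × ℝ) → ℂ} (hF : ContDiff ℝ ∞ F)
    {S : Set (Eu M)} (hS : IsOpen S) (h : LocSmoothBdd S F) : LocSmoothBdd S (hardyProjLast F) := by
  set D : Eu M × (Eu m × ℝ) → ℂ := _root_.dirDeriv (dirXin M m) (_root_.dirDeriv (dirXin M m) F)
    with hD
  have hDs : ContDiff ℝ ∞ D := (hF.dirDeriv _).dirDeriv _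
  have hDb : LocSmoothBdd S D := (h.dirDeriv hS _).dirDeriv hS _
  have hdd : ∀ x η, deriv (deriv fun s : ℝ => F (x, η, s)) = fun s => D (x, η, s) := by
    intro x η
    rw [deriv_last hF, deriv_last (hF.dirDeriv _)]
  set H : Eu M × ((Eu m × ℝ) × ℝ) → ℂ := fun p =>
    D (p.1, p.2.1.1, p.2.1.2 - p.2.2) - D (p.1, p.2.1.1, 0 - p.2.2) with hH
  have hHs : ContDiff ℝ ∞ H := by
    refine ContDiff.sub (hDs.comp ?_) (hDs.comp ?_) <;> fun_prop
  have hHb : LocSmoothBdd S H := fun v => by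
    refine LocSmoothBddAt.sub hS ?_ ?_
    · exact LocSmoothBdd.comp_right (γ := fun v : (Eu m × ℝ) × ℝ => (v.1.1, v.1.2 - v.2)) hS
        (by fun_prop) hDb v
    · exact LocSmoothBdd.comp_right (γ := fun v : (Eu m × ℝ) × ℝ => (v.1.1, 0 - v.2)) hS
        (by fun_prop) hDb v
  have hkr : Continuous fun s => (hardyKernel s).re := Complex.continuous_re.comp continuous_hardyKernel
  have hki : Continuous fun s => (hardyKernel s).im := Complex.continuous_im.comp continuous_hardyKernel
  -- Integration against a parameter is set up for real kernels, so the complex kernel is split into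
  -- real and imaginary part.
  have heq : ∀ p : Eu M × (Eu m × ℝ), _root_.hardyProjLast F p = (2 * Real.pi : ℂ)⁻¹ *
      ((∫ s in (0 : ℝ)..2 * Real.pi, (hardyKernel s).re • H (p.1, (p.2, s))) +
        I * ∫ s in (0 : ℝ)..2 * Real.pi, (hardyKernel s).im • H (p.1, (p.2, s))) := by
    rintro ⟨x, η, φ⟩
    have hHc : Continuous fun s : ℝ => H (x, ((η, φ), s)) :=
      hHs.continuous.comp (by fun_prop)
    simp only [_root_.hardyProjLast, hardyProj, hdd]
    have h1 : IntervalIntegrable (fun s => (hardyKernel s).re • H (x, ((η, φ), s)))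
      MeasureTheory.volume 0 (2 * Real.pi) := (hkr.smul hHc).intervalIntegrable _ _
    have h2 : IntervalIntegrable (fun s => I * ((hardyKernel s).im • H (x, ((η, φ), s))))
      MeasureTheory.volume 0 (2 * Real.pi) :=
      (continuous_const.mul (hki.smul hHc)).intervalIntegrable _ _
    rw [← intervalIntegral.integral_const_mul I, ← intervalIntegral.integral_add h1 h2]
    congr 2
    ext s
    conv_lhs => rw [← Complex.re_add_im (hardyKernel s)]
    simp only [hH, Complex.real_smul]
    ring
  intro v
  rw [funext heq]
  refine (LocSmoothBddAt.const _).mul hS (LocSmoothBddAt.add hS ?_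
    ((LocSmoothBddAt.const _).mul hS ?_))
  · exact LocSmoothBddAt.integral hS (hkr.intervalIntegrable _ _) fun s _ => hHb _
  · exact LocSmoothBddAt.integral hS (hki.intervalIntegrable _ _) fun s _ => hHb _

theorem ContDiff.hardyProjLast {F : Eu M × (Eu m × ℝ) → ℂ} (hF : ContDiff ℝ ∞ F) :
    ContDiff ℝ ∞ (hardyProjLast F) :=
  contDiff_of_locSmoothBdd_ball fun R =>
    (hF.locSmoothBdd_ball R).hardyProjLast hF Metric.isOpen_ball

/-- Smooth functions on the circle, depending on parameters, whose values for a parameter extend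
holomorphically to the disc and vanish at `1`, and that are homogeneous of degree `0` in the
coordinate `circleAngle`. -/
structure CircleFactor (G : Eu M × (Eu m × ℝ) → ℂ) : Prop where
  contDiff : ContDiff ℝ ∞ G
  extends_disc : ∀ x η, ∃ A : ℂ → ℂ, DiffContOnCl ℂ A (Metric.ball 0 1) ∧ A 1 = 0 ∧
    (∀ w, A w ≠ -1) ∧ ∀ φ : ℝ, G (x, η, φ) = A (Complex.exp (φ * I))
  homogeneous : ∀ (x : Eu M) (η : Eu m) (t : ℝ), 1 ≤ ‖η‖ → ∀ s : ℝ, 1 ≤ s →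
    G (x, s • η, circleAngle (s * t)) = G (x, η, circleAngle t)

/-- The properties of the logarithm of the symbol on the circle that the factorization needs. -/
structure CircleLog (Ψ : Eu M × (Eu m × ℝ) → ℂ) : Prop where
  contDiff : ContDiff ℝ ∞ Ψ
  periodic : ∀ x η, Function.Periodic (fun φ => Ψ (x, η, φ)) (2 * Real.pi)
  at_zero : ∀ x η η', Ψ (x, η, 0) = Ψ (x, η', 0)
  homogeneous : ∀ (x : Eu M) (η : Eu m) (t : ℝ), 1 ≤ ‖η‖ → ∀ s : ℝ, 1 ≤ s →
    Ψ (x, s • η, circleAngle (s * t)) = Ψ (x, η, circleAngle t)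

theorem CircleLog.conj {Ψ : Eu M × (Eu m × ℝ) → ℂ} (h : CircleLog Ψ) :
    CircleLog fun p => (starRingEnd ℂ) (Ψ p) where
  contDiff := Complex.conjCLE.contDiff.comp h.contDiff
  periodic x η φ := congrArg (starRingEnd ℂ) (h.periodic x η φ)
  at_zero x η η' := congrArg (starRingEnd ℂ) (h.at_zero x η η')
  homogeneous x η t hη s hs := congrArg (starRingEnd ℂ) (h.homogeneous x η t hη s hs)

/-- The factor that belongs to the part of `Ψ` with positive frequencies, minus `1`. -/
def expHardy (Ψ : Eu M × (Eu m × ℝ) → ℂ) : Eu M × (Eu m × ℝ) → ℂ := fun p =>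
  Complex.exp (hardyProjLast Ψ p) - 1

theorem CircleLog.contDiff_slice {Ψ : Eu M × (Eu m × ℝ) → ℂ} (h : CircleLog Ψ) (x : Eu M)
    (η : Eu m) : ContDiff ℝ ∞ fun φ : ℝ => Ψ (x, η, φ) :=
  h.contDiff.comp (by fun_prop)

/-- The extension is e^A − 1, which omits the value −1; this is why 1 plus the factor has no zeros.
Homogeneity uses that the value of Ψ at infinity does not depend on η. -/
theorem CircleLog.circleFactor {Ψ : Eu M × (Eu m × ℝ) → ℂ} (h : CircleLog Ψ) :
    CircleFactor (expHardy Ψ) where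
  contDiff := (h.contDiff.hardyProjLast.cexp).sub contDiff_const
  extends_disc x η := by
    obtain ⟨A, hA, hA1, hAψ⟩ := exists_hardyProj_eq_powerSeries (h.contDiff_slice x η) (h.periodic x η)
    refine ⟨fun w => Complex.exp (A w) - 1, ?_, by simp [hA1], fun w hw => ?_, fun φ => ?_⟩
    · exact (Complex.differentiable_exp.diffContOnCl.comp hA (mapsTo_univ _ _)).sub_const 1
    · exact Complex.exp_ne_zero (A w) (by linear_combination hw)
    · rw [expHardy, hardyProjLast, hAψ]
  homogeneous x η t hη s hs := by
    simp only [expHardy, hardyProjLast]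
    rw [hardyProj_dilation (h.contDiff_slice x η) (h.periodic x η) (h.contDiff_slice x (s • η))
      (h.periodic x (s • η)) (one_pos.trans_le hs) (h.at_zero x _ _)
      (fun t => h.homogeneous x η t hη s hs)]

theorem LocSmoothBdd.expHardy {Ψ : Eu M × (Eu m × ℝ) → ℂ} (hΨ : ContDiff ℝ ∞ Ψ)
    {S : Set (Eu M)} (hS : IsOpen S) (h : LocSmoothBdd S Ψ) : LocSmoothBdd S (expHardy Ψ) :=
  fun v => ((h.hardyProjLast hΨ hS v).comp_contDiff hS Complex.contDiff_exp).sub hS (.const 1)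

theorem expHardy_mul_conj {Ψ : Eu M × (Eu m × ℝ) → ℂ} (h : CircleLog Ψ) (x : Eu M) (η : Eu m)
    (φ : ℝ) : (1 + expHardy Ψ (x, η, φ)) *
      (starRingEnd ℂ) (1 + expHardy (fun p => (starRingEnd ℂ) (Ψ p)) (x, η, φ)) =
      Complex.exp (Ψ (x, η, φ) - Ψ (x, η, 0)) := by
  have := hardyProj_add_conj (h.contDiff_slice x η) (h.periodic x η) φ
  simp only [expHardy, hardyProjLast, add_sub_cancel]
  rw [← this, Complex.exp_add, Complex.exp_conj]

theorem CircleFactor.invertible_lower {G : Eu M × (Eu m × ℝ) → ℂ} (h : CircleFactor G) (x : Eu M)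
    (η : Eu m) : InvertibleHolomorphicExtension {z : ℂ | z.im < 0}
      fun t => 1 + G (x, η, circleAngle t) := by
  obtain ⟨A, hA, -, hne, hAG⟩ := h.extends_disc x η
  refine ⟨fun z => 1 + A (cayley z), hA.comp_cayley.const_add 1, fun t => ?_, fun z _ hz => ?_⟩
  · simp only [hAG, exp_circleAngle]
  · exact hne _ (by linear_combination hz)

/-- Schwarz reflection: the extension is z ↦ conj(g(conj z)). -/
theorem InvertibleHolomorphicExtension.conj {u : ℝ → ℂ}
    (h : InvertibleHolomorphicExtension {z : ℂ | z.im < 0} u) :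
    InvertibleHolomorphicExtension {z : ℂ | 0 < z.im} fun t => (starRingEnd ℂ) (u t) := by
  obtain ⟨g, hg, hgu, hne⟩ := h
  have hcl : closure {z : ℂ | 0 < z.im} = {z : ℂ | 0 ≤ z.im} := Complex.closure_setOfPred_lt_im 0
  have hc := hg.continuousOn
  rw [closure_lower] at hc hne
  refine ⟨fun z => (starRingEnd ℂ) (g ((starRingEnd ℂ) z)), ⟨fun z hz => ?_, ?_⟩, fun t => ?_,
    fun z hz h0 => ?_⟩
  · have h1 : DifferentiableAt ℂ g ((starRingEnd ℂ) z) := hg.differentiableAt isOpen_lower (by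
      simpa using hz)
    have h2 := h1.star_star
    simpa [Function.comp_def] using h2.differentiableWithinAt
  · rw [hcl]
    exact Complex.continuous_conj.comp_continuousOn (hc.comp Complex.continuous_conj.continuousOn
      fun z (hz : 0 ≤ z.im) => by simpa using hz)
  · simp [hgu]
  · rw [hcl] at hz
    exact hne ((starRingEnd ℂ) z) (by simpa using hz) (by simpa using h0)

/-- The logarithm of the symbol on the circle, for the branch that is cut along the ray of
argument `θ`. -/
def circleLogSymbol (θ : ℝ) (q : Eu M → Eu m → ℝ → ℂ) : Eu M × (Eu m × ℝ) → ℂ := fun p =>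
  Complex.log (-Complex.exp (-(θ * I)) * circleSymbol q p)

/-- The factor −e^{−iθ} rotates the forbidden ray onto the closed negative real axis, where the
principal logarithm has its cut. -/
theorem rotated_mem_slitPlane {θ : ℝ} {z : ℂ}
    (h : ∀ r : ℝ, 0 ≤ r → z ≠ r * Complex.exp (θ * I)) :
    -Complex.exp (-(θ * I)) * z ∈ Complex.slitPlane := by
  rw [Complex.mem_slitPlane_iff]
  by_contra! hc
  set w := -Complex.exp (-(θ * I)) * z with hw
  refine h (-w.re) (by linarith [hc.1]) ?_
  have h1 : (w.re : ℂ) = w := Complex.ext (by simp) (by simp [hc.2])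
  rw [Complex.ofReal_neg, h1, hw, Complex.exp_neg]
  field_simp

theorem exists_circleSymbol_eq (q : Eu M → Eu m → ℝ → ℂ) (p : Eu M × (Eu m × ℝ)) :
    ∃ η t, circleSymbol q p = q p.1 η t := by
  unfold circleSymbol
  split_ifs
  exacts [⟨_, _, rfl⟩, ⟨_, _, rfl⟩]

theorem circleLogSymbol_arg_mem {θ : ℝ} {q : Eu M → Eu m → ℝ → ℂ} (hray : AvoidsRay θ q)
    (p : Eu M × (Eu m × ℝ)) : -Complex.exp (-(θ * I)) * circleSymbol q p ∈ Complex.slitPlane := by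
  obtain ⟨η, t, h⟩ := exists_circleSymbol_eq q p
  rw [h]
  exact rotated_mem_slitPlane (hray p.1 η t)

theorem circleSymbol_zero (q : Eu M → Eu m → ℝ → ℂ) (x : Eu M) (η : Eu m) :
    circleSymbol q (x, η, 0) = q x 0 1 := by
  simp [circleSymbol]

/-- The rotation factor cancels in the difference of logarithms, leaving q(x, ξ)/s_0(x). -/
theorem exp_circleLogSymbol {θ : ℝ} {q : Eu M → Eu m → ℝ → ℂ} (hray : AvoidsRay θ q)
    (x : Eu M) (η : Eu m) (t : ℝ) : q x 0 1 * Complex.exp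
      (circleLogSymbol θ q (x, η, circleAngle t) - circleLogSymbol θ q (x, η, 0)) = q x η t := by
  have h := fun p => Complex.slitPlane_ne_zero (circleLogSymbol_arg_mem hray p)
  simp only [circleLogSymbol]
  rw [Complex.exp_sub, Complex.exp_log (h _), Complex.exp_log (h _), circleSymbol_circleAngle,
    circleSymbol_zero]
  have h0 := h (x, η, 0)
  rw [circleSymbol_zero] at h0
  have := mul_ne_zero_iff.1 h0
  obtain ⟨h1, h2⟩ := this
  field_simp

theorem LocSmoothBdd.circleLogSymbol {θ : ℝ} {q : Eu M → Eu m → ℝ → ℂ} (hq : JointlySmooth q)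
    (hhom : HomogeneousZero q) (ht : ZeroTransmission q) (hray : AvoidsRay θ q) {S : Set (Eu M)}
    (hS : IsOpen S) (hb : LocSmoothBdd S (joint q))
    (hlow : ∀ v : Eu m × ℝ, ∃ c : ℝ, 0 < c ∧
      ∀ᶠ v' in 𝓝 v, ∀ x ∈ S, c ≤ ‖_root_.circleSymbol q (x, v')‖) :
    LocSmoothBdd S (circleLogSymbol θ q) := by
  intro v
  obtain ⟨c, hc, hl⟩ := hlow v
  refine ((LocSmoothBddAt.const _).mul hS (hb.circleSymbol hq hhom ht hS v)).log hS
    (fun x _ v => circleLogSymbol_arg_mem hray (x, v)) hc ?_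
  filter_upwards [hl] with v' hv' x hx
  rw [norm_mul, norm_neg, Complex.norm_exp]
  simpa using hv' x hx

theorem circleLog_circleLogSymbol {θ : ℝ} {q : Eu M → Eu m → ℝ → ℂ} (hq : JointlySmooth q)
    (hhom : HomogeneousZero q) (ht : ZeroTransmission q) (hray : AvoidsRay θ q) :
    CircleLog (circleLogSymbol θ q) where
  contDiff := by
    have hcs : ContDiff ℝ ∞ (circleSymbol q) := contDiff_of_locSmoothBdd_ball fun R =>
      LocSmoothBdd.circleSymbol hq hhom ht Metric.isOpen_ball (ContDiff.locSmoothBdd_ball hq R)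
    refine contDiff_iff_contDiffAt.2 fun p => ?_
    exact ((Complex.contDiffAt_log (circleLogSymbol_arg_mem hray p)).restrict_scalars ℝ).comp p
      (contDiff_const.mul hcs).contDiffAt
  periodic x η φ := by simp only [circleLogSymbol, circleSymbol_add_two_pi]
  at_zero x η η' := by simp only [circleLogSymbol, circleSymbol_zero]
  homogeneous x η t hη s hs := by
    simp only [circleLogSymbol, circleSymbol_circleAngle]
    rw [hhom x η t _ s hs]
    rw [OutsideUnitBall, Real.one_le_sqrt]
    nlinarith [sq_nonneg t]

end Factors

/-! ### Homogeneous functions with a smooth chart at infinity. -/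

noncomputable section Pairs

variable {M m : ℕ} {S : Set (Eu M)}

theorem dirDeriv_eq_deriv_line {P : Type} [NormedAddCommGroup P] [NormedSpace ℝ P] {F : P → ℂ}
    (hF : ContDiff ℝ ∞ F) (v p : P) : dirDeriv v F p = deriv (fun r : ℝ => F (p + r • v)) 0 :=
  ((hF.differentiable (by simp)) p).lineDeriv_eq_fderiv.symm

theorem hasDerivAt_last {g : Eu M × (Eu m × ℝ) → ℂ} (hg : ContDiff ℝ ∞ g) (x : Eu M) (η : Eu m)
    (u : ℝ) : HasDerivAt (fun s : ℝ => g (x, η, s)) (dirDeriv (dirXin M m) g (x, η, u)) u := by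
  have := ((hg.comp (by fun_prop : ContDiff ℝ ∞ fun s : ℝ => (x, η, s))).differentiable
    (by simp) u).hasDerivAt
  rwa [Function.comp_def, deriv_last hg] at this

/-- The difference quotient `(g(x, η, u) - g(x, η, 0)) / u`. -/
def lastQuotient (g : Eu M × (Eu m × ℝ) → ℂ) : Eu M × (Eu m × ℝ) → ℂ := fun p =>
  ∫ r in (0 : ℝ)..1, (1 : ℝ) • dirDeriv (dirXin M m) g (p.1, (p.2.1, r * p.2.2))

/-- The fundamental theorem of calculus along r ↦ g(x, η, ru). The integral form defines the
quotient smoothly at u = 0 as well. -/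
theorem mul_lastQuotient {g : Eu M × (Eu m × ℝ) → ℂ} (hg : ContDiff ℝ ∞ g) (x : Eu M) (η : Eu m)
    (u : ℝ) : (u : ℂ) * lastQuotient g (x, η, u) = g (x, η, u) - g (x, η, 0) := by
  have hd : ∀ r : ℝ, HasDerivAt (fun r : ℝ => g (x, η, r * u))
      ((u : ℂ) * ((1 : ℝ) • dirDeriv (dirXin M m) g (x, (η, r * u)))) r := by
    intro r
    have h2 := (hasDerivAt_last hg x η (r * u)).scomp r ((hasDerivAt_id r).mul_const u)
    simpa [Function.comp_def] using h2
  have hc : Continuous fun r : ℝ => (u : ℂ) *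
      ((1 : ℝ) • dirDeriv (dirXin M m) g (x, (η, r * u))) := by
    have := (hg.dirDeriv (dirXin M m)).continuous
    fun_prop
  have := intervalIntegral.integral_eq_sub_of_hasDerivAt (a := 0) (b := 1) (fun r _ => hd r)
    (hc.intervalIntegrable _ _)
  rw [intervalIntegral.integral_const_mul] at this
  simpa [lastQuotient] using this

theorem LocSmoothBdd.lastQuotient {g : Eu M × (Eu m × ℝ) → ℂ} (hS : IsOpen S)
    (h : LocSmoothBdd S g) : LocSmoothBdd S (lastQuotient g) := fun v => by
  refine LocSmoothBddAt.integral (H := fun p : Eu M × ((Eu m × ℝ) × ℝ) =>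
    _root_.dirDeriv (dirXin M m) g (p.1, (p.2.1.1, p.2.2 * p.2.1.2))) hS
    (continuous_const.intervalIntegrable _ _) fun s _ => ?_
  exact LocSmoothBdd.comp_right (γ := fun v : (Eu m × ℝ) × ℝ => (v.1.1, v.2 * v.1.2)) hS
    (by fun_prop) (h.dirDeriv hS _) _

theorem ContDiff.lastQuotient {g : Eu M × (Eu m × ℝ) → ℂ} (hg : ContDiff ℝ ∞ g) :
    ContDiff ℝ ∞ (lastQuotient g) :=
  contDiff_of_locSmoothBdd_ball fun R => (hg.locSmoothBdd_ball R).lastQuotient Metric.isOpen_ball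

/-- A function `a(x, η, t)` that is homogeneous of degree `d` in `(η, t)` for `‖η‖ > 1`, together with
the function `g(x, η, u) = a(x, η, 1/u)` that extends it smoothly to `u = 0`, where it vanishes; all
derivatives are bounded uniformly for `x ∈ S`. -/
structure SymbolPair (S : Set (Eu M)) (d : ℤ) (a g : Eu M × (Eu m × ℝ) → ℂ) : Prop where
  contDiff : ContDiff ℝ ∞ a
  contDiff_inv : ContDiff ℝ ∞ g
  bdd : LocSmoothBdd S a
  bdd_inv : LocSmoothBdd S g
  inv_eq : ∀ (x : Eu M) (η : Eu m) (u : ℝ), u ≠ 0 → g (x, η, u) = a (x, η, u⁻¹)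
  inv_zero : ∀ (x : Eu M) (η : Eu m), g (x, η, 0) = 0
  homogeneous : ∀ (x : Eu M) (η : Eu m) (t : ℝ), 1 < ‖η‖ → ∀ s : ℝ, 1 ≤ s →
    a (x, s • η, s * t) = (s : ℂ) ^ d * a (x, η, t)

namespace SymbolPair

variable {d : ℤ} {a g : Eu M × (Eu m × ℝ) → ℂ}

theorem dirDeriv_inv_eq (h : SymbolPair S d a g) (v : Eu M) (w : Eu m) (x : Eu M) (η : Eu m)
    {u : ℝ} (hu : u ≠ 0) : dirDeriv (v, w, 0) g (x, η, u) = dirDeriv (v, w, 0) a (x, η, u⁻¹) := by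
  rw [dirDeriv_eq_deriv_line h.contDiff, dirDeriv_eq_deriv_line h.contDiff_inv]
  congr 1
  ext r
  simpa using h.inv_eq (x + r • v) (η + r • w) u hu

theorem dirDeriv_inv_zero (h : SymbolPair S d a g) (v : Eu M) (w : Eu m) (x : Eu M) (η : Eu m) :
    dirDeriv (v, w, 0) g (x, η, 0) = 0 := by
  rw [dirDeriv_eq_deriv_line h.contDiff_inv]
  have : (fun r : ℝ => g ((x, η, 0) + r • (v, w, 0))) = fun _ => 0 := by
    ext r
    simpa using h.inv_zero (x + r • v) (η + r • w)
  rw [this, deriv_const]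

/-- Differentiate the homogeneity relation along a line. The condition 1 < ‖η‖ is open, so the
relation holds for nearby points of the line; the inner factor s lowers the degree by one. -/
theorem homogeneous_dirDeriv (h : SymbolPair S d a g) (w : Eu m) (τ : ℝ) (x : Eu M) (η : Eu m)
    (t : ℝ) (hη : 1 < ‖η‖) (s : ℝ) (hs : 1 ≤ s) :
    dirDeriv (0, w, τ) a (x, s • η, s * t) = (s : ℂ) ^ (d - 1) * dirDeriv (0, w, τ) a (x, η, t) := by
  have hs0 : (s : ℂ) ≠ 0 := by exact_mod_cast (one_pos.trans_le hs).ne'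
  have hev : (fun r : ℝ => a ((x, s • η, s * t) + (s * r) • (0, w, τ))) =ᶠ[𝓝 0]
      fun r => (s : ℂ) ^ d * a ((x, η, t) + r • (0, w, τ)) := by
    have hc : ContinuousAt (fun r : ℝ => ‖η + r • w‖) 0 := by fun_prop
    filter_upwards [hc.eventually_const_lt (by simpa using hη)] with r hr
    have := h.homogeneous x (η + r • w) (t + r * τ) hr s hs
    simp only [Prod.smul_mk, Prod.mk_add_mk, smul_zero, add_zero, smul_eq_mul]
    rw [← this, smul_add, smul_smul, mul_add, mul_assoc]
  have h1 := hev.deriv_eq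
  have h2 : deriv (fun r : ℝ => a ((x, s • η, s * t) + (s * r) • (0, w, τ))) 0 =
      (s : ℂ) * dirDeriv (0, w, τ) a (x, s • η, s * t) := by
    rw [dirDeriv_eq_deriv_line h.contDiff]
    have := deriv_comp_mul_left s (fun r : ℝ => a ((x, s • η, s * t) + r • (0, w, τ))) 0
    rw [mul_zero] at this
    rw [this, Complex.real_smul]
  have hdiff : DifferentiableAt ℝ (fun r : ℝ => a ((x, η, t) + r • (0, w, τ))) 0 :=
    (h.contDiff.comp (by fun_prop)).differentiable (by simp) 0
  rw [h2, deriv_const_mul _ hdiff, ← dirDeriv_eq_deriv_line h.contDiff] at h1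
  rw [zpow_sub_one₀ hs0]
  field_simp
  rw [mul_comm]
  exact h1

theorem dirX (hS : IsOpen S) (h : SymbolPair S d a g) (i : Fin M) :
    SymbolPair S d (dirDeriv (dirX M m i) a) (dirDeriv (dirX M m i) g) where
  contDiff := h.contDiff.dirDeriv _
  contDiff_inv := h.contDiff_inv.dirDeriv _
  bdd := h.bdd.dirDeriv hS _
  bdd_inv := h.bdd_inv.dirDeriv hS _
  inv_eq x η _ hu := h.dirDeriv_inv_eq _ 0 x η hu
  inv_zero x η := h.dirDeriv_inv_zero _ 0 x η
  homogeneous x η t hη s hs := by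
    rw [dirDeriv_eq_deriv_line h.contDiff, dirDeriv_eq_deriv_line h.contDiff]
    have : (fun r : ℝ => a ((x, s • η, s * t) + r • _root_.dirX M m i)) =
        fun r => (s : ℂ) ^ d * a ((x, η, t) + r • _root_.dirX M m i) := by
      ext r
      simpa [_root_.dirX] using h.homogeneous (x + r • EuclideanSpace.single i 1) η t hη s hs
    rw [this, deriv_const_mul]
    exact (h.contDiff.comp (by fun_prop)).differentiable (by simp) 0

theorem dirXi (hS : IsOpen S) (h : SymbolPair S d a g) (i : Fin m) :
    SymbolPair S (d - 1) (dirDeriv (dirXi M m i) a) (dirDeriv (dirXi M m i) g) where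
  contDiff := h.contDiff.dirDeriv _
  contDiff_inv := h.contDiff_inv.dirDeriv _
  bdd := h.bdd.dirDeriv hS _
  bdd_inv := h.bdd_inv.dirDeriv hS _
  inv_eq x η _ hu := h.dirDeriv_inv_eq 0 _ x η hu
  inv_zero x η := h.dirDeriv_inv_zero 0 _ x η
  homogeneous := h.homogeneous_dirDeriv _ 0

theorem locSmoothBdd_last (hS : IsOpen S) :
    LocSmoothBdd S fun p : Eu M × (Eu m × ℝ) => (p.2.2 : ℂ) :=
  LocSmoothBdd.of_snd hS (γ := fun v : Eu m × ℝ => (v.2 : ℂ))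
    (Complex.ofRealCLM.contDiff.comp contDiff_snd)

theorem contDiff_last : ContDiff ℝ ∞ fun p : Eu M × (Eu m × ℝ) => (p.2.2 : ℂ) :=
  Complex.ofRealCLM.contDiff.comp (contDiff_snd.comp contDiff_snd)

/-- With u = 1/t, d/dt = −u² d/du; the factor u² preserves the vanishing at u = 0. -/
theorem dirXin (hS : IsOpen S) (h : SymbolPair S d a g) :
    SymbolPair S (d - 1) (dirDeriv (dirXin M m) a)
      (fun p => -((p.2.2 : ℂ) * ((p.2.2 : ℂ) * dirDeriv (dirXin M m) g p))) where
  contDiff := h.contDiff.dirDeriv _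
  contDiff_inv := (contDiff_last.mul (contDiff_last.mul (h.contDiff_inv.dirDeriv _))).neg
  bdd := h.bdd.dirDeriv hS _
  bdd_inv v := by
    have h1 := (locSmoothBdd_last hS v).mul hS ((locSmoothBdd_last hS v).mul hS
      (h.bdd_inv.dirDeriv hS (_root_.dirXin M m) v))
    simpa using (LocSmoothBddAt.const (0 : ℂ)).sub hS h1
  inv_eq x η u hu := by
    have hui : u⁻¹ ≠ 0 := inv_ne_zero hu
    have hev : (fun t : ℝ => a (x, η, t)) =ᶠ[𝓝 u⁻¹] fun t => g (x, η, t⁻¹) := by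
      filter_upwards [isOpen_ne.mem_nhds hui] with t ht
      rw [h.inv_eq x η t⁻¹ (inv_ne_zero ht), inv_inv]
    have h1 : HasDerivAt (fun s : ℝ => g (x, η, s)) (dirDeriv (_root_.dirXin M m) g (x, η, u))
        (u⁻¹)⁻¹ := by
      rw [inv_inv]
      exact hasDerivAt_last h.contDiff_inv x η u
    have h2 := (h1.scomp u⁻¹ (hasDerivAt_inv hui)).deriv
    have h3 := congrFun (deriv_last h.contDiff x η) u⁻¹
    rw [← h3, hev.deriv_eq]
    refine Eq.trans ?_ h2.symm
    simp only [Complex.real_smul]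
    push_cast
    have : (u : ℂ) ≠ 0 := by exact_mod_cast hu
    field_simp
  inv_zero x η := by simp
  homogeneous := h.homogeneous_dirDeriv 0 1

/-- Multiplication by `t` followed by the removal of the constant term at infinity. -/
theorem mul_last (hS : IsOpen S) (h : SymbolPair S d a g) :
    SymbolPair S (d + 1) (fun p => (p.2.2 : ℂ) * a p - lastQuotient g (p.1, p.2.1, 0))
      (fun p => lastQuotient g p - lastQuotient g (p.1, p.2.1, 0)) := by
  have hq := h.contDiff_inv.lastQuotient
  have hqb := h.bdd_inv.lastQuotient hS
  have hc : ContDiff ℝ ∞ fun p : Eu M × (Eu m × ℝ) => lastQuotient g (p.1, p.2.1, 0) :=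
    hq.comp (by fun_prop)
  have hcb : LocSmoothBdd S fun p : Eu M × (Eu m × ℝ) => lastQuotient g (p.1, p.2.1, 0) :=
    LocSmoothBdd.comp_right (γ := fun v : Eu m × ℝ => (v.1, (0 : ℝ))) hS (by fun_prop) hqb
  have hmul : ∀ x η u, u ≠ 0 → lastQuotient g (x, η, u) = (u : ℂ)⁻¹ * a (x, η, u⁻¹) := by
    intro x η u hu
    have hu' : (u : ℂ) ≠ 0 := by exact_mod_cast hu
    have := mul_lastQuotient h.contDiff_inv x η u
    rw [h.inv_zero, sub_zero, h.inv_eq x η u hu] at this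
    rw [← this]
    field_simp
  refine ⟨(contDiff_last.mul h.contDiff).sub hc, hq.sub hc,
    fun v => ((locSmoothBdd_last hS v).mul hS (h.bdd v)).sub hS (hcb v),
    fun v => (hqb v).sub hS (hcb v), fun x η u hu => ?_, fun x η => sub_self _, ?_⟩
  · rw [hmul x η u hu]
    push_cast
    rfl
  · intro x η t hη s hs
    have hs0 : s ≠ 0 := (one_pos.trans_le hs).ne'
    have hs0' : (s : ℂ) ≠ 0 := by exact_mod_cast hs0
    have hcont1 : Continuous fun u : ℝ => lastQuotient g (x, s • η, s⁻¹ * u) :=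
      hq.continuous.comp (by fun_prop)
    have hcont2 : Continuous fun u : ℝ => (s : ℂ) ^ (d + 1) * lastQuotient g (x, η, u) :=
      continuous_const.mul (hq.continuous.comp (by fun_prop))
    -- The removed constant must itself be homogeneous of degree d + 1. For u ≠ 0 this is the
    -- homogeneity of t·a at t = 1/u; density carries it to u = 0.
    have heq := Continuous.ext_on (dense_compl_singleton (0 : ℝ)) hcont1 hcont2 (fun u hu => by
      have hu0 : u ≠ 0 := hu
      have hu' : (u : ℂ) ≠ 0 := by exact_mod_cast hu0
      rw [hmul _ _ _ (mul_ne_zero (inv_ne_zero hs0) hu0), hmul _ _ _ hu0, mul_inv, inv_inv,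
        h.homogeneous x η u⁻¹ hη s hs, zpow_add_one₀ hs0']
      push_cast
      field_simp)
    have h0 := congrFun heq 0
    simp only [mul_zero] at h0
    rw [h0, h.homogeneous x η t hη s hs, zpow_add_one₀ hs0']
    push_cast
    ring

/-- The smooth function required at τ = 0 is the difference quotient, since g vanishes there. -/
theorem memH_neg_one (h : SymbolPair S d a g) (x : Eu M) (η : Eu m) :
    MemH (-1) fun t => a (x, η, t) := by
  refine ⟨h.contDiff.comp (by fun_prop), fun u => lastQuotient g (x, η, u),
    (h.contDiff_inv.lastQuotient.comp (by fun_prop)).contDiffOn, fun u _ hu => ?_⟩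
  have hu' : (u : ℂ) ≠ 0 := by exact_mod_cast hu
  have := mul_lastQuotient h.contDiff_inv x η u
  rw [h.inv_zero, sub_zero, h.inv_eq x η u hu] at this
  simp only
  rw [← this, zpow_neg_one, inv_mul_cancel_left₀ hu']

/-- Each derivative in ξ' or ξ_n lowers the degree by one, each x-derivative by none. The chart at
infinity changes with every ξ_n-derivative and is therefore existentially quantified. -/
theorem exists_jointDeriv (hS : IsOpen S) (h : SymbolPair S d a g) (β : Fin M → ℕ)
    (α : Fin m → ℕ) (k : ℕ) :
    ∃ g', SymbolPair S (d - k - (∑ i, α i : ℕ)) (jointDeriv β α k a) g' := by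
  have hiter : ∀ (v : Eu M × (Eu m × ℝ)) (c : ℤ)
      (_ : ∀ d a, (∃ g, SymbolPair S d a g) → ∃ g', SymbolPair S (d - c) (dirDeriv v a) g')
      (n : ℕ) (d : ℤ) (a), (∃ g, SymbolPair S d a g) →
      ∃ g', SymbolPair S (d - n * c) ((dirDeriv v)^[n] a) g' := by
    intro v c hv n d a ha
    induction n with
    | zero => simpa using ha
    | succ n ih =>
      rw [Function.iterate_succ_apply']
      have := hv _ _ ih
      rwa [show d - n * c - c = d - ((n + 1 : ℕ) : ℤ) * c by push_cast; ring] at this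
  have hmulti : ∀ {ι : Type} (e : ι → Eu M × (Eu m × ℝ)) (c : ℤ)
      (_ : ∀ i d a, (∃ g, SymbolPair S d a g) → ∃ g', SymbolPair S (d - c) (dirDeriv (e i) a) g')
      (α : ι → ℕ) (l : List ι) (d : ℤ) (a), (∃ g, SymbolPair S d a g) →
      ∃ g', SymbolPair S (d - (l.map α).sum * c) (dirMultiDeriv e α l a) g' := by
    intro ι e c he α l d a ha
    induction l with
    | nil => simpa [dirMultiDeriv] using ha
    | cons i l ih =>
      have := hiter (e i) c (he i) (α i) _ _ ih
      rw [show d - (l.map α).sum * c - (α i : ℤ) * c = d - ((i :: l).map α).sum * c by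
        rw [List.map_cons, List.sum_cons]; push_cast; ring] at this
      exact this
  have h1 := hiter (_root_.dirXin M m) 1 (fun _ _ ⟨_, hg⟩ => ⟨_, hg.dirXin hS⟩) k d a ⟨g, h⟩
  have h2 := hmulti (_root_.dirXi M m) 1 (fun i _ _ ⟨_, hg⟩ => ⟨_, hg.dirXi hS i⟩) α
    (List.finRange m) _ _ h1
  have h3 := hmulti (_root_.dirX M m) 0 (fun i _ _ ⟨_, hg⟩ => ⟨_, by
    rw [sub_zero]; exact hg.dirX hS i⟩) β (List.finRange M) _ _ h2
  rw [mul_one, mul_one, mul_zero, sub_zero, ← Fin.sum_univ_def] at h3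
  exact h3

end SymbolPair

end Pairs

/-! ### The L₂ estimates and the conclusion. -/

noncomputable section Estimates

open MeasureTheory

variable {M m : ℕ} {S : Set (Eu M)}

/-- The function `(1 + t²)^{-1/2}`. -/
def invBracket (t : ℝ) : ℝ := (Real.sqrt (1 + t ^ 2))⁻¹

theorem continuous_invBracket : Continuous invBracket :=
  Continuous.inv₀ (by fun_prop) fun t => (Real.sqrt_pos.2 (by positivity)).ne'

theorem invBracket_nonneg (t : ℝ) : 0 ≤ invBracket t := by unfold invBracket; positivity

theorem memLp_invBracket : MemLp invBracket 2 := by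
  rw [memLp_two_iff_integrable_sq continuous_invBracket.aestronglyMeasurable]
  refine integrable_inv_one_add_sq.congr (Eventually.of_forall fun t => ?_)
  simp only [invBracket]
  rw [inv_pow, Real.sq_sqrt (by positivity)]

theorem eLpNorm_invBracket_comp {s : ℝ} (hs : 0 < s) :
    eLpNorm (fun t => invBracket (s⁻¹ * t)) 2 volume =
      ENNReal.ofReal (s ^ (1 / 2 : ℝ)) * eLpNorm invBracket 2 volume := by
  have h1 := eLpNorm_map_measure (p := 2) (μ := volume) (f := fun t : ℝ => s⁻¹ * t)
    (g := invBracket) continuous_invBracket.aestronglyMeasurable (by fun_prop)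
  rw [Real.map_volume_mul_left (inv_ne_zero hs.ne'), inv_inv, abs_of_pos hs,
    eLpNorm_smul_measure_of_ne_top (by simp)] at h1
  rw [← Function.comp_def invBracket, ← h1, smul_eq_mul,
    ENNReal.ofReal_rpow_of_nonneg hs.le (by norm_num)]
  simp

/-- Here s = max(1, ‖η‖/2). Scaling to norm 2 rather than 1 keeps η₀ strictly inside the region of
homogeneity whenever s ≠ 1. -/
theorem exists_scaling (η : Eu m) : ∃ (s : ℝ) (η₀ : Eu m), 1 ≤ s ∧ ‖η₀‖ ≤ 2 ∧ η = s • η₀ ∧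
    (s = 1 ∨ 1 < ‖η₀‖) ∧ s ≤ bracket η ∧ bracket η ≤ 3 * s := by
  rcases le_total ‖η‖ 2 with h | h
  · refine ⟨1, η, le_rfl, h, (one_smul _ _).symm, Or.inl rfl, ?_, ?_⟩
    · rw [bracket, Real.one_le_sqrt]
      nlinarith [sq_nonneg ‖η‖]
    · rw [bracket, Real.sqrt_le_left (by norm_num)]
      nlinarith [norm_nonneg η]
  · have hp : 0 < ‖η‖ := by linarith
    have hn : ‖(‖η‖ / 2)⁻¹ • η‖ = 2 := by
      rw [norm_smul, norm_inv, Real.norm_of_nonneg (by positivity)]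
      field_simp
    refine ⟨‖η‖ / 2, (‖η‖ / 2)⁻¹ • η, by linarith, hn.le, ?_, Or.inr (by rw [hn]; norm_num), ?_, ?_⟩
    · rw [smul_inv_smul₀ (by positivity)]
    · exact Real.le_sqrt_of_sq_le (by nlinarith)
    · rw [bracket, Real.sqrt_le_left (by positivity)]
      nlinarith

namespace SymbolPair

variable {d : ℤ} {a g : Eu M × (Eu m × ℝ) → ℂ}

/-- Compactness in (η, t) for |t| ≤ 1, and in (η, u) for |u| = |1/t| ≤ 1, where a = u ·
`lastQuotient g`. That the chart vanishes at infinity is what gives the decay 1/|t|. -/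
theorem exists_norm_le_invBracket (hS : IsOpen S) (h : SymbolPair S d a g) :
    ∃ C : ℝ, 0 ≤ C ∧ ∀ x ∈ S, ∀ η : Eu m, ‖η‖ ≤ 2 → ∀ t,
      ‖a (x, η, t)‖ ≤ C * invBracket t := by
  have hK : IsCompact (Metric.closedBall (0 : Eu m) 2 ×ˢ Icc (-1 : ℝ) 1) :=
    (isCompact_closedBall _ _).prod isCompact_Icc
  obtain ⟨N₁, -, hKN₁, h₁⟩ := LocSmoothBdd.exists_isOpen_of_isCompact hS hK fun v _ => h.bdd v
  obtain ⟨N₂, -, hKN₂, h₂⟩ := LocSmoothBdd.exists_isOpen_of_isCompact hS hK fun v _ =>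
    h.bdd_inv.lastQuotient hS v
  obtain ⟨C₁, hC₁⟩ := h₁.bounded
  obtain ⟨C₂, hC₂⟩ := h₂.bounded
  obtain ⟨C, hC0, hC₁C, hC₂C⟩ : ∃ C : ℝ, 0 ≤ C ∧ C₁ ≤ C ∧ C₂ ≤ C :=
    ⟨max 0 (max C₁ C₂), le_max_left _ _, le_max_of_le_right (le_max_left _ _),
      le_max_of_le_right (le_max_right _ _)⟩
  -- The 2 absorbs √(1 + t²) ≤ 2 for |t| ≤ 1 and √(1 + t²) ≤ 2|t| for |t| ≥ 1.
  refine ⟨C * 2, by positivity, fun x hx η hη t => ?_⟩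
  have hpos : 0 < Real.sqrt (1 + t ^ 2) := Real.sqrt_pos.2 (by positivity)
  have hKmem : ∀ u : ℝ, |u| ≤ 1 → (η, u) ∈ Metric.closedBall (0 : Eu m) 2 ×ˢ Icc (-1 : ℝ) 1 :=
    fun u hu => mk_mem_prod (by simpa using hη) (abs_le.1 hu)
  rw [mul_assoc]
  rcases le_total |t| 1 with ht | ht
  · have h1 : ‖a (x, η, t)‖ ≤ C :=
      (hC₁ (x, η, t) (mk_mem_prod hx (hKN₁ (hKmem t ht)))).trans hC₁C
    refine h1.trans (le_mul_of_one_le_right hC0 ?_)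
    rw [invBracket, ← div_eq_mul_inv, one_le_div hpos, Real.sqrt_le_left (by norm_num)]
    nlinarith [sq_abs t, abs_nonneg t]
  · have ht0 : t ≠ 0 := fun h0 => by rw [h0, abs_zero] at ht; linarith
    have htp : 0 < |t| := abs_pos.2 ht0
    have hinv : |t⁻¹| ≤ 1 := by rw [abs_inv]; exact inv_le_one_of_one_le₀ ht
    have h1 : ‖lastQuotient g (x, η, t⁻¹)‖ ≤ C :=
      (hC₂ (x, η, t⁻¹) (mk_mem_prod hx (hKN₂ (hKmem _ hinv)))).trans hC₂C
    have h2 := mul_lastQuotient h.contDiff_inv x η t⁻¹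
    rw [h.inv_zero, sub_zero, h.inv_eq x η _ (inv_ne_zero ht0), inv_inv] at h2
    rw [← h2, norm_mul, mul_comm, Complex.norm_real, Real.norm_eq_abs, abs_inv]
    refine mul_le_mul h1 ?_ (by positivity) hC0
    rw [invBracket, ← div_eq_mul_inv, le_div_iff₀ hpos, inv_mul_le_iff₀ htp,
      Real.sqrt_le_left (by positivity)]
    nlinarith [sq_abs t]

theorem rpow_le_of_scaling {s b : ℝ} (e : ℝ) (hs : 0 < s) (h1 : s ≤ b) (h2 : b ≤ 3 * s) :
    s ^ e ≤ 3 ^ |e| * b ^ e := by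
  have hb : 0 < b := hs.trans_le h1
  rcases le_total 0 e with he | he
  · calc s ^ e ≤ b ^ e := Real.rpow_le_rpow hs.le h1 he
      _ ≤ 3 ^ |e| * b ^ e := le_mul_of_one_le_left (by positivity)
        (Real.one_le_rpow (by norm_num) (abs_nonneg e))
  · have h3 : (3 * s) ^ e ≤ b ^ e := Real.rpow_le_rpow_of_nonpos hb h2 he
    rw [Real.mul_rpow (by norm_num) hs.le] at h3
    rw [abs_of_nonpos he]
    calc s ^ e = 3 ^ (-e) * (3 ^ e * s ^ e) := by
          rw [← mul_assoc, ← Real.rpow_add (by norm_num)]; simp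
      _ ≤ 3 ^ (-e) * b ^ e := by gcongr

/-- Write a(x, η, t) = s^d a(x, η₀, t/s) with ‖η₀‖ ≤ 2 and s comparable to ⟨η⟩. The dilation
contributes s^{1/2} to the L₂-norm. -/
theorem exists_eLpNorm_le (hS : IsOpen S) (h : SymbolPair S d a g) :
    ∃ C : ℝ, ∀ x ∈ S, ∀ η : Eu m, eLpNorm (fun t : ℝ => a (x, η, t)) 2 volume ≤
      ENNReal.ofReal (C * bracket η ^ ((d : ℝ) + 1 / 2)) := by
  obtain ⟨C, hC0, hC⟩ := h.exists_norm_le_invBracket hS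
  set K : ℝ := (eLpNorm invBracket 2 volume).toReal
  have hK : eLpNorm invBracket 2 volume = ENNReal.ofReal K :=
    (ENNReal.ofReal_toReal memLp_invBracket.eLpNorm_ne_top).symm
  have hK0 : 0 ≤ K := ENNReal.toReal_nonneg
  refine ⟨C * K * 3 ^ |(d : ℝ) + 1 / 2|, fun x hx η => ?_⟩
  obtain ⟨s, η₀, hs1, hη₀, hη, hcase, hb1, hb2⟩ := exists_scaling η
  have hs : 0 < s := one_pos.trans_le hs1
  have hhom : ∀ t, a (x, η, t) = (s : ℂ) ^ d * a (x, η₀, s⁻¹ * t) := by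
    intro t
    rcases hcase with rfl | hn
    · simp [hη]
    · rw [← h.homogeneous x η₀ _ hn s hs1, ← hη, mul_inv_cancel_left₀ hs.ne']
  have hle : ∀ t, ‖a (x, η, t)‖ ≤ (s ^ d * C) * ‖invBracket (s⁻¹ * t)‖ := by
    intro t
    rw [hhom, norm_mul, norm_zpow, Complex.norm_real, Real.norm_of_nonneg hs.le,
      Real.norm_of_nonneg (invBracket_nonneg _), mul_assoc]
    gcongr
    exact hC x hx η₀ hη₀ _
  refine (eLpNorm_le_mul_eLpNorm_of_ae_le_mul (Eventually.of_forall hle) 2).trans ?_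
  rw [eLpNorm_invBracket_comp hs, hK, ← ENNReal.ofReal_mul (by positivity),
    ← ENNReal.ofReal_mul (by positivity)]
  refine ENNReal.ofReal_le_ofReal ?_
  have h1 := rpow_le_of_scaling ((d : ℝ) + 1 / 2) hs hb1 hb2
  rw [Real.rpow_add hs, Real.rpow_intCast] at h1
  calc s ^ d * C * (s ^ (1 / 2 : ℝ) * K) = C * K * (s ^ d * s ^ (1 / 2 : ℝ)) := by ring
    _ ≤ C * K * (3 ^ |(d : ℝ) + 1 / 2| * bracket η ^ ((d : ℝ) + 1 / 2)) := by gcongr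
    _ = _ := by ring

end SymbolPair

theorem hMinusOne_eq {f : ℝ → ℂ} {p : Polynomial ℂ}
    (hp : MemH (-1) fun t => f t - p.eval (t : ℂ)) :
    hMinusOne f = fun t => f t - p.eval (t : ℂ) := by
  have h : ∃ p : Polynomial ℂ, MemH (-1) (fun t => f t - p.eval (t : ℂ)) := ⟨p, hp⟩
  rw [hMinusOne, dif_pos h, polynomialPart_unique h.choose_spec hp]

/-- `h_{-1}(t^k f)` is again the first component of a pair. -/
theorem SymbolPair.exists_hMinusOneMul (hS : IsOpen S) {f : Eu M → Eu m → ℝ → ℂ}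
    {g : Eu M × (Eu m × ℝ) → ℂ} (h : SymbolPair S 0 (joint f) g) (k : ℕ) :
    ∃ g', SymbolPair S k (joint (hMinusOneMul k f)) g' := by
  -- The pair is built with an explicit polynomial part: multiplication by t turns p into X·p plus
  -- the removed constant. Uniqueness of the polynomial part then identifies it with the one chosen
  -- in `hMinusOne`.
  have key : ∃ a g', SymbolPair S k a g' ∧ ∀ x η, ∃ p : Polynomial ℂ, ∀ t : ℝ,
      a (x, η, t) = (t : ℂ) ^ k * f x η t - p.eval (t : ℂ) := by
    induction k with
    | zero => exact ⟨joint f, g, by simpa using h, fun x η => ⟨0, fun t => by simp [joint]⟩⟩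
    | succ k ih =>
      obtain ⟨a, g', hag, hp⟩ := ih
      refine ⟨_, _, by simpa using hag.mul_last hS, fun x η => ?_⟩
      obtain ⟨p, hp⟩ := hp x η
      refine ⟨Polynomial.X * p + Polynomial.C (lastQuotient g' (x, η, 0)), fun t => ?_⟩
      simp only [hp, Polynomial.eval_add, Polynomial.eval_mul, Polynomial.eval_X,
        Polynomial.eval_C]
      ring
  obtain ⟨a, g', hag, hp⟩ := key
  refine ⟨g', ?_⟩
  convert hag using 1
  ext ⟨x, η, t⟩
  obtain ⟨p, hp⟩ := hp x η
  have hmem := hag.memH_neg_one x η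
  simp only [hp] at hmem
  simp only [joint, hMinusOneMul, hMinusOne_eq hmem, hp]

theorem CircleFactor.symbolPair {G : Eu M × (Eu m × ℝ) → ℂ} (h : CircleFactor G) (hS : IsOpen S)
    (hb : LocSmoothBdd S G) :
    SymbolPair S 0 (joint fun x η t => G (x, η, circleAngle t))
      (fun p => G (p.1, p.2.1, 2 * Real.arctan p.2.2)) where
  contDiff := h.contDiff.comp (contDiff_fst.prodMk ((contDiff_fst.comp contDiff_snd).prodMk
    (contDiff_circleAngle.comp (contDiff_snd.comp contDiff_snd))))
  contDiff_inv := h.contDiff.comp (contDiff_fst.prodMk ((contDiff_fst.comp contDiff_snd).prodMk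
    (contDiff_const.mul (Real.contDiff_arctan.comp (contDiff_snd.comp contDiff_snd)))))
  bdd := LocSmoothBdd.comp_right (γ := fun v : Eu m × ℝ => (v.1, circleAngle v.2)) hS
    (contDiff_fst.prodMk (contDiff_circleAngle.comp contDiff_snd)) hb
  bdd_inv := LocSmoothBdd.comp_right (γ := fun v : Eu m × ℝ => (v.1, 2 * Real.arctan v.2)) hS
    (contDiff_fst.prodMk (contDiff_const.mul (Real.contDiff_arctan.comp contDiff_snd))) hb
  inv_eq x η u hu := by
    obtain ⟨A, -, -, -, hA⟩ := h.extends_disc x η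
    have hp : Function.Periodic (fun φ => G (x, η, φ)) (2 * Real.pi) := fun φ => by
      simp only [hA]
      rw [Complex.ofReal_add, add_mul, Complex.ofReal_mul, Complex.ofReal_ofNat,
        Complex.exp_add, Complex.exp_two_pi_mul_I, mul_one]
    exact (circleAngle_inv hu hp).symm
  inv_zero x η := by
    obtain ⟨A, -, hA1, -, hA⟩ := h.extends_disc x η
    simp [hA, hA1]
  homogeneous x η t hη s hs := by
    simpa [joint] using h.homogeneous x η t hη.le s hs

theorem CircleFactor.smoothHPlusValued {G : Eu M × (Eu m × ℝ) → ℂ} (h : CircleFactor G) :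
    SmoothHPlusValued fun x η t => G (x, η, circleAngle t) := by
  have hball : ∀ R, SymbolPair (Metric.ball 0 R) 0 _ _ := fun R =>
    h.symbolPair Metric.isOpen_ball (h.contDiff.locSmoothBdd_ball R)
  -- The smoothness fields of a pair are global in x and do not involve `S`, so the radius is
  -- arbitrary.
  refine ⟨(hball 1).contDiff, fun x η => ?_, fun k => ?_⟩
  · obtain ⟨A, hA, hA1, -, hAG⟩ := h.extends_disc x η
    exact memHPlus_comp_circleAngle (G := fun φ => G (x, η, φ)) (h.contDiff.comp (by fun_prop))
      hA hA1 hAG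
  · obtain ⟨g', hg'⟩ := (hball 1).exists_hMinusOneMul Metric.isOpen_ball k
    exact hg'.contDiff

theorem CircleFactor.exists_seminormHPlus_le {G : Eu M × (Eu m × ℝ) → ℂ} (h : CircleFactor G)
    (hS : IsOpen S) (hb : LocSmoothBdd S G) (β : Fin M → ℕ) (α : Fin m → ℕ) (k k' : ℕ) :
    ∃ C : ℝ, ∀ x ∈ S, ∀ η, seminormHPlus β α k k' (fun x η t => G (x, η, circleAngle t)) x η ≤
      ENNReal.ofReal (C * bracket η ^ ((0 : ℝ) + 1 / 2 - k + k' - (∑ i, α i : ℕ) : ℝ)) := by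
  obtain ⟨g', hg'⟩ := (h.symbolPair hS hb).exists_hMinusOneMul hS k'
  obtain ⟨g'', hg''⟩ := hg'.exists_jointDeriv hS β α k
  obtain ⟨C, hC⟩ := hg''.exists_eLpNorm_le hS
  refine ⟨C, fun x hx η => ?_⟩
  have he : (((k' : ℤ) - k - (∑ i, α i : ℕ) : ℤ) : ℝ) + 1 / 2 =
      (0 : ℝ) + 1 / 2 - k + k' - (∑ i, α i : ℕ) := by
    push_cast
    ring
  rw [← he]
  simp only [seminormHPlus, symDeriv_eq_jointDeriv hg'.contDiff]
  exact hC x hx η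

theorem CircleFactor.memSHPlus {G : Eu M × (Eu m × ℝ) → ℂ} (h : CircleFactor G)
    (hb : LocSmoothBdd univ G) : MemSHPlus 0 fun x η t => G (x, η, circleAngle t) := by
  refine ⟨h.smoothHPlusValued, fun β α k k' => ?_⟩
  obtain ⟨C, hC⟩ := h.exists_seminormHPlus_le isOpen_univ hb β α k k'
  exact ⟨C, fun x η => hC x (mem_univ x) η⟩

/-- Each ball gives a constant that is valid near its centre. Admissible constants at a point form
an upward closed, hence convex, set, so a partition of unity glues them to a continuous function of
x. -/
theorem CircleFactor.memSHPlusLoc {G : Eu M × (Eu m × ℝ) → ℂ} (h : CircleFactor G) :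
    MemSHPlusLoc 0 fun x η t => G (x, η, circleAngle t) := by
  refine ⟨h.smoothHPlusValued, fun β α k k' => ?_⟩
  have hbr : ∀ η : Eu m, 0 ≤ bracket η := fun η => Real.sqrt_nonneg _
  obtain ⟨C, hC⟩ := exists_continuous_forall_mem_convex_of_local_const (X := Eu M) (E := ℝ)
    (t := fun x => {C | ∀ η, seminormHPlus β α k k' (fun x η t => G (x, η, circleAngle t)) x η ≤
      ENNReal.ofReal (C * bracket η ^ ((0 : ℝ) + 1 / 2 - k + k' - (∑ i, α i : ℕ) : ℝ))})
    (fun x => by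
      refine OrdConnected.convex ⟨fun c hc c' _ y hy η => (hc η).trans ?_⟩
      refine ENNReal.ofReal_le_ofReal (mul_le_mul_of_nonneg_right hy.1 ?_)
      exact Real.rpow_nonneg (hbr η) _)
    (fun x => by
      obtain ⟨C, hC⟩ := h.exists_seminormHPlus_le Metric.isOpen_ball
        (h.contDiff.locSmoothBdd_ball (‖x‖ + 1)) β α k k'
      refine ⟨C, ?_⟩
      filter_upwards [Metric.isOpen_ball.mem_nhds
        (by simp : x ∈ Metric.ball (0 : Eu M) (‖x‖ + 1))] with y hy η
      exact hC y hy η)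
  exact ⟨C, C.continuous, hC⟩

theorem CircleFactor.homogeneousZeroTangential {G : Eu M × (Eu m × ℝ) → ℂ} (h : CircleFactor G) :
    HomogeneousZeroTangential fun x η t => G (x, η, circleAngle t) := h.homogeneous

end Estimates

theorem theorem2p6 (m : ℕ) (θ : ℝ) (q : Eu (m + 1) → Eu m → ℝ → ℂ)
    (hq : IsSymbolLoc 0 q) (hhom : HomogeneousZero q) (htrans : ZeroTransmission q)
    (hray : AvoidsRay θ q) :
    ∃ qm qp f g : Eu (m + 1) → Eu m → ℝ → ℂ,
      (∀ x η t, q x η t = q x 0 1 * qm x η t * qp x η t) ∧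
      (∀ x η, InvertibleHolomorphicExtension {z : ℂ | z.im < 0} (qp x η)) ∧
      (∀ x η, InvertibleHolomorphicExtension {z : ℂ | 0 < z.im} (qm x η)) ∧
      (∀ x η t, qp x η t = 1 + f x η t) ∧
      (∀ x η t, (starRingEnd ℂ) (qm x η t) = 1 + g x η t) ∧
      MemSHPlusLoc 0 f ∧ HomogeneousZeroTangential f ∧
      MemSHPlusLoc 0 g ∧ HomogeneousZeroTangential g ∧
      (IsSymbol 0 q → (∃ c : ℝ, 0 < c ∧ ∀ x η t, c ≤ ‖q x η t‖) →
        MemSHPlus 0 f ∧ MemSHPlus 0 g) := by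
  have hΨ := circleLog_circleLogSymbol hq.1 hhom htrans hray
  have hF := hΨ.circleFactor
  have hG := hΨ.conj.circleFactor
  set F := expHardy (circleLogSymbol θ q)
  set G := expHardy fun p => (starRingEnd ℂ) (circleLogSymbol θ q p)
  -- The minus factor is the conjugate of the plus factor of the conjugate logarithm, so g has the
  -- same properties as f by one argument.
  refine ⟨fun x η t => (starRingEnd ℂ) (1 + G (x, η, circleAngle t)),
    fun x η t => 1 + F (x, η, circleAngle t), fun x η t => F (x, η, circleAngle t),
    fun x η t => G (x, η, circleAngle t), fun x η t => ?_, fun x η => hF.invertible_lower x η,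
    fun x η => (hG.invertible_lower x η).conj, fun _ _ _ => rfl, fun _ _ _ => Complex.conj_conj _,
    hF.memSHPlusLoc, hF.homogeneousZeroTangential, hG.memSHPlusLoc, hG.homogeneousZeroTangential,
    ?_⟩
  · rw [mul_assoc, mul_comm ((starRingEnd ℂ) _), expHardy_mul_conj hΨ, exp_circleLogSymbol hray]
  · rintro hsym ⟨c, hc, hlow⟩
    -- Bounds of q uniform in x, together with inf |q| > 0, make the logarithm bounded with all
    -- derivatives uniformly in x; every later construction preserves this.
    have hb : LocSmoothBdd univ (circleLogSymbol θ q) :=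
      LocSmoothBdd.circleLogSymbol hq.1 hhom htrans hray isOpen_univ hsym.locSmoothBdd fun v =>
        ⟨c, hc, Eventually.of_forall fun v' x _ => by
          obtain ⟨η, t, h⟩ := exists_circleSymbol_eq q (x, v')
          rw [h]
          exact hlow _ _ _⟩
    have hb' : LocSmoothBdd univ fun p => (starRingEnd ℂ) (circleLogSymbol θ q p) := fun v =>
      (hb v).clm_comp isOpen_univ (Complex.conjCLE : ℂ →L[ℝ] ℂ)
    exact ⟨hF.memSHPlus (hb.expHardy hΨ.contDiff isOpen_univ),
      hG.memSHPlus (hb'.expHardy hΨ.conj.contDiff isOpen_univ)⟩
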